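/- A network is a multigraph together with a mark in a complete separable metric space \(\Xi\) at each vertex and, for each edge, one mark in \(\Xi\) at each of its endpoints. Let \(\mathcal G_*(\Xi)\) be the space of isomorphism classes of connected locally finite rooted networks \((G,o)\) with marks in \(\Xi\), with the distance \(1/(1+\alpha)\), where \(\alpha\) is the supremum of those \(r>0\) for which there is a rooted isomorphism of the balls of radius \(\lfloor r\rfloor\) around the roots such that corresponding marks have distance less than \(1/r\). Let \(\mathcal G_{**}(\Xi)\) be the analogous space of networks with an ordered pair of distinguished vertices. A Borel probability measure \(\mu\) on \(\mathcal G_*(\Xi)\) is *unimodular* if for all Borel \(f:\mathcal G_{**}(\Xi)\to[0,\infty]\), \[ \int \sum_{x\in V(G)} f(G,o,x)\,d\mu(G,o)=\int \sum_{x\in V(G)} f(G,x,o)\,d\mu(G,o). \] For a unimodular \(\mu\), a *percolation on \(\mu\) with finite components* is a pair \((\mu',A)\), where \(\mu'\) is a unimodular probability measure on \(\mathcal G_*(\Xi\times\mathbb N^{\mathbb N})\) whose image under taking the first coordinate of every mark is \(\mu\), and \(A\subseteq\Xi\times\mathbb N^{\mathbb N}\) is a Borel set such that \(K(A)\), the set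 of vertices that can be reached from the root by edges both of whose marks lie in \(A\), is \(\mu'\)-a.s. finite. (For \(\Xi=\mathbb N^{\mathbb N}\), one may identify \(\Xi\times\mathbb N^{\mathbb N}\) with \(\Xi\) by a homeomorphism.) Write \(n(x,A)\) for the number of vertices \(y\) that are joined to \(x\) by an edge with some mark not in \(A\). The measure \(\mu\) is *amenable* if \[ \inf_{(\mu',A)}\int \frac{1}{|K(A)|}\sum_{x\in K(A)} n(x,A)\,d\mu'(G,o)=0, \] where the infimum is over all percolations on \(\mu\) with finite components. Let \(\mathcal R\subseteq\Xi\times\Xi\) be a closed set. An *\(\mathcal R\)-coupling* of \(\mu_1\) to \(\mu_2\) is a Borel probability measure \(\nu\) on \(\mathcal G_*(\Xi\times\Xi)\) that is concentrated on networks all of whose marks lie in \(\mathcal R\) and whose marginal given by taking the \(i\)th coordinate of each mark is \(\mu_i\) for \(i=1,2\); if one exists, \(\mu_1\) is *\(\mathcal R\)-related* to \(\mu_2\). **Proposition (Coupling From Amenability).** Let \(\mathcal R\subseteq\Xi\times\Xi\) be closed. If \(\mu_1\) and \(\mu_2\) are amenable unimodular probability measures on \(\mathcal G_*(\Xi)\)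 and \(\mu_1\) is \(\mathcal R\)-related to \(\mu_2\), then there is a unimodular \(\mathcal R\)-coupling of \(\mu_1\) to \(\mu_2\). -/

import Mathlib

open MeasureTheory
open scoped ENNReal

/-- A network with marks in `Ξ`: a multigraph (loops and multiple edges are allowed) whose vertices
carry a mark and whose edges carry two marks, one at each endpoint.  Each undirected edge is
represented by its two orientations `d` and `rev d` in `D`; the mark of the edge at the endpoint
`src d` is `dmark d`.  Connected locally finite networks are countable, so there is no loss in
taking vertices and edges from `Type`. -/
structure Network (Ξ : Type*) where
  V : Type
  D : Type
  src : D → V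
  rev : D → D
  rev_rev : ∀ d, rev (rev d) = d
  rev_ne : ∀ d, rev d ≠ d
  vmark : V → Ξ
  dmark : D → Ξ

namespace Network

/-- The other endpoint of an oriented edge. -/
def tgt {Ξ : Type*} (N : Network Ξ) (d : N.D) : N.V := N.src (N.rev d)

/-- The simple graph recording which distinct vertices are adjacent. -/
def graph {Ξ : Type*} (N : Network Ξ) : SimpleGraph N.V :=
  SimpleGraph.fromRel fun x y => ∃ d, N.src d = x ∧ N.tgt d = y

/-- The simple graph recording which distinct vertices are joined by an edge both of whose marks
lie in `A`. -/
def openGraph {Ξ : Type*} (N : Network Ξ) (A : Set Ξ) : SimpleGraph N.V :=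
  SimpleGraph.fromRel fun x y =>
    ∃ d, N.src d = x ∧ N.tgt d = y ∧ N.dmark d ∈ A ∧ N.dmark (N.rev d) ∈ A

/-- The `A`-component of `x`: the vertices that can be reached from `x` by edges both of whose
marks lie in `A`. -/
def component {Ξ : Type*} (N : Network Ξ) (A : Set Ξ) (x : N.V) : Set N.V :=
  {y | (N.openGraph A).Reachable x y}

/-- The number of vertices `y` joined to `x` by an edge with some mark not in `A`. -/
noncomputable def cut {Ξ : Type*} (N : Network Ξ) (A : Set Ξ) (x : N.V) : ℝ≥0∞ :=
  ({y | ∃ d, N.src d = x ∧ N.tgt d = y ∧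
    (N.dmark d ∉ A ∨ N.dmark (N.rev d) ∉ A)}.encard : ℝ≥0∞)

/-- The subnetwork induced on a set of vertices. -/
def induce {Ξ : Type*} (N : Network Ξ) (S : Set N.V) : Network Ξ where
  V := {v : N.V // v ∈ S}
  D := {d : N.D // N.src d ∈ S ∧ N.tgt d ∈ S}
  src d := ⟨N.src d.1, d.2.1⟩
  rev d := ⟨N.rev d.1, d.2.2, by simpa [tgt, N.rev_rev] using d.2.1⟩
  rev_rev d := Subtype.ext (N.rev_rev d.1)
  rev_ne d h := N.rev_ne d.1 (congrArg Subtype.val h)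
  vmark v := N.vmark v.1
  dmark d := N.dmark d.1

/-- The ball of radius `n` around `o` for the graph distance, as a subnetwork. -/
noncomputable def ball {Ξ : Type*} (N : Network Ξ) (o : N.V) (n : ℕ) : Network Ξ :=
  N.induce {v | N.graph.edist o v ≤ (n : ℕ∞)}

/-- The network obtained by applying `f` to every mark. -/
def map {Ξ Ξ' : Type*} (f : Ξ → Ξ') (N : Network Ξ) : Network Ξ' where
  V := N.V
  D := N.D
  src := N.src
  rev := N.rev
  rev_rev := N.rev_rev
  rev_ne := N.rev_ne
  vmark v := f (N.vmark v)
  dmark d := f (N.dmark d)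

/-- An isomorphism of the underlying multigraphs (marks are not taken into account). -/
structure Iso {Ξ Ξ' : Type*} (N : Network Ξ) (M : Network Ξ') where
  onV : N.V ≃ M.V
  onD : N.D ≃ M.D
  src_onD : ∀ d, M.src (onD d) = onV (N.src d)
  rev_onD : ∀ d, M.rev (onD d) = onD (N.rev d)

namespace Iso

def refl {Ξ : Type*} (N : Network Ξ) : Iso N N where
  onV := Equiv.refl _
  onD := Equiv.refl _
  src_onD _ := rfl
  rev_onD _ := rfl

def symm {Ξ Ξ' : Type*} {N : Network Ξ} {M : Network Ξ'} (φ : Iso N M) : Iso M N where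
  onV := φ.onV.symm
  onD := φ.onD.symm
  src_onD d := by
    rw [Equiv.eq_symm_apply, ← φ.src_onD, Equiv.apply_symm_apply]
  rev_onD d := by
    rw [Equiv.eq_symm_apply, ← φ.rev_onD, Equiv.apply_symm_apply]

def trans {Ξ Ξ' Ξ'' : Type*} {N : Network Ξ} {M : Network Ξ'} {P : Network Ξ''}
    (φ : Iso N M) (ψ : Iso M P) : Iso N P where
  onV := φ.onV.trans ψ.onV
  onD := φ.onD.trans ψ.onD
  src_onD d := by simp [ψ.src_onD, φ.src_onD]
  rev_onD d := by simp [ψ.rev_onD, φ.rev_onD]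

end Iso

end Network

/-- A connected locally finite network with `k + 1` distinguished vertices (in order, repetitions
allowed), the first of which is the root. -/
structure PointedNetwork (Ξ : Type*) (k : ℕ) where
  net : Network Ξ
  connected : net.graph.Connected
  locallyFinite : ∀ v, {d | net.src d = v}.Finite
  pt : Fin (k + 1) → net.V

namespace PointedNetwork

/-- The root. -/
def root {Ξ : Type*} {k : ℕ} (N : PointedNetwork Ξ k) : N.net.V := N.pt 0

/-- Isomorphism of pointed networks: it preserves all marks and the distinguished vertices. -/
instance setoid (Ξ : Type*) (k : ℕ) : Setoid (PointedNetwork Ξ k) where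
  r N M := ∃ φ : N.net.Iso M.net,
    (∀ v, M.net.vmark (φ.onV v) = N.net.vmark v) ∧
    (∀ d, M.net.dmark (φ.onD d) = N.net.dmark d) ∧
    ∀ i, φ.onV (N.pt i) = M.pt i
  iseqv :=
    { refl := fun N => ⟨Network.Iso.refl _, fun _ => rfl, fun _ => rfl, fun _ => rfl⟩
      symm := by
        rintro N M ⟨φ, hv, hd, hp⟩
        refine ⟨φ.symm, fun v => ?_, fun d => ?_, fun i => ?_⟩
        · simpa [Network.Iso.symm] using (hv (φ.onV.symm v)).symm
        · simpa [Network.Iso.symm] using (hd (φ.onD.symm d)).symm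
        · simp [Network.Iso.symm, ← hp i]
      trans := by
        rintro N M P ⟨φ, hv, hd, hp⟩ ⟨ψ, hv', hd', hp'⟩
        exact ⟨φ.trans ψ, fun v => (hv' _).trans (hv v), fun d => (hd' _).trans (hd d),
          fun i => (congrArg ψ.onV (hp i)).trans (hp' i)⟩ }

/-- Applying a function to all marks. -/
def map {Ξ Ξ' : Type*} {k : ℕ} (f : Ξ → Ξ') (N : PointedNetwork Ξ k) : PointedNetwork Ξ' k where
  net := N.net.map f
  connected := N.connected
  locallyFinite := N.locallyFinite
  pt := N.pt

/-- The same network with other distinguished vertices. -/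
def withPt {Ξ : Type*} {k l : ℕ} (N : PointedNetwork Ξ k) (p : Fin (l + 1) → N.net.V) :
    PointedNetwork Ξ l where
  net := N.net
  connected := N.connected
  locallyFinite := N.locallyFinite
  pt := p

/-- There is an isomorphism of the balls of radius `⌊r⌋` around the roots, matching the
distinguished vertices in these balls (in particular the roots), such that each pair of
corresponding marks has distance less than `1 / r`. -/
def Close {Ξ : Type*} [MetricSpace Ξ] {k : ℕ} (r : ℝ) (N M : PointedNetwork Ξ k) : Prop :=
  ∃ φ : (N.net.ball N.root ⌊r⌋₊).Iso (M.net.ball M.root ⌊r⌋₊),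
    (∀ v, dist ((N.net.ball N.root ⌊r⌋₊).vmark v)
      ((M.net.ball M.root ⌊r⌋₊).vmark (φ.onV v)) < 1 / r) ∧
    (∀ d, dist ((N.net.ball N.root ⌊r⌋₊).dmark d)
      ((M.net.ball M.root ⌊r⌋₊).dmark (φ.onD d)) < 1 / r) ∧
    ∀ i v, v.1 = N.pt i ↔ (φ.onV v).1 = M.pt i

end PointedNetwork

/-- The space of isomorphism classes of connected locally finite networks with `k + 1`
distinguished vertices. -/
def NetworkSpace (Ξ : Type*) (k : ℕ) := Quotient (PointedNetwork.setoid Ξ k)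

/-- The space of isomorphism classes of rooted connected locally finite networks. -/
abbrev GStar (Ξ : Type*) := NetworkSpace Ξ 0

/-- The space of isomorphism classes of connected locally finite networks with an ordered pair of
distinguished vertices. -/
abbrev GStarStar (Ξ : Type*) := NetworkSpace Ξ 1

namespace NetworkSpace

/-- The isomorphism class of a pointed network. -/
def mk {Ξ : Type*} {k : ℕ} (N : PointedNetwork Ξ k) : NetworkSpace Ξ k :=
  Quotient.mk (PointedNetwork.setoid Ξ k) N

/-- A specific network in an isomorphism class. -/
noncomputable def rep {Ξ : Type*} {k : ℕ} (a : NetworkSpace Ξ k) : PointedNetwork Ξ k :=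
  Quotient.out a

/-- Applying a function to all marks, on isomorphism classes. -/
def map {Ξ Ξ' : Type*} {k : ℕ} (f : Ξ → Ξ') : NetworkSpace Ξ k → NetworkSpace Ξ' k :=
  Quotient.map (PointedNetwork.map f) (by
    rintro N M ⟨φ, hv, hd, hp⟩
    exact ⟨⟨φ.onV, φ.onD, φ.src_onD, φ.rev_onD⟩, fun v => congrArg f (hv v),
      fun d => congrArg f (hd d), hp⟩)

/-- The distance `1 / (1 + α)`, where `α` is the supremum of the `r > 0` such that representatives
of the two classes are close at scale `r`. -/
noncomputable def gdist {Ξ : Type*} [MetricSpace Ξ] {k : ℕ} (a b : NetworkSpace Ξ k) : ℝ≥0∞ :=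
  (1 + ⨆ (r : ℝ) (_ : 0 < r ∧ PointedNetwork.Close r a.rep b.rep), ENNReal.ofReal r)⁻¹

/-- The topology given by the distance `gdist`. -/
instance topology (Ξ : Type*) [MetricSpace Ξ] (k : ℕ) : TopologicalSpace (NetworkSpace Ξ k) where
  IsOpen U := ∀ a ∈ U, ∃ ε : ℝ≥0∞, 0 < ε ∧ ∀ b, gdist a b < ε → b ∈ U
  isOpen_univ := fun _ _ => ⟨1, one_pos, fun _ _ => trivial⟩
  isOpen_inter := by
    intro s t hs ht a ha
    obtain ⟨ε, hε, h⟩ := hs a ha.1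
    obtain ⟨δ, hδ, h'⟩ := ht a ha.2
    exact ⟨min ε δ, lt_min hε hδ, fun b hb =>
      ⟨h b (hb.trans_le (min_le_left _ _)), h' b (hb.trans_le (min_le_right _ _))⟩⟩
  isOpen_sUnion := by
    intro S hS a ha
    obtain ⟨t, ht, hat⟩ := ha
    obtain ⟨ε, hε, h⟩ := hS t ht a hat
    exact ⟨ε, hε, fun b hb => ⟨t, ht, h b hb⟩⟩

instance measurableSpace (Ξ : Type*) [MetricSpace Ξ] (k : ℕ) : MeasurableSpace (NetworkSpace Ξ k) :=
  borel _

instance borelSpace (Ξ : Type*) [MetricSpace Ξ] (k : ℕ) : BorelSpace (NetworkSpace Ξ k) := ⟨rfl⟩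

end NetworkSpace

/-- A unimodular probability measure on rooted networks: one that obeys the Mass-Transport
Principle. -/
structure IsUnimodular {Ξ : Type*} [MetricSpace Ξ] (μ : Measure (GStar Ξ)) : Prop where
  isProbabilityMeasure : IsProbabilityMeasure μ
  massTransport : ∀ f : GStarStar Ξ → ℝ≥0∞, Measurable f →
    ∫⁻ a, ∑' x : a.rep.net.V, f (.mk (a.rep.withPt ![a.rep.root, x])) ∂μ =
      ∫⁻ a, ∑' x : a.rep.net.V, f (.mk (a.rep.withPt ![x, a.rep.root])) ∂μ

/-- `ν` is an `R`-coupling of `μ₁` to `μ₂`: a probability measure on rooted networks with marks in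
`Ξ × Ξ`, concentrated on networks all of whose marks lie in `R`, whose marginals given by the two
coordinates of the marks are `μ₁` and `μ₂`. -/
structure IsRCoupling {Ξ : Type*} [MetricSpace Ξ] (R : Set (Ξ × Ξ)) (μ₁ μ₂ : Measure (GStar Ξ))
    (ν : Measure (GStar (Ξ × Ξ))) : Prop where
  isProbabilityMeasure : IsProbabilityMeasure ν
  marks_mem : ∀ᵐ a ∂ν, (∀ v, a.rep.net.vmark v ∈ R) ∧ ∀ d, a.rep.net.dmark d ∈ R
  map_fst : ν.map (NetworkSpace.map Prod.fst) = μ₁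
  map_snd : ν.map (NetworkSpace.map Prod.snd) = μ₂

/-- `μ₁` is `R`-related to `μ₂`: there is an `R`-coupling. -/
def IsRRelated {Ξ : Type*} [MetricSpace Ξ] (R : Set (Ξ × Ξ)) (μ₁ μ₂ : Measure (GStar Ξ)) : Prop :=
  ∃ ν : Measure (GStar (Ξ × Ξ)), IsRCoupling R μ₁ μ₂ ν

/-- Baire space with its usual metric. -/
noncomputable instance baireMetric : MetricSpace (ℕ → ℕ) := PiNat.metricSpaceNatNat

/-- `(ν, A)` is a percolation on `μ` with only finite components.  The marks of the percolation
are pairs, of which the first coordinate is the original mark and the second one is an additional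
mark in Baire space.  (If `Ξ` is Baire space, then `Ξ × (ℕ → ℕ)` is homeomorphic to `Ξ`, so that
such pairs may be coded by marks in `Ξ`.) -/
structure IsFinitePercolation {Ξ : Type*} [MetricSpace Ξ] (μ : Measure (GStar Ξ))
    (ν : Measure (GStar (Ξ × (ℕ → ℕ)))) (A : Set (Ξ × (ℕ → ℕ))) : Prop where
  unimodular : IsUnimodular ν
  measurableSet : MeasurableSet[borel (Ξ × (ℕ → ℕ))] A
  map_fst : ν.map (NetworkSpace.map Prod.fst) = μ
  finite_component : ∀ᵐ a ∂ν, (a.rep.net.component A a.rep.root).Finite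

/-- The isoperimetric constant `ι_E(μ)`: the infimum, over the percolations on `μ` with only finite
components, of the expectation of the total cut of the component of the root divided by
its number of vertices. -/
noncomputable def isoperimetricConstant {Ξ : Type*} [MetricSpace Ξ] (μ : Measure (GStar Ξ)) :
    ℝ≥0∞ :=
  ⨅ (ν : Measure (GStar (Ξ × (ℕ → ℕ)))) (A : Set (Ξ × (ℕ → ℕ))) (_ : IsFinitePercolation μ ν A),
    ∫⁻ a, (∑' x : a.rep.net.component A a.rep.root, a.rep.net.cut A x) /
      ((a.rep.net.component A a.rep.root).encard : ℝ≥0∞) ∂ν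

/-- Amenability of a measure on rooted networks. -/
def IsAmenable {Ξ : Type*} [MetricSpace Ξ] (μ : Measure (GStar Ξ)) : Prop :=
  isoperimetricConstant μ = 0

/-! An `R`-coupling `ν` need not be unimodular, but it can be averaged over the choice of root.
Write `κ(o, x) = 1[x ∈ K(o)] / |K(o)|` for the uniform distribution on the percolation cluster of
`o` (`kap`). It is a symmetric transport of total mass 1, and by the Mass-Transport Principle the
expected cut at the root equals the expected average cut of the root's cluster
(`lintegral_rootCut`). If this cut is small, then `κ(o, x) = κ(o, y)` for most pairs of nearby
vertices `x`, `y`.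

The percolation lives on `μ₁`, not on `ν`. However, `μ₁`, `μ₂` and `ν` have the same law of unmarked
networks, so `κ` is replaced by its conditional expectation `t` given the unmarked network
(`exists_condexp_kap`). A conditional Jensen inequality for the positive part shows that `t` is
still almost invariant (`discrepancy_condexp_le`), and mass transport shows that the incoming mass
of `t` is a.s. 1 (`exists_transport`).

Now move the root of `ν` to `x` with weight `t(o, x)` (`moved`). The marks do not change, so they
remain in `R`. Since `t` does not depend on marks, moving the root commutes with taking a
coordinate; as `μ₁` and `μ₂` are unimodular and the incoming mass is 1, both marginals are preserved
(`map_moved`). For test functions supported on bounded local configurations, the moved law obeys the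
Mass-Transport Principle up to the discrepancy of `t` (`lintegral_moved_vsum_le`), which can be made
arbitrarily small.

Couplings with prescribed marginals form a tight set (`isTightMeasureSet_of_marginals`), because
networks with bounded balls and marks in compact sets form compact sets (`isCompact_boundedSet`). A
weak limit of moved couplings therefore exists. It has the right marginals by continuity of the
coordinate maps, has marks in the closed set `R`, and is unimodular (`isUnimodular_of_tendsto`). -/

namespace Network

/-! ### Balls in networks and isomorphisms between balls. -/

variable {Ξ Ξ' Ξ'' : Type*}

/-- The closed ball for the graph distance, as a set of vertices. -/
def cball (N : Network Ξ) (o : N.V) (n : ℕ) : Set N.V := {v | N.graph.edist o v ≤ (n : ℕ∞)}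

/-- The oriented edges with both endpoints in the closed ball. -/
def eball (N : Network Ξ) (o : N.V) (n : ℕ) : Set N.D :=
  {d | N.src d ∈ N.cball o n ∧ N.tgt d ∈ N.cball o n}

variable {N : Network Ξ} {M : Network Ξ'}

theorem graph_adj {x y : N.V} :
    N.graph.Adj x y ↔ x ≠ y ∧ ∃ d, N.src d = x ∧ N.tgt d = y := by
  simp only [graph, SimpleGraph.fromRel_adj]
  refine and_congr_right fun _ => ⟨?_, Or.inl⟩
  rintro (h | ⟨d, h1, h2⟩)
  · exact h
  · exact ⟨N.rev d, h2, by simpa [tgt, N.rev_rev] using h1⟩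

theorem self_mem_cball (v : N.V) (n : ℕ) : v ∈ N.cball v n := by simp [cball]

theorem mem_cball_comm {v w : N.V} {n : ℕ} : w ∈ N.cball v n ↔ v ∈ N.cball w n := by
  simp only [cball, Set.mem_ofPred_eq, SimpleGraph.edist_comm]

theorem cball_mono {v : N.V} {n m : ℕ} (h : n ≤ m) : N.cball v n ⊆ N.cball v m :=
  fun _ hw => le_trans (b := (n : ℕ∞)) hw (Nat.cast_le.2 h)

theorem eball_mono {v : N.V} {n m : ℕ} (h : n ≤ m) : N.eball v n ⊆ N.eball v m :=
  fun _ hd => ⟨cball_mono h hd.1, cball_mono h hd.2⟩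

theorem mem_cball_trans {u v w : N.V} {a b : ℕ} (h : u ∈ N.cball v a) (h' : w ∈ N.cball u b) :
    w ∈ N.cball v (a + b) := by
  refine SimpleGraph.edist_triangle.trans ((add_le_add h h').trans ?_)
  push_cast; rfl

theorem tgt_mem_cball (d : N.D) : N.tgt d ∈ N.cball (N.src d) 1 := by
  simp only [cball, Set.mem_ofPred_eq, Nat.cast_one, SimpleGraph.edist_le_one_iff_adj_or_eq,
    graph_adj]
  by_cases h : N.src d = N.tgt d
  · exact Or.inr h
  · exact Or.inl ⟨h, d, rfl, rfl⟩

theorem mem_cball_zero {v w : N.V} : w ∈ N.cball v 0 ↔ w = v := by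
  rw [cball, Set.mem_ofPred_eq, Nat.cast_zero, nonpos_iff_eq_zero,
    SimpleGraph.edist_eq_zero_iff, eq_comm]

theorem mem_cball_succ {v w : N.V} {m : ℕ} (h : w ∈ N.cball v (m + 1)) :
    w = v ∨ ∃ d, N.src d = v ∧ w ∈ N.cball (N.tgt d) m := by
  have hne : N.graph.edist v w ≠ ⊤ := fun h' => by simp [cball, h'] at h
  obtain ⟨p, hp⟩ := SimpleGraph.exists_walk_of_edist_ne_top hne
  cases p with
  | nil => exact Or.inl rfl
  | cons ha p =>
    obtain ⟨-, d, rfl, rfl⟩ := graph_adj.1 ha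
    refine Or.inr ⟨d, rfl, (SimpleGraph.edist_le p).trans ?_⟩
    have : ((p.length + 1 : ℕ) : ℕ∞) ≤ (m + 1 : ℕ) := by
      rw [SimpleGraph.Walk.length_cons] at hp
      exact hp.le.trans h
    have h2 : p.length + 1 ≤ m + 1 := by exact_mod_cast this
    exact_mod_cast Nat.le_of_succ_le_succ h2

theorem exists_mem_cball (h : N.graph.Connected) (v w : N.V) : ∃ n, w ∈ N.cball v n := by
  obtain ⟨p, hp⟩ := h.exists_walk_length_eq_edist v w
  exact ⟨p.length, hp.ge⟩

theorem finite_cball (hN : ∀ v, {d | N.src d = v}.Finite) (n : ℕ) (v : N.V) :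
    (N.cball v n).Finite := by
  induction n generalizing v with
  | zero => exact (Set.finite_singleton v).subset fun w hw => mem_cball_zero.1 hw
  | succ n ih =>
    refine ((Set.finite_singleton v).union ((hN v).biUnion fun d _ => ih (N.tgt d))).subset ?_
    intro w hw
    rcases mem_cball_succ hw with h | ⟨d, h1, h2⟩
    · exact Or.inl h
    · exact Or.inr (Set.mem_biUnion (show d ∈ {d | N.src d = v} from h1) h2)

theorem finite_eball (hN : ∀ v, {d | N.src d = v}.Finite) (n : ℕ) (v : N.V) :
    (N.eball v n).Finite :=
  ((finite_cball hN n v).biUnion fun w _ => hN w).subset fun d hd =>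
    Set.mem_biUnion hd.1 (show d ∈ {d' | N.src d' = N.src d} from rfl)

namespace Iso

theorem tgt_onD (φ : Iso N M) (d : N.D) : M.tgt (φ.onD d) = φ.onV (N.tgt d) := by
  rw [tgt, φ.rev_onD, φ.src_onD]; rfl

theorem mem_cball_image_global (φ : Iso N M) {v w : N.V} {m : ℕ} (hm : w ∈ N.cball v m) :
    φ.onV w ∈ M.cball (φ.onV v) m := by
  induction m generalizing v with
  | zero => obtain rfl := mem_cball_zero.1 hm; exact self_mem_cball _ _
  | succ m ih =>
    rcases mem_cball_succ hm with rfl | ⟨d, rfl, hd⟩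
    · exact self_mem_cball _ _
    · have := tgt_mem_cball (φ.onD d)
      rw [φ.src_onD, φ.tgt_onD] at this
      rw [add_comm]
      exact mem_cball_trans this (ih hd)

theorem mem_cball_iff_global (φ : Iso N M) {v w : N.V} {m : ℕ} :
    w ∈ N.cball v m ↔ φ.onV w ∈ M.cball (φ.onV v) m := by
  refine ⟨φ.mem_cball_image_global, fun h => ?_⟩
  have := φ.symm.mem_cball_image_global h
  simpa [Iso.symm] using this

section Balls

variable {o : N.V} {o' : M.V} {n : ℕ}

/-- Distances are those of the whole networks, while `φ` only sees the balls. The condition `a + m ≤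
n` keeps a path of length at most `m` from `v` inside the ball, so that `φ` can be applied to it
edge by edge. -/
theorem mem_cball_image (φ : (N.ball o n).Iso (M.ball o' n)) (m a : ℕ) (v w : N.V)
    (hv : v ∈ N.cball o n) (hw : w ∈ N.cball o n) (hva : v ∈ N.cball o a) (ha : a + m ≤ n)
    (hvw : w ∈ N.cball v m) :
    (φ.onV ⟨w, hw⟩).1 ∈ M.cball (φ.onV ⟨v, hv⟩).1 m := by
  induction m generalizing a v with
  | zero =>
    obtain rfl := mem_cball_zero.1 hvw
    exact self_mem_cball _ _
  | succ m ih =>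
    rcases mem_cball_succ hvw with rfl | ⟨d, rfl, hd⟩
    · exact self_mem_cball _ _
    · have ht : N.tgt d ∈ N.cball o (a + 1) := mem_cball_trans hva (tgt_mem_cball d)
      have ht' : N.tgt d ∈ N.cball o n := cball_mono (by omega) ht
      have := ih (a + 1) (N.tgt d) ht' ht (by omega) hd
      let d' : (N.ball o n).D := ⟨d, hv, ht'⟩
      have h1 : M.src (φ.onD d').1 = (φ.onV ⟨N.src d, hv⟩).1 :=
        congrArg Subtype.val (φ.src_onD d')
      have h2 : M.tgt (φ.onD d').1 = (φ.onV ⟨N.tgt d, ht'⟩).1 :=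
        congrArg Subtype.val (φ.tgt_onD d')
      have h3 := tgt_mem_cball (φ.onD d').1
      rw [h1, h2] at h3
      rw [add_comm]
      exact mem_cball_trans h3 this

theorem mem_cball_iff (φ : (N.ball o n).Iso (M.ball o' n))
    (ho : (φ.onV ⟨o, self_mem_cball o n⟩).1 = o') {m a : ℕ} {v w : N.V}
    (hv : v ∈ N.cball o n) (hw : w ∈ N.cball o n) (hva : v ∈ N.cball o a) (ha : a + m ≤ n) :
    w ∈ N.cball v m ↔ (φ.onV ⟨w, hw⟩).1 ∈ M.cball (φ.onV ⟨v, hv⟩).1 m := by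
  refine ⟨φ.mem_cball_image m a v w hv hw hva ha, fun h => ?_⟩
  have hva' : (φ.onV ⟨v, hv⟩).1 ∈ M.cball o' a := by
    have := φ.mem_cball_image a 0 o v (self_mem_cball o n) hv (self_mem_cball o 0) (by omega) hva
    rwa [ho] at this
  have := φ.symm.mem_cball_image m a _ _ (φ.onV ⟨v, hv⟩).2 (φ.onV ⟨w, hw⟩).2 hva' ha h
  have h1 : φ.symm.onV ⟨(φ.onV ⟨w, hw⟩).1, (φ.onV ⟨w, hw⟩).2⟩ = ⟨w, hw⟩ :=
    φ.onV.symm_apply_apply ⟨w, hw⟩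
  have h2 : φ.symm.onV ⟨(φ.onV ⟨v, hv⟩).1, (φ.onV ⟨v, hv⟩).2⟩ = ⟨v, hv⟩ :=
    φ.onV.symm_apply_apply ⟨v, hv⟩
  rwa [h1, h2] at this

end Balls

/-- Restriction of an isomorphism of induced subnetworks to smaller sets of vertices. -/
def restrict {S T : Set N.V} {S' T' : Set M.V} (φ : (N.induce S).Iso (M.induce S'))
    (hT : T ⊆ S) (hT' : T' ⊆ S') (h : ∀ v (hv : v ∈ S), v ∈ T ↔ (φ.onV ⟨v, hv⟩).1 ∈ T') :
    (N.induce T).Iso (M.induce T') :=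
  have hsymm : ∀ w (hw : w ∈ S'), (φ.symm.onV ⟨w, hw⟩).1 ∈ T ↔ w ∈ T' := fun w hw => by
    have h1 : φ.onV (φ.symm.onV ⟨w, hw⟩) = ⟨w, hw⟩ := φ.onV.apply_symm_apply ⟨w, hw⟩
    have h2 := h (φ.symm.onV ⟨w, hw⟩).1 (φ.symm.onV ⟨w, hw⟩).2
    refine h2.trans ?_
    change (φ.onV (φ.symm.onV ⟨w, hw⟩)).1 ∈ T' ↔ w ∈ T'
    rw [h1]
  { onV :=
      { toFun := fun v => ⟨(φ.onV ⟨v.1, hT v.2⟩).1, (h _ _).1 v.2⟩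
        invFun := fun w => ⟨(φ.symm.onV ⟨w.1, hT' w.2⟩).1, (hsymm _ _).2 w.2⟩
        left_inv := fun v =>
          Subtype.ext (congrArg Subtype.val (φ.onV.symm_apply_apply ⟨v.1, hT v.2⟩) :)
        right_inv := fun w =>
          Subtype.ext (congrArg Subtype.val (φ.onV.apply_symm_apply ⟨w.1, hT' w.2⟩) :) }
    onD :=
      { toFun := fun d => ⟨(φ.onD ⟨d.1, hT d.2.1, hT d.2.2⟩).1, by
          have h1 : M.src (φ.onD ⟨d.1, hT d.2.1, hT d.2.2⟩).1
              = (φ.onV ⟨N.src d.1, hT d.2.1⟩).1 := congrArg Subtype.val (φ.src_onD _)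
          rw [h1]; exact (h _ _).1 d.2.1, by
          have h1 : M.tgt (φ.onD ⟨d.1, hT d.2.1, hT d.2.2⟩).1
              = (φ.onV ⟨N.tgt d.1, hT d.2.2⟩).1 := congrArg Subtype.val (φ.tgt_onD _)
          rw [h1]; exact (h _ _).1 d.2.2⟩
        invFun := fun d => ⟨(φ.symm.onD ⟨d.1, hT' d.2.1, hT' d.2.2⟩).1, by
          have h1 : N.src (φ.symm.onD ⟨d.1, hT' d.2.1, hT' d.2.2⟩).1
              = (φ.symm.onV ⟨M.src d.1, hT' d.2.1⟩).1 :=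
            congrArg Subtype.val (φ.symm.src_onD _)
          rw [h1]; exact (hsymm _ _).2 d.2.1, by
          have h1 : N.tgt (φ.symm.onD ⟨d.1, hT' d.2.1, hT' d.2.2⟩).1
              = (φ.symm.onV ⟨M.tgt d.1, hT' d.2.2⟩).1 :=
            congrArg Subtype.val (φ.symm.tgt_onD _)
          rw [h1]; exact (hsymm _ _).2 d.2.2⟩
        left_inv := fun d => Subtype.ext
          (congrArg Subtype.val (φ.onD.symm_apply_apply ⟨d.1, hT d.2.1, hT d.2.2⟩) :)
        right_inv := fun d => Subtype.ext
          (congrArg Subtype.val (φ.onD.apply_symm_apply ⟨d.1, hT' d.2.1, hT' d.2.2⟩) :) }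
    src_onD := fun d => Subtype.ext
      (congrArg Subtype.val (φ.src_onD ⟨d.1, hT d.2.1, hT d.2.2⟩) :)
    rev_onD := fun d => Subtype.ext
      (congrArg Subtype.val (φ.rev_onD ⟨d.1, hT d.2.1, hT d.2.2⟩) :) }

end Iso

end Network

/-! ### Closeness of pointed networks. -/

namespace PointedNetwork

open Network

variable {Ξ : Type*} {k l : ℕ}

theorem ball_iso_root {n : ℕ} {N M : PointedNetwork Ξ k}
    {φ : (N.net.ball N.root n).Iso (M.net.ball M.root n)}
    (h : ∀ i v, v.1 = N.pt i ↔ (φ.onV v).1 = M.pt i) :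
    (φ.onV ⟨N.root, self_mem_cball _ n⟩).1 = M.root := (h 0 _).1 rfl

theorem exists_ball_iso_of_equiv {N M : PointedNetwork Ξ k} (h : N ≈ M) (n : ℕ) :
    ∃ ψ : (N.net.ball N.root n).Iso (M.net.ball M.root n),
      (∀ v, (M.net.ball M.root n).vmark (ψ.onV v) = (N.net.ball N.root n).vmark v) ∧
      (∀ d, (M.net.ball M.root n).dmark (ψ.onD d) = (N.net.ball N.root n).dmark d) ∧
      ∀ i v, v.1 = N.pt i ↔ (ψ.onV v).1 = M.pt i := by
  obtain ⟨φ, hv, hd, hp⟩ := h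
  have hb : ∀ v, v ∈ N.net.cball N.root n ↔ φ.onV v ∈ M.net.cball M.root n := by
    intro v
    rw [φ.mem_cball_iff_global, show φ.onV N.root = M.root from hp 0]
  let ψ : (N.net.ball N.root n).Iso (M.net.ball M.root n) :=
    { onV := φ.onV.subtypeEquiv hb
      onD := φ.onD.subtypeEquiv fun d => by
        rw [φ.src_onD, φ.tgt_onD]; exact and_congr (hb _) (hb _)
      src_onD := fun d => Subtype.ext (φ.src_onD d.1)
      rev_onD := fun d => Subtype.ext (φ.rev_onD d.1) }
  refine ⟨ψ, fun v => hv v.1, fun d => hd d.1, fun i v => ?_⟩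
  rw [← hp i]
  exact (φ.onV.apply_eq_iff_eq (x := v.1)).symm

variable [MetricSpace Ξ]

/-- There is an isomorphism of the balls of radius `n` around the roots, matching the
distinguished vertices in these balls, such that corresponding marks have distance less than
`ε`. -/
def CloseWith (n : ℕ) (ε : ℝ) (N M : PointedNetwork Ξ k) : Prop :=
  ∃ φ : (N.net.ball N.root n).Iso (M.net.ball M.root n),
    (∀ v, dist ((N.net.ball N.root n).vmark v) ((M.net.ball M.root n).vmark (φ.onV v)) < ε) ∧
    (∀ d, dist ((N.net.ball N.root n).dmark d) ((M.net.ball M.root n).dmark (φ.onD d)) < ε) ∧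
    ∀ i v, v.1 = N.pt i ↔ (φ.onV v).1 = M.pt i

theorem close_iff {r : ℝ} {N M : PointedNetwork Ξ k} :
    Close r N M ↔ CloseWith ⌊r⌋₊ (1 / r) N M := Iff.rfl

/-- A ball about a vertex at distance at most `a` from the root lies in the ball about the root
whose radius is larger by `a`, so the isomorphism restricts. The case `a = 0` covers smaller radii
and additional points; the general case gives continuity of a change of root. -/
theorem closeWith_of_iso {n m a : ℕ} {ε : ℝ} {N M : PointedNetwork Ξ k}
    (φ : (N.net.ball N.root n).Iso (M.net.ball M.root n))
    (hφ : (∀ v, dist ((N.net.ball N.root n).vmark v)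
        ((M.net.ball M.root n).vmark (φ.onV v)) < ε) ∧
      (∀ d, dist ((N.net.ball N.root n).dmark d) ((M.net.ball M.root n).dmark (φ.onD d)) < ε) ∧
      ∀ i v, v.1 = N.pt i ↔ (φ.onV v).1 = M.pt i)
    (p : Fin (l + 1) → N.net.V) (q : Fin (l + 1) → M.net.V)
    (hp : p 0 ∈ N.net.cball N.root a) (ham : a + m ≤ n)
    (hpq : ∀ i v (hv : v ∈ N.net.cball N.root n), v = p i ↔ (φ.onV ⟨v, hv⟩).1 = q i) :
    CloseWith m ε (N.withPt p) (M.withPt q) := by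
  have hroot := ball_iso_root hφ.2.2
  have hp' : p 0 ∈ N.net.cball N.root n := cball_mono (by omega) hp
  have hq : (φ.onV ⟨p 0, hp'⟩).1 = q 0 := (hpq 0 _ hp').1 rfl
  have hq' : q 0 ∈ M.net.cball M.root a := by
    have := φ.mem_cball_image a 0 _ _ (self_mem_cball _ _) hp' (self_mem_cball _ _) (by omega) hp
    rwa [hroot, hq] at this
  refine ⟨φ.restrict (T := N.net.cball (p 0) m) (T' := M.net.cball (q 0) m)
    (fun v hv => cball_mono ham (mem_cball_trans hp hv))
    (fun v hv => cball_mono ham (mem_cball_trans hq' hv)) ?_, ?_, ?_, ?_⟩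
  · intro v hv
    have := φ.mem_cball_iff hroot hp' hv hp ham
    rwa [hq] at this
  · exact fun v => hφ.1 ⟨v.1, cball_mono ham (mem_cball_trans hp v.2)⟩
  · exact fun d => hφ.2.1 ⟨d.1, cball_mono ham (mem_cball_trans hp d.2.1),
      cball_mono ham (mem_cball_trans hp d.2.2)⟩
  · exact fun i v => hpq i v.1 _

theorem CloseWith.mono_radius {n m : ℕ} {ε : ℝ} {N M : PointedNetwork Ξ k} (hmn : m ≤ n)
    (h : CloseWith n ε N M) : CloseWith m ε N M := by
  obtain ⟨φ, hφ⟩ := h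
  exact closeWith_of_iso (a := 0) φ hφ N.pt M.pt (self_mem_cball _ _) (by omega)
    fun i v hv => hφ.2.2 i ⟨v, hv⟩

theorem CloseWith.mono {n m : ℕ} {ε δ : ℝ} {N M : PointedNetwork Ξ k}
    (h : CloseWith n ε N M) (hmn : m ≤ n) (hε : ε ≤ δ) : CloseWith m δ N M := by
  obtain ⟨φ, h1, h2, h3⟩ := h.mono_radius hmn
  exact ⟨φ, fun v => (h1 v).trans_le hε, fun v => (h2 v).trans_le hε, h3⟩

theorem CloseWith.symm {n : ℕ} {ε : ℝ} {N M : PointedNetwork Ξ k}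
    (h : CloseWith n ε N M) : CloseWith n ε M N := by
  obtain ⟨φ, h1, h2, h3⟩ := h
  refine ⟨φ.symm, fun v => ?_, fun d => ?_, fun i v => ?_⟩
  · have := h1 (φ.onV.symm v)
    rw [dist_comm]; simpa [Iso.symm] using this
  · have := h2 (φ.onD.symm d)
    rw [dist_comm]; simpa [Iso.symm] using this
  · have := h3 i (φ.onV.symm v)
    simpa [Iso.symm] using this.symm

theorem CloseWith.trans {n : ℕ} {ε δ : ℝ} {N M P : PointedNetwork Ξ k}
    (h : CloseWith n ε N M) (h' : CloseWith n δ M P) : CloseWith n (ε + δ) N P := by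
  obtain ⟨φ, h1, h2, h3⟩ := h
  obtain ⟨ψ, h1', h2', h3'⟩ := h'
  exact ⟨φ.trans ψ,
    fun v => (dist_triangle _ _ _).trans_lt (add_lt_add (h1 v) (h1' _)),
    fun v => (dist_triangle _ _ _).trans_lt (add_lt_add (h2 v) (h2' _)),
    fun i v => (h3 i v).trans (h3' i _)⟩

theorem closeWith_of_equiv {N M : PointedNetwork Ξ k} (h : N ≈ M) (n : ℕ) {ε : ℝ} (hε : 0 < ε) :
    CloseWith n ε N M := by
  obtain ⟨ψ, hv, hd, hp⟩ := exists_ball_iso_of_equiv h n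
  exact ⟨ψ, fun v => by rw [hv, dist_self]; exact hε, fun d => by rw [hd, dist_self]; exact hε, hp⟩

theorem CloseWith.refl {n : ℕ} {ε : ℝ} (hε : 0 < ε) (N : PointedNetwork Ξ k) :
    CloseWith n ε N N := closeWith_of_equiv (Setoid.refl N) n hε

theorem closeWith_congr {n : ℕ} {ε : ℝ} {N N' M M' : PointedNetwork Ξ k}
    (hN : N ≈ N') (hM : M ≈ M') : CloseWith n ε N M ↔ CloseWith n ε N' M' := by
  have aux : ∀ {N N' M M' : PointedNetwork Ξ k}, N ≈ N' → M ≈ M' →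
      CloseWith n ε N M → CloseWith n ε N' M' := by
    rintro N N' M M' hN hM ⟨φ, h1, h2, h3⟩
    obtain ⟨α, a1, a2, a3⟩ := exists_ball_iso_of_equiv (Setoid.symm hN) n
    obtain ⟨β, b1, b2, b3⟩ := exists_ball_iso_of_equiv hM n
    refine ⟨(α.trans φ).trans β, fun v => ?_, fun d => ?_, fun i v => ?_⟩
    · have := h1 (α.onV v)
      rw [a1] at this
      simpa [Iso.trans, b1] using this
    · have := h2 (α.onD d)
      rw [a2] at this
      simpa [Iso.trans, b2] using this
    · exact ((a3 i v).trans (h3 i _)).trans (b3 i _)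
  exact ⟨aux hN hM, aux (Setoid.symm hN) (Setoid.symm hM)⟩

end PointedNetwork

/-! ### The topology of the space of networks. -/

namespace NetworkSpace

open Network PointedNetwork Filter Topology Uniformity

variable {Ξ : Type*} {k l : ℕ}

theorem mk_eq_mk {N M : PointedNetwork Ξ k} : mk N = mk M ↔ N ≈ M := Quotient.eq

theorem mk_rep (a : NetworkSpace Ξ k) : mk a.rep = a := Quotient.out_eq a

theorem rep_mk (N : PointedNetwork Ξ k) : (mk N).rep ≈ N := Quotient.mk_out N

theorem exists_mk_eq (a : NetworkSpace Ξ k) : ∃ N, mk N = a := ⟨a.rep, mk_rep a⟩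

variable [MetricSpace Ξ]

theorem gdist_mk (N M : PointedNetwork Ξ k) : gdist (mk N) (mk M) =
    (1 + ⨆ (r : ℝ) (_ : 0 < r ∧ Close r N M), ENNReal.ofReal r)⁻¹ := by
  simp only [gdist, close_iff, closeWith_congr (rep_mk N) (rep_mk M)]

theorem isOpen_iff {U : Set (NetworkSpace Ξ k)} : IsOpen U ↔ ∀ N, mk N ∈ U →
    ∃ n : ℕ, ∀ M, CloseWith n (1 / (n + 1)) N M → mk M ∈ U := by
  have h0 : IsOpen U ↔ ∀ a ∈ U, ∃ ε : ℝ≥0∞, 0 < ε ∧ ∀ b, gdist a b < ε → b ∈ U := Iff.rfl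
  rw [h0]
  constructor
  · intro h N hN
    obtain ⟨ε, hε, h⟩ := h _ hN
    obtain ⟨n, hn⟩ := ENNReal.exists_inv_nat_lt hε.ne'
    refine ⟨n + 1, fun M hM => h _ (lt_of_le_of_lt ?_ hn)⟩
    rw [gdist_mk]
    refine ENNReal.inv_le_inv.2 (le_add_left ?_)
    have hc : Close ((n + 1 : ℕ) : ℝ) N M := by
      rw [close_iff, Nat.floor_natCast]
      refine hM.mono le_rfl ?_
      gcongr
      linarith
    refine le_trans ?_ (le_iSup₂_of_le ((n + 1 : ℕ) : ℝ) ⟨by positivity, hc⟩ le_rfl)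
    rw [ENNReal.ofReal_natCast]
    exact_mod_cast Nat.le_succ n
  · intro h a ha
    obtain ⟨N, rfl⟩ := exists_mk_eq a
    obtain ⟨n, hn⟩ := h N ha
    -- A smaller distance forces closeness at some scale `r > n + 1`, hence on balls of radius at
    -- least `n` with mark error less than `1 / (n + 1)`.
    refine ⟨(1 + (n + 1 : ℕ))⁻¹, by simp, fun b hb => ?_⟩
    obtain ⟨M, rfl⟩ := exists_mk_eq b
    rw [gdist_mk, ENNReal.inv_lt_inv, ENNReal.add_lt_add_iff_left ENNReal.one_ne_top] at hb
    simp only [lt_iSup_iff] at hb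
    obtain ⟨r, ⟨hr, hc⟩, hlt⟩ := hb
    rw [← ENNReal.ofReal_natCast, ENNReal.ofReal_lt_ofReal_iff hr] at hlt
    refine hn M ((close_iff.1 hc).mono (Nat.le_floor ?_) ?_)
    · refine le_trans ?_ hlt.le
      push_cast; linarith
    · rw [one_div, one_div]
      exact inv_anti₀ (by positivity) (by push_cast at hlt; exact hlt.le)

/-- The basic entourages of the space of networks. -/
def entourage (Ξ : Type*) [MetricSpace Ξ] (k n : ℕ) : Set (NetworkSpace Ξ k × NetworkSpace Ξ k) :=
  {p | CloseWith n (1 / (n + 1)) p.1.rep p.2.rep}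

theorem mk_mem_entourage {n : ℕ} {N M : PointedNetwork Ξ k} :
    (mk N, mk M) ∈ entourage Ξ k n ↔ CloseWith n (1 / (n + 1)) N M :=
  closeWith_congr (rep_mk N) (rep_mk M)

theorem entourage_anti {n m : ℕ} (h : n ≤ m) : entourage Ξ k m ⊆ entourage Ξ k n := by
  intro p hp
  refine CloseWith.mono hp h ?_
  gcongr

/-- The filter basis of the basic entourages. -/
def entourageBasis (Ξ : Type*) [MetricSpace Ξ] (k : ℕ) :
    FilterBasis (NetworkSpace Ξ k × NetworkSpace Ξ k) where
  sets := Set.range (entourage Ξ k)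
  nonempty := Set.range_nonempty _
  inter_sets := by
    rintro _ _ ⟨n, rfl⟩ ⟨m, rfl⟩
    exact ⟨_, ⟨max n m, rfl⟩, Set.subset_inter (entourage_anti (le_max_left _ _))
      (entourage_anti (le_max_right _ _))⟩

/-- The core of the uniformity on the space of networks. -/
def uniformCore (Ξ : Type*) [MetricSpace Ξ] (k : ℕ) : UniformSpace.Core (NetworkSpace Ξ k) :=
  UniformSpace.Core.mkOfBasis (entourageBasis Ξ k)
    (by rintro _ ⟨n, rfl⟩ x; exact CloseWith.refl (by positivity) _)
    (by rintro _ ⟨n, rfl⟩; exact ⟨_, ⟨n, rfl⟩, fun p hp => CloseWith.symm hp⟩)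
    (by
      rintro _ ⟨n, rfl⟩
      -- Two errors `1 / (2n + 2)` add up to `1 / (n + 1)`.
      refine ⟨_, ⟨2 * n + 1, rfl⟩, ?_⟩
      rintro ⟨a, b⟩ ⟨c, h1, h2⟩
      have h1' : CloseWith (2 * n + 1) (1 / ((2 * n + 1 : ℕ) + 1)) a.rep c.rep := h1
      have h2' : CloseWith (2 * n + 1) (1 / ((2 * n + 1 : ℕ) + 1)) c.rep b.rep := h2
      refine (h1'.trans h2').mono (by omega) (le_of_eq ?_)
      push_cast
      field_simp
      ring)

theorem uniformCore_hasBasis : (uniformCore Ξ k).uniformity.HasBasis (fun _ : ℕ => True)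
    (entourage Ξ k) := by
  have h := (entourageBasis Ξ k).hasBasis
  refine h.to_hasBasis ?_ ?_
  · rintro _ ⟨n, rfl⟩
    exact ⟨n, trivial, subset_rfl⟩
  · exact fun n _ => ⟨_, ⟨n, rfl⟩, subset_rfl⟩

/-- A countably generated uniformity yields pseudometrizability, so no triangle inequality for
`gdist` is needed. -/
theorem topology_eq : topology Ξ k = (uniformCore Ξ k).toTopologicalSpace := by
  refine TopologicalSpace.ext_iff.2 fun U => ?_
  rw [isOpen_iff, @isOpen_iff_mem_nhds (NetworkSpace Ξ k) (uniformCore Ξ k).toTopologicalSpace U]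
  simp only [UniformSpace.Core.nhds_toTopologicalSpace,
    (uniformCore_hasBasis.comap _).mem_iff, true_and]
  constructor
  · intro h a ha
    obtain ⟨N, rfl⟩ := exists_mk_eq a
    obtain ⟨n, hn⟩ := h N ha
    refine ⟨n, fun b hb => ?_⟩
    obtain ⟨M, rfl⟩ := exists_mk_eq b
    exact hn M (mk_mem_entourage.1 hb)
  · intro h N hN
    obtain ⟨n, hn⟩ := h _ hN
    exact ⟨n, fun M hM => hn (mk_mem_entourage.2 hM)⟩

/-- The uniform structure on the space of networks. -/
noncomputable abbrev uniformSpace (Ξ : Type*) [MetricSpace Ξ] (k : ℕ) :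
    UniformSpace (NetworkSpace Ξ k) :=
  UniformSpace.ofCoreEq (uniformCore Ξ k) (topology Ξ k) topology_eq

instance pseudoMetrizable : TopologicalSpace.PseudoMetrizableSpace (NetworkSpace Ξ k) := by
  let _ := uniformSpace Ξ k
  have : IsCountablyGenerated (𝓤 (NetworkSpace Ξ k)) :=
    (uniformCore_hasBasis (Ξ := Ξ) (k := k)).isCountablyGenerated
  exact UniformSpace.pseudoMetrizableSpace

theorem nhds_hasBasis (N : PointedNetwork Ξ k) : (𝓝 (mk N)).HasBasis (fun _ : ℕ => True)
    (fun n => {a | ∃ M, mk M = a ∧ CloseWith n (1 / (n + 1)) N M}) := by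
  have h : (𝓝 (mk N)) = comap (Prod.mk (mk N)) (uniformCore Ξ k).uniformity := by
    rw [← UniformSpace.Core.nhds_toTopologicalSpace, ← topology_eq]
  rw [h]
  convert uniformCore_hasBasis.comap (Prod.mk (mk N)) using 2 with n
  ext a
  constructor
  · rintro ⟨M, rfl, hM⟩
    exact mk_mem_entourage.2 hM
  · intro ha
    obtain ⟨M, rfl⟩ := exists_mk_eq a
    exact ⟨M, rfl, mk_mem_entourage.1 ha⟩

theorem mem_nhds_iff {N : PointedNetwork Ξ k} {s : Set (NetworkSpace Ξ k)} :
    s ∈ 𝓝 (mk N) ↔ ∃ n : ℕ, ∀ M, CloseWith n (1 / (n + 1)) N M → mk M ∈ s := by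
  rw [(nhds_hasBasis N).mem_iff]
  constructor
  · rintro ⟨n, -, h⟩
    exact ⟨n, fun M hM => h ⟨M, rfl, hM⟩⟩
  · rintro ⟨n, h⟩
    refine ⟨n, trivial, ?_⟩
    rintro _ ⟨M, rfl, hM⟩
    exact h M hM

theorem mem_nhds_of_closeWith {N : PointedNetwork Ξ k} {s : Set (NetworkSpace Ξ k)} {n : ℕ} {ε : ℝ}
    (hε : 0 < ε) (h : ∀ M, CloseWith n ε N M → mk M ∈ s) : s ∈ 𝓝 (mk N) := by
  obtain ⟨m, hm⟩ := exists_nat_one_div_lt hε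
  refine mem_nhds_iff.2 ⟨max n m, fun M hM => h M (hM.mono (le_max_left _ _) ?_)⟩
  refine le_trans ?_ hm.le
  gcongr
  exact le_max_right _ _

/-- Pointed networks whose balls are isomorphic with marks arbitrarily close are isomorphic. -/
theorem equiv_of_forall_closeWith {N M : PointedNetwork Ξ k}
    (h : ∀ n : ℕ, CloseWith n (1 / (n + 1)) N M) : N ≈ M := by
  choose φ hv hd hp using h
  -- The isomorphisms `φ n` need not be compatible with each other. Each vertex or edge has only
  -- finitely many possible images, and a nonprincipal ultrafilter selects one of them; this
  -- replaces a diagonal argument.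
  let U : Ultrafilter ℕ := hyperfilter ℕ
  have hU : ∀ m : ℕ, ∀ᶠ n in (U : Filter ℕ), m ≤ n := fun m =>
    Nat.hyperfilter_le_atTop (eventually_ge_atTop m)
  have h0 : Tendsto (fun n : ℕ => (1 : ℝ) / (n + 1)) U (𝓝 0) :=
    tendsto_one_div_add_atTop_nhds_zero_nat.mono_left Nat.hyperfilter_le_atTop
  let A : N.net.V → M.net.V → Prop := fun v w =>
    ∀ᶠ n in (U : Filter ℕ), ∃ hv : v ∈ N.net.cball N.root n, ((φ n).onV ⟨v, hv⟩).1 = w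
  let B : N.net.D → M.net.D → Prop := fun d e =>
    ∀ᶠ n in (U : Filter ℕ), ∃ hd : d ∈ N.net.eball N.root n, ((φ n).onD ⟨d, hd⟩).1 = e
  have Ael : ∀ v, ∃ w, A v w := by
    intro v
    obtain ⟨m, hm⟩ := exists_mem_cball N.connected N.root v
    have := (Ultrafilter.eventually_exists_mem_iff (f := U)
      (P := fun w n => ∃ hv : v ∈ N.net.cball N.root n, ((φ n).onV ⟨v, hv⟩).1 = w)
      (finite_cball M.locallyFinite m M.root)).1 (by
        filter_upwards [hU m] with n hn
        refine ⟨_, ?_, cball_mono hn hm, rfl⟩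
        have := (φ n).mem_cball_image m 0 _ v (self_mem_cball _ _) (cball_mono hn hm)
          (self_mem_cball _ _) (by omega) hm
        rwa [ball_iso_root (hp n)] at this)
    exact ⟨this.choose, this.choose_spec.2⟩
  have Aer : ∀ w, ∃ v, A v w := by
    intro w
    obtain ⟨m, hm⟩ := exists_mem_cball M.connected M.root w
    have := (Ultrafilter.eventually_exists_mem_iff (f := U)
      (P := fun v n => ∃ hv : v ∈ N.net.cball N.root n, ((φ n).onV ⟨v, hv⟩).1 = w)
      (finite_cball N.locallyFinite m N.root)).1 (by
        filter_upwards [hU m] with n hn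
        refine ⟨((φ n).symm.onV ⟨w, cball_mono hn hm⟩).1, ?_,
          ((φ n).symm.onV ⟨w, cball_mono hn hm⟩).2,
          congrArg Subtype.val ((φ n).onV.apply_symm_apply ⟨w, cball_mono hn hm⟩)⟩
        have := (φ n).symm.mem_cball_image m 0 _ w (self_mem_cball _ _) (cball_mono hn hm)
          (self_mem_cball _ _) (by omega) hm
        have h1 : (φ n).symm.onV ⟨M.root, self_mem_cball _ _⟩ = ⟨N.root, self_mem_cball _ _⟩ := by
          refine ((φ n).onV.symm_apply_eq).2 (Subtype.ext (ball_iso_root (hp n)).symm)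
        rwa [h1] at this)
    exact ⟨this.choose, this.choose_spec.2⟩
  have Bmem : ∀ d, ∃ m, d ∈ N.net.eball N.root m := fun d => by
    obtain ⟨a, ha⟩ := exists_mem_cball N.connected N.root (N.net.src d)
    exact ⟨a + 1, cball_mono (Nat.le_succ a) ha, mem_cball_trans ha (tgt_mem_cball d)⟩
  have Bmem' : ∀ d, ∃ m, d ∈ M.net.eball M.root m := fun d => by
    obtain ⟨a, ha⟩ := exists_mem_cball M.connected M.root (M.net.src d)
    exact ⟨a + 1, cball_mono (Nat.le_succ a) ha, mem_cball_trans ha (tgt_mem_cball d)⟩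
  -- The image of the source is already decided, so the image of `d` is one of the finitely many
  -- edges that leave it.
  have Bel : ∀ d, ∃ e, B d e := by
    intro d
    obtain ⟨w, hw⟩ := Ael (N.net.src d)
    obtain ⟨m, hm⟩ := Bmem d
    have := (Ultrafilter.eventually_exists_mem_iff (f := U)
      (P := fun e n => ∃ hd : d ∈ N.net.eball N.root n, ((φ n).onD ⟨d, hd⟩).1 = e)
      (M.locallyFinite w)).1 (by
        filter_upwards [hU m, hw] with n hn hw
        obtain ⟨h1, h2⟩ := hw
        refine ⟨_, ?_, eball_mono hn hm, rfl⟩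
        rw [← h2]
        exact (congrArg Subtype.val ((φ n).src_onD ⟨d, eball_mono hn hm⟩) :))
    exact ⟨this.choose, this.choose_spec.2⟩
  have Ber : ∀ e, ∃ d, B d e := by
    intro e
    obtain ⟨v, hv⟩ := Aer (M.net.src e)
    obtain ⟨m, hm⟩ := Bmem' e
    have := (Ultrafilter.eventually_exists_mem_iff (f := U)
      (P := fun d n => ∃ hd : d ∈ N.net.eball N.root n, ((φ n).onD ⟨d, hd⟩).1 = e)
      (N.locallyFinite v)).1 (by
        filter_upwards [hU m, hv] with n hn hv
        obtain ⟨h1, h2⟩ := hv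
        have h4 := (φ n).onD.apply_symm_apply ⟨e, eball_mono hn hm⟩
        refine ⟨((φ n).symm.onD ⟨e, eball_mono hn hm⟩).1, ?_,
          ((φ n).symm.onD ⟨e, eball_mono hn hm⟩).2, congrArg Subtype.val h4⟩
        have h3 := (φ n).symm.src_onD ⟨e, eball_mono hn hm⟩
        refine (congrArg Subtype.val h3).trans ?_
        have h5 : (M.net.ball M.root n).src ⟨e, eball_mono hn hm⟩ = (φ n).onV ⟨v, h1⟩ :=
          Subtype.ext h2.symm
        rw [h5]
        exact congrArg Subtype.val ((φ n).onV.symm_apply_apply ⟨v, h1⟩))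
    exact ⟨this.choose, this.choose_spec.2⟩
  have Aun : ∀ v w w', A v w → A v w' → w = w' := fun v w w' h h' => by
    obtain ⟨n, ⟨h1, h2⟩, ⟨h3, h4⟩⟩ := (h.and h').exists
    exact h2.symm.trans h4
  have Bun : ∀ v w w', B v w → B v w' → w = w' := fun v w w' h h' => by
    obtain ⟨n, ⟨h1, h2⟩, ⟨h3, h4⟩⟩ := (h.and h').exists
    exact h2.symm.trans h4
  have Aun' : ∀ v v' w, A v w → A v' w → v = v' := fun v v' w h h' => by
    obtain ⟨n, ⟨h1, h2⟩, ⟨h3, h4⟩⟩ := (h.and h').exists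
    exact congrArg Subtype.val ((φ n).onV.injective (Subtype.ext (h2.trans h4.symm)))
  have Bun' : ∀ v v' w, B v w → B v' w → v = v' := fun v v' w h h' => by
    obtain ⟨n, ⟨h1, h2⟩, ⟨h3, h4⟩⟩ := (h.and h').exists
    exact congrArg Subtype.val ((φ n).onD.injective (Subtype.ext (h2.trans h4.symm)))
  choose f hf using Ael
  choose g hg using Bel
  let ψ : N.net.Iso M.net :=
    { onV := Equiv.ofBijective f ⟨fun v v' h => Aun' _ _ _ (hf v) (h ▸ hf v'),
        fun w => (Aer w).imp fun v hv => Aun _ _ _ (hf v) hv⟩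
      onD := Equiv.ofBijective g ⟨fun v v' h => Bun' _ _ _ (hg v) (h ▸ hg v'),
        fun w => (Ber w).imp fun v hv => Bun _ _ _ (hg v) hv⟩
      src_onD := fun d => by
        obtain ⟨n, ⟨h1, h2⟩, ⟨h3, h4⟩⟩ := ((hf (N.net.src d)).and (hg d)).exists
        change M.net.src (g d) = f (N.net.src d)
        rw [← h2, ← h4]
        exact (congrArg Subtype.val ((φ n).src_onD ⟨d, h3⟩) :)
      rev_onD := fun d => by
        obtain ⟨n, ⟨h1, h2⟩, ⟨h3, h4⟩⟩ := ((hg (N.net.rev d)).and (hg d)).exists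
        change M.net.rev (g d) = g (N.net.rev d)
        rw [← h2, ← h4]
        exact (congrArg Subtype.val ((φ n).rev_onD ⟨d, h3⟩) :) }
  refine ⟨ψ, fun v => ?_, fun d => ?_, fun i => ?_⟩
  · refine (dist_le_zero.1 (ge_of_tendsto h0 ?_)).symm
    filter_upwards [hf v] with n hn
    obtain ⟨h1, h2⟩ := hn
    have := hv n ⟨v, h1⟩
    refine le_of_eq_of_le ?_ this.le
    change dist (N.net.vmark v) (M.net.vmark (f v)) = dist (N.net.vmark v) (M.net.vmark _)
    rw [h2]
  · refine (dist_le_zero.1 (ge_of_tendsto h0 ?_)).symm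
    filter_upwards [hg d] with n hn
    obtain ⟨h1, h2⟩ := hn
    have := hd n ⟨d, h1⟩
    refine le_of_eq_of_le ?_ this.le
    change dist (N.net.dmark d) (M.net.dmark (g d)) = dist (N.net.dmark d) (M.net.dmark _)
    rw [h2]
  · obtain ⟨n, h1, h2⟩ := (hf (N.pt i)).exists
    exact h2.symm.trans ((hp n i ⟨N.pt i, h1⟩).1 rfl)

instance t0Space : T0Space (NetworkSpace Ξ k) := ⟨fun a b h => by
  obtain ⟨N, rfl⟩ := exists_mk_eq a
  obtain ⟨M, rfl⟩ := exists_mk_eq b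
  refine mk_eq_mk.2 (equiv_of_forall_closeWith fun n => ?_)
  have h1 : {a | ∃ P, mk P = a ∧ CloseWith n (1 / (n + 1)) N P} ∈ 𝓝 (mk M) := by
    rw [← h.nhds_eq]
    exact (nhds_hasBasis N).mem_of_mem trivial
  obtain ⟨P, hP, hc⟩ := mem_of_mem_nhds h1
  exact (closeWith_congr (Setoid.refl N) (mk_eq_mk.1 hP)).1 hc⟩

instance t2Space : T2Space (NetworkSpace Ξ k) := by
  let _ := TopologicalSpace.pseudoMetrizableSpacePseudoMetric (NetworkSpace Ξ k)
  let _ := MetricSpace.ofT0PseudoMetricSpace (NetworkSpace Ξ k)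
  infer_instance

/-- Needed for the portmanteau theorem and for determining finite measures by integrals of bounded
continuous functions. -/
instance hasOuterApproxClosed : HasOuterApproxClosed (NetworkSpace Ξ k) := by
  let _ := TopologicalSpace.pseudoMetrizableSpacePseudoMetric (NetworkSpace Ξ k)
  infer_instance

end NetworkSpace

/-! ### Additional distinguished vertices, sums over vertices and their measurability. -/

namespace PointedNetwork

open Network

variable {Ξ Ξ' : Type*} {k l : ℕ}

/-- Add a distinguished vertex. -/
def addPt (N : PointedNetwork Ξ k) (x : N.net.V) : PointedNetwork Ξ (k + 1) :=
  N.withPt (Fin.snoc (α := fun _ => N.net.V) N.pt x)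

theorem addPt_root (N : PointedNetwork Ξ k) (x : N.net.V) : (N.addPt x).root = N.root := by
  change Fin.snoc (α := fun _ => N.net.V) N.pt x 0 = N.pt 0
  rw [← Fin.castSucc_zero, Fin.snoc_castSucc]

theorem addPt_last (N : PointedNetwork Ξ k) (x : N.net.V) :
    (N.addPt x).pt (Fin.last (k + 1)) = x :=
  Fin.snoc_last (α := fun _ => N.net.V) _ _

theorem withPt_one_addPt (N : PointedNetwork Ξ 0) (x : N.net.V) :
    N.addPt x = N.withPt ![N.root, x] := by
  refine congrArg N.withPt (funext fun i => ?_)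
  fin_cases i <;> rfl

theorem withPt_addPt (N : PointedNetwork Ξ 0) (x y z : N.net.V) :
    (N.withPt ![x, y]).addPt z = N.withPt ![x, y, z] := by
  refine congrArg N.withPt (funext fun i => ?_)
  fin_cases i <;> rfl

theorem withPt_equiv {N M : PointedNetwork Ξ k} (φ : N.net.Iso M.net)
    (hv : ∀ v, M.net.vmark (φ.onV v) = N.net.vmark v)
    (hd : ∀ d, M.net.dmark (φ.onD d) = N.net.dmark d) (p : Fin (l + 1) → N.net.V)
    (q : Fin (l + 1) → M.net.V) (h : ∀ i, φ.onV (p i) = q i) : N.withPt p ≈ M.withPt q :=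
  ⟨φ, hv, hd, h⟩

theorem exists_equiv_addPt {N M : PointedNetwork Ξ k} (h : N ≈ M) :
    ∃ e : N.net.V ≃ M.net.V, ∀ x, N.addPt x ≈ M.addPt (e x) := by
  obtain ⟨φ, hv, hd, hp⟩ := h
  refine ⟨φ.onV, fun x => withPt_equiv φ hv hd _ _ fun i => ?_⟩
  refine Fin.lastCases ?_ (fun i => ?_) i
  · simp
  · simp [hp i]

/-- The one isomorphism witnessing closeness of `N` and `M` also matches every additional point near
the root with its image. This allows sums over vertices to be compared term by term. -/
theorem exists_equiv_cball [MetricSpace Ξ] {R n : ℕ} {ε : ℝ} {N M : PointedNetwork Ξ k}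
    (h : CloseWith R ε N M) (hn : n ≤ R) :
    ∃ e : N.net.cball N.root n ≃ M.net.cball M.root n,
      ∀ x : N.net.cball N.root n, CloseWith R ε (N.addPt x.1) (M.addPt (e x).1) := by
  obtain ⟨φ, hφ⟩ := h
  have hr := ball_iso_root hφ.2.2
  have key : ∀ v (hv : v ∈ N.net.cball N.root R),
      v ∈ N.net.cball N.root n ↔ (φ.onV ⟨v, hv⟩).1 ∈ M.net.cball M.root n := fun v hv => by
    have := φ.mem_cball_iff hr (self_mem_cball _ _) hv (self_mem_cball _ 0) (m := n) (by omega)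
    rwa [hr] at this
  let ψ := φ.restrict (cball_mono hn) (cball_mono hn) key
  refine ⟨ψ.onV, fun x => ?_⟩
  have h0 : ∀ {P : PointedNetwork Ξ k} (x : P.net.V),
      (Fin.snoc (α := fun _ => P.net.V) P.pt x : Fin (k + 2) → P.net.V) 0 = P.root :=
    fun x => addPt_root _ x
  refine closeWith_of_iso (a := 0) φ hφ (Fin.snoc (α := fun _ => N.net.V) N.pt x.1)
    (Fin.snoc (α := fun _ => M.net.V) M.pt (ψ.onV x).1) (by rw [h0]; exact self_mem_cball _ _)
    (by omega) fun i v hv => ?_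
  refine Fin.lastCases ?_ (fun i => ?_) i
  · rw [Fin.snoc_last, Fin.snoc_last]
    change v = x.1 ↔ (φ.onV ⟨v, hv⟩).1 = (φ.onV ⟨x.1, cball_mono hn x.2⟩).1
    constructor
    · rintro rfl; rfl
    · intro h
      exact congrArg Subtype.val (φ.onV.injective (Subtype.ext h))
  · rw [Fin.snoc_castSucc, Fin.snoc_castSucc]
    exact hφ.2.2 i ⟨v, hv⟩

end PointedNetwork

namespace NetworkSpace

open Network PointedNetwork Filter Topology

variable {Ξ Ξ' Ξ'' : Type*} {k l m : ℕ}

theorem map_mk (f : Ξ → Ξ') (N : PointedNetwork Ξ k) : map f (mk N) = mk (N.map f) := rfl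

theorem map_map (f : Ξ → Ξ') (g : Ξ' → Ξ'') (a : NetworkSpace Ξ k) :
    map g (map f a) = map (g ∘ f) a := by
  obtain ⟨N, rfl⟩ := exists_mk_eq a
  rfl

/-- Change of the distinguished vertices. -/
def reindex (σ : Fin (l + 1) → Fin (k + 1)) : NetworkSpace Ξ k → NetworkSpace Ξ l :=
  Quotient.map (fun N => N.withPt (N.pt ∘ σ)) (by
    rintro N M ⟨φ, hv, hd, hp⟩
    exact ⟨φ, hv, hd, fun i => hp (σ i)⟩)

theorem reindex_mk (σ : Fin (l + 1) → Fin (k + 1)) (N : PointedNetwork Ξ k) :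
    reindex σ (mk N) = mk (N.withPt (N.pt ∘ σ)) := rfl

theorem reindex_mk_withPt {σ : Fin (l + 1) → Fin (k + 1)} {N : PointedNetwork Ξ m}
    {p : Fin (k + 1) → N.net.V} {q : Fin (l + 1) → N.net.V} (h : ∀ i, p (σ i) = q i) :
    reindex σ (mk (N.withPt p)) = mk (N.withPt q) := by
  obtain rfl : p ∘ σ = q := funext h
  rfl

theorem map_reindex (f : Ξ → Ξ') (σ : Fin (l + 1) → Fin (k + 1)) (a : NetworkSpace Ξ k) :
    map f (reindex σ a) = reindex σ (map f a) := by
  obtain ⟨N, rfl⟩ := exists_mk_eq a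
  rfl

/-- The sum of a function over all ways to add a distinguished vertex. -/
noncomputable def vsum (f : NetworkSpace Ξ (k + 1) → ℝ≥0∞) (a : NetworkSpace Ξ k) : ℝ≥0∞ :=
  ∑' x : a.rep.net.V, f (mk (a.rep.addPt x))

theorem vsum_mk (f : NetworkSpace Ξ (k + 1) → ℝ≥0∞) (N : PointedNetwork Ξ k) :
    vsum f (mk N) = ∑' x : N.net.V, f (mk (N.addPt x)) := by
  obtain ⟨e, he⟩ := exists_equiv_addPt (rep_mk N)
  rw [vsum, ← e.tsum_eq]
  exact tsum_congr fun x => congrArg f (mk_eq_mk.2 (he x))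

theorem vsum_mk_zero (f : NetworkSpace Ξ 1 → ℝ≥0∞) (N : PointedNetwork Ξ 0) :
    vsum f (mk N) = ∑' x : N.net.V, f (mk (N.withPt ![N.root, x])) := by
  simp only [vsum_mk, withPt_one_addPt]

theorem vsum_mk_one (f : NetworkSpace Ξ 2 → ℝ≥0∞) (N : PointedNetwork Ξ 0) (x y : N.net.V) :
    vsum f (mk (N.withPt ![x, y])) = ∑' z : N.net.V, f (mk (N.withPt ![x, y, z])) := by
  rw [vsum_mk]
  exact tsum_congr fun z => congrArg (fun P => f (mk P)) (withPt_addPt N x y z)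

theorem vsum_mono {f g : NetworkSpace Ξ (k + 1) → ℝ≥0∞} (h : ∀ b, f b ≤ g b)
    (a : NetworkSpace Ξ k) : vsum f a ≤ vsum g a :=
  ENNReal.tsum_le_tsum fun _ => h _

theorem vsum_add (f g : NetworkSpace Ξ (k + 1) → ℝ≥0∞) (a : NetworkSpace Ξ k) :
    vsum (fun b => f b + g b) a = vsum f a + vsum g a := ENNReal.tsum_add

theorem reindex_castSucc_addPt (N : PointedNetwork Ξ k) (x : N.net.V) :
    reindex Fin.castSucc (mk (N.addPt x)) = mk N := by
  change mk (N.withPt _) = mk (N.withPt N.pt)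
  congr 2
  funext i
  exact Fin.snoc_castSucc (α := fun _ => N.net.V) _ _ _

theorem vsum_mul_left (g : NetworkSpace Ξ k → ℝ≥0∞) (f : NetworkSpace Ξ (k + 1) → ℝ≥0∞)
    (a : NetworkSpace Ξ k) :
    vsum (fun b => g (reindex Fin.castSucc b) * f b) a = g a * vsum f a := by
  obtain ⟨N, rfl⟩ := exists_mk_eq a
  simp only [vsum_mk, reindex_castSucc_addPt, ENNReal.tsum_mul_left]

theorem vsum_map (g : Ξ → Ξ') (f : NetworkSpace Ξ' (k + 1) → ℝ≥0∞) (a : NetworkSpace Ξ k) :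
    vsum f (map g a) = vsum (fun b => f (map g b)) a := by
  obtain ⟨N, rfl⟩ := exists_mk_eq a
  rw [map_mk, vsum_mk, vsum_mk]
  rfl

theorem vsum_swap_mk (f : NetworkSpace Ξ 1 → ℝ≥0∞) (N : PointedNetwork Ξ 0) :
    vsum (fun b => f (reindex ![1, 0] b)) (mk N) =
      ∑' x : N.net.V, f (mk (N.withPt ![x, N.root])) := by
  rw [vsum_mk_zero]
  refine tsum_congr fun x => congrArg f (reindex_mk_withPt fun i => ?_)
  fin_cases i <;> rfl

theorem vsum_vsum_swap (f : NetworkSpace Ξ 2 → ℝ≥0∞) (a : NetworkSpace Ξ 0) :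
    vsum (vsum fun b => f (reindex ![0, 2, 1] b)) a = vsum (vsum f) a := by
  obtain ⟨N, rfl⟩ := exists_mk_eq a
  simp only [vsum_mk_zero, vsum_mk_one]
  rw [ENNReal.tsum_comm]
  refine tsum_congr fun x => tsum_congr fun y => congrArg f (reindex_mk_withPt fun i => ?_)
  fin_cases i <;> rfl

/-- Summation over the last vertex commutes with a change of root. -/
theorem vsum_reindex_one (f : NetworkSpace Ξ 1 → ℝ≥0∞) (a : NetworkSpace Ξ 1) :
    vsum f (reindex ![1] a) = vsum (fun b => f (reindex ![1, 2] b)) a := by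
  obtain ⟨N, rfl⟩ := exists_mk_eq a
  rw [reindex_mk, vsum_mk, vsum_mk]
  refine tsum_congr fun x => congrArg f ?_
  change mk (N.withPt _) = mk (N.withPt _)
  congr 2
  funext i
  fin_cases i <;> rfl

/-- The networks in which the last distinguished vertex is at distance at most `n` from the
root. -/
def within (Ξ : Type*) (k n : ℕ) : Set (NetworkSpace Ξ k) :=
  {a | a.rep.pt (Fin.last k) ∈ a.rep.net.cball a.rep.root n}

theorem mk_mem_within {n : ℕ} {N : PointedNetwork Ξ k} :
    mk N ∈ within Ξ k n ↔ N.pt (Fin.last k) ∈ N.net.cball N.root n := by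
  obtain ⟨φ, hv, hd, hp⟩ := rep_mk N
  change (mk N).rep.pt (Fin.last k) ∈ (mk N).rep.net.cball (mk N).rep.root n ↔ _
  rw [φ.mem_cball_iff_global, hp, show φ.onV (mk N).rep.root = N.root from hp 0]

theorem addPt_mem_within {n : ℕ} {N : PointedNetwork Ξ k} {x : N.net.V} :
    mk (N.addPt x) ∈ within Ξ (k + 1) n ↔ x ∈ N.net.cball N.root n := by
  rw [mk_mem_within, addPt_last, addPt_root]
  rfl

theorem iUnion_within : ⋃ n, within Ξ k n = Set.univ := by
  refine Set.eq_univ_of_forall fun a => ?_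
  obtain ⟨N, rfl⟩ := exists_mk_eq a
  obtain ⟨n, hn⟩ := exists_mem_cball N.connected N.root (N.pt (Fin.last k))
  exact Set.mem_iUnion.2 ⟨n, mk_mem_within.2 hn⟩

theorem within_mono {n m : ℕ} (h : n ≤ m) : within Ξ k n ⊆ within Ξ k m :=
  fun _ ha => cball_mono h ha

theorem tsum_cball {N : PointedNetwork Ξ k} {n : ℕ} {f : NetworkSpace Ξ (k + 1) → ℝ≥0∞}
    (hf : ∀ b, b ∉ within Ξ (k + 1) n → f b = 0) :
    ∑' x : N.net.cball N.root n, f (mk (N.addPt x)) = vsum f (mk N) := by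
  rw [vsum_mk]
  refine tsum_subtype_eq_of_support_subset (f := fun x => f (mk (N.addPt x))) fun x hx => ?_
  by_contra h
  exact hx (hf _ fun h' => h (addPt_mem_within.1 h'))

theorem vsum_ne_top {n : ℕ} {f : NetworkSpace Ξ (k + 1) → ℝ≥0∞}
    (hf : ∀ b, b ∉ within Ξ (k + 1) n → f b = 0) (hf' : ∀ b, f b ≠ ∞) (a : NetworkSpace Ξ k) :
    vsum f a ≠ ∞ := by
  obtain ⟨N, rfl⟩ := exists_mk_eq a
  rw [← tsum_cball hf]
  have : Finite (N.net.cball N.root n) := finite_cball N.locallyFinite n N.root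
  have := Fintype.ofFinite (N.net.cball N.root n)
  rw [tsum_fintype]
  exact ENNReal.sum_ne_top.2 fun x _ => hf' _

variable [MetricSpace Ξ] [MetricSpace Ξ'] [MetricSpace Ξ'']

/-- The hypothesis is symmetric between `s` and its complement, so openness of one gives openness of
the other. It is applied to sets that depend only on the underlying graph of a ball, for which the
mark error 1 is irrelevant. -/
theorem isClopen_of_closeWith {s : Set (NetworkSpace Ξ k)}
    (h : ∀ N, ∃ n : ℕ, ∀ M, CloseWith n 1 N M → (mk N ∈ s ↔ mk M ∈ s)) : IsClopen s := by
  have aux : ∀ s : Set (NetworkSpace Ξ k),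
      (∀ N, ∃ n : ℕ, ∀ M, CloseWith n 1 N M → (mk N ∈ s ↔ mk M ∈ s)) → IsOpen s := by
    intro s h
    refine isOpen_iff_mem_nhds.2 fun a ha => ?_
    obtain ⟨N, rfl⟩ := exists_mk_eq a
    obtain ⟨n, hn⟩ := h N
    exact mem_nhds_of_closeWith one_pos fun M hM => (hn M hM).1 ha
  refine ⟨isOpen_compl_iff.1 (aux _ fun N => (h N).imp fun n hn M hM => ?_), aux s h⟩
  exact not_congr (hn M hM)

theorem isClopen_within (n : ℕ) : IsClopen (within Ξ k n) := by
  refine isClopen_of_closeWith fun N => ?_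
  obtain ⟨m, hm⟩ := exists_mem_cball N.connected N.root (N.pt (Fin.last k))
  refine ⟨m + n, fun M hM => ?_⟩
  obtain ⟨φ, -, -, hp⟩ := hM
  have hm' := cball_mono (Nat.le_add_right m n) hm
  rw [mk_mem_within, mk_mem_within, φ.mem_cball_iff (ball_iso_root hp) (self_mem_cball _ _) hm'
    (self_mem_cball _ 0) (by omega), ball_iso_root hp]
  exact iff_of_eq (congrArg (· ∈ _) ((hp _ ⟨_, hm'⟩).1 rfl))

theorem continuous_map {f : Ξ → Ξ'} (hf : LipschitzWith 1 f) :
    Continuous (map (k := k) f) := by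
  refine continuous_iff_continuousAt.2 fun a => ?_
  obtain ⟨N, rfl⟩ := exists_mk_eq a
  intro s hs
  rw [map_mk] at hs
  obtain ⟨n, hn⟩ := mem_nhds_iff.1 hs
  refine mem_nhds_iff.2 ⟨n, fun M hM => hn _ ?_⟩
  obtain ⟨φ, hv, hd, hp⟩ := hM
  have hf' : ∀ x y, dist (f x) (f y) ≤ dist x y := fun x y => by simpa using hf.dist_le_mul x y
  exact ⟨⟨φ.onV, φ.onD, φ.src_onD, φ.rev_onD⟩, fun v => (hf' _ _).trans_lt (hv v),
    fun d => (hf' _ _).trans_lt (hd d), hp⟩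

theorem measurable_map {f : Ξ → Ξ'} (hf : LipschitzWith 1 f) :
    Measurable (map (k := k) f) := (continuous_map hf).measurable

theorem continuous_reindex (σ : Fin (l + 1) → Fin (k + 1)) :
    Continuous (reindex (Ξ := Ξ) σ) := by
  refine continuous_iff_continuousAt.2 fun a => ?_
  obtain ⟨N, rfl⟩ := exists_mk_eq a
  intro s hs
  rw [reindex_mk] at hs
  obtain ⟨n, hn⟩ := mem_nhds_iff.1 hs
  obtain ⟨m, hm⟩ := exists_mem_cball N.connected N.root (N.pt (σ 0))
  -- The new root is at distance at most `m` from the old one, so radius `m` is lost.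
  refine mem_nhds_of_closeWith (n := m + n) (ε := 1 / (n + 1)) (by positivity) fun M hM => ?_
  refine hn _ ?_
  obtain ⟨φ, hφ⟩ := hM
  exact closeWith_of_iso φ hφ _ _ hm le_rfl fun i v hv => hφ.2.2 _ ⟨v, hv⟩

theorem measurable_reindex (σ : Fin (l + 1) → Fin (k + 1)) :
    Measurable (reindex (Ξ := Ξ) σ) := (continuous_reindex σ).measurable

/-- Only the finitely many vertices of a ball contribute. Those whose pointed network lies in the
open set `U` continue to do so under a small perturbation, while others may enter `U`; hence the
count can only go up. -/
theorem vsum_indicator_lsc {U : Set (NetworkSpace Ξ (k + 1))} (hU : IsOpen U) {n : ℕ}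
    (hn : U ⊆ within Ξ (k + 1) n) :
    LowerSemicontinuous (vsum (k := k) (U.indicator 1)) := by
  intro a y hy
  obtain ⟨N, rfl⟩ := exists_mk_eq a
  have h1 : ∀ x : N.net.V, ∃ R : ℕ, ∀ M, mk (N.addPt x) ∈ U →
      CloseWith R (1 / (R + 1)) (N.addPt x) M → mk M ∈ U := fun x => by
    by_cases hx : mk (N.addPt x) ∈ U
    · obtain ⟨R, hR⟩ := mem_nhds_iff.1 (hU.mem_nhds hx)
      exact ⟨R, fun M _ => hR M⟩
    · exact ⟨0, fun M h => absurd h hx⟩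
  choose R hR using h1
  have hfin := finite_cball N.locallyFinite n N.root
  obtain ⟨S, hS⟩ := (hfin.image R).bddAbove
  refine mem_nhds_iff.2 ⟨max S n, fun M hM => hy.trans_le ?_⟩
  obtain ⟨e, he⟩ := exists_equiv_cball hM (le_max_right S n)
  have hf : ∀ b, b ∉ within Ξ (k + 1) n → U.indicator (1 : NetworkSpace Ξ (k + 1) → ℝ≥0∞) b = 0 :=
    fun b hb => Set.indicator_of_notMem (fun h => hb (hn h)) _
  rw [← tsum_cball hf, ← tsum_cball hf, ← e.tsum_eq]
  refine ENNReal.tsum_le_tsum fun x => ?_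
  by_cases hx : mk (N.addPt x.1) ∈ U
  · have hRS : R x.1 ≤ max S n := (hS ⟨x.1, x.2, rfl⟩).trans (le_max_left _ _)
    have : mk (M.addPt (e x).1) ∈ U := by
      refine hR _ _ hx ((he x).mono hRS ?_)
      gcongr
    simp [hx, this]
  · simp [hx]

/-- The counting measure on the ways to add a distinguished vertex. -/
noncomputable def vmeas (a : NetworkSpace Ξ k) : Measure (NetworkSpace Ξ (k + 1)) :=
  Measure.sum fun x : a.rep.net.V => Measure.dirac (mk (a.rep.addPt x))

theorem lintegral_vmeas {f : NetworkSpace Ξ (k + 1) → ℝ≥0∞} (hf : Measurable f)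
    (a : NetworkSpace Ξ k) : ∫⁻ b, f b ∂vmeas a = vsum f a := by
  rw [vmeas, lintegral_sum_measure, vsum]
  exact tsum_congr fun x => lintegral_dirac' _ hf

theorem vmeas_apply {s : Set (NetworkSpace Ξ (k + 1))} (hs : MeasurableSet s)
    (a : NetworkSpace Ξ k) : vmeas a s = vsum (s.indicator 1) a := by
  rw [← lintegral_indicator_one hs, lintegral_vmeas (measurable_one.indicator hs)]

theorem measurableSet_within (n : ℕ) : MeasurableSet (within Ξ k n) :=
  (isClopen_within n).isOpen.measurableSet

theorem vmeas_within_ne_top (n : ℕ) (a : NetworkSpace Ξ k) :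
    vmeas a (within Ξ (k + 1) n) ≠ ∞ := by
  rw [vmeas_apply (measurableSet_within n)]
  refine vsum_ne_top (n := n) (fun b hb => Set.indicator_of_notMem hb _) (fun b => ?_) a
  by_cases h : b ∈ within Ξ (k + 1) n <;> simp [h]

/-- Open sets are covered by semicontinuity, and Dynkin's π-λ argument extends this to Borel sets.
The restriction to distance at most `n` makes the counting measures finite, as the subtraction for
complements requires. -/
theorem measurable_vmeas_inter_within {s : Set (NetworkSpace Ξ (k + 1))} (hs : MeasurableSet s)
    (n : ℕ) : Measurable fun a : NetworkSpace Ξ k => vmeas a (s ∩ within Ξ (k + 1) n) := by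
  have hopen : ∀ t : Set (NetworkSpace Ξ (k + 1)), IsOpen t → t ⊆ within Ξ (k + 1) n →
      Measurable fun a : NetworkSpace Ξ k => vmeas a t := fun t ht h => by
    simp only [vmeas_apply ht.measurableSet]
    exact (vsum_indicator_lsc ht h).measurable
  have hw := hopen _ (isClopen_within n).isOpen subset_rfl
  induction s, hs using MeasurableSpace.induction_on_inter
    (h_eq := rfl) (h_inter := isPiSystem_isOpen) with
  | empty => simp
  | basic t ht =>
    exact hopen _ (IsOpen.inter ht (isClopen_within n).isOpen) Set.inter_subset_right
  | compl t ht ih =>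
    have : ∀ a : NetworkSpace Ξ k, vmeas a (tᶜ ∩ within Ξ (k + 1) n) =
        vmeas a (within Ξ (k + 1) n) - vmeas a (t ∩ within Ξ (k + 1) n) := fun a => by
      have h : tᶜ ∩ within Ξ (k + 1) n = within Ξ (k + 1) n \ (t ∩ within Ξ (k + 1) n) := by
        ext; simp; tauto
      rw [h, measure_sdiff Set.inter_subset_right
        (ht.inter (measurableSet_within n)).nullMeasurableSet
        (ne_top_of_le_ne_top (vmeas_within_ne_top n a) (measure_mono Set.inter_subset_right))]
    simp only [this]
    exact hw.sub ih
  | iUnion f hd hf ih =>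
    have : ∀ a : NetworkSpace Ξ k, vmeas a ((⋃ i, f i) ∩ within Ξ (k + 1) n) =
        ∑' i, vmeas a (f i ∩ within Ξ (k + 1) n) := fun a => by
      rw [Set.iUnion_inter, measure_iUnion
        (fun i j hij => (hd hij).mono Set.inter_subset_left Set.inter_subset_left)
        fun i => (hf i).inter (measurableSet_within n)]
    simp only [this]
    exact Measurable.tsum ih

theorem measurable_vmeas : Measurable (vmeas (Ξ := Ξ) (k := k)) := by
  refine Measure.measurable_of_measurable_coe _ fun s hs => ?_
  have : (fun a : NetworkSpace Ξ k => vmeas a s) = fun a =>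
      ⨆ n, vmeas a (s ∩ within Ξ (k + 1) n) := by
    funext a
    have h1 : s = ⋃ n, s ∩ within Ξ (k + 1) n := by
      rw [← Set.inter_iUnion, iUnion_within, Set.inter_univ]
    conv_lhs => rw [h1]
    exact Monotone.measure_iUnion fun i j hij => Set.inter_subset_inter_right _ (within_mono hij)
  rw [this]
  exact Measurable.iSup fun n => measurable_vmeas_inter_within hs n

theorem measurable_vsum {f : NetworkSpace Ξ (k + 1) → ℝ≥0∞} (hf : Measurable f) :
    Measurable (vsum f) := by
  simp only [← funext (lintegral_vmeas hf)]
  exact (Measure.measurable_lintegral hf).comp measurable_vmeas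

end NetworkSpace

/-! ### Percolation clusters, edge counts and cuts. -/

namespace Network

variable {Ξ : Type*}

/-- The relation of being joined by an edge whose pair of marks lies in `C`. -/
def edgeRel (N : Network Ξ) (C : Set (Ξ × Ξ)) (x y : N.V) : Prop :=
  ∃ d, N.src d = x ∧ N.tgt d = y ∧ (N.dmark d, N.dmark (N.rev d)) ∈ C

theorem edgeRel_prod_symm {N : Network Ξ} {A : Set Ξ} {x y : N.V}
    (h : N.edgeRel (A ×ˢ A) x y) : N.edgeRel (A ×ˢ A) y x := by
  obtain ⟨d, h1, h2, h3, h4⟩ := h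
  exact ⟨N.rev d, h2, by simpa [tgt, N.rev_rev] using h1, h4, by simpa [N.rev_rev] using h3⟩

theorem openGraph_adj {N : Network Ξ} {A : Set Ξ} {x y : N.V} :
    (N.openGraph A).Adj x y ↔ x ≠ y ∧ N.edgeRel (A ×ˢ A) x y := by
  simp only [openGraph, SimpleGraph.fromRel_adj]
  exact and_congr_right fun _ => ⟨fun h => h.elim id edgeRel_prod_symm, Or.inl⟩

theorem mem_component_iff {N : Network Ξ} {A : Set Ξ} {x y : N.V} :
    y ∈ N.component A x ↔ Relation.ReflTransGen (N.edgeRel (A ×ˢ A)) x y := by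
  change (N.openGraph A).Reachable x y ↔ _
  rw [SimpleGraph.reachable_iff_reflTransGen]
  constructor
  · exact (Relation.ReflTransGen.mono fun a b h => (openGraph_adj.1 h).2 :
      Relation.ReflTransGen (N.openGraph A).Adj ≤ Relation.ReflTransGen (N.edgeRel (A ×ˢ A))) x y
  · intro h
    induction h with
    | refl => exact .refl
    | @tail b c h1 h2 ih =>
      by_cases hbc : b = c
      · exact hbc ▸ ih
      · exact ih.tail (openGraph_adj.2 ⟨hbc, h2⟩)

theorem mem_component_self {N : Network Ξ} {A : Set Ξ} (x : N.V) : x ∈ N.component A x :=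
  mem_component_iff.2 .refl

theorem component_eq {N : Network Ξ} {A : Set Ξ} {x y : N.V} (h : y ∈ N.component A x) :
    N.component A y = N.component A x := by
  ext z
  exact ⟨fun h' => SimpleGraph.Reachable.trans h h',
    fun h' => SimpleGraph.Reachable.trans (SimpleGraph.Reachable.symm h) h'⟩

theorem mem_component_comm {N : Network Ξ} {A : Set Ξ} {x y : N.V} :
    y ∈ N.component A x ↔ x ∈ N.component A y :=
  ⟨SimpleGraph.Reachable.symm, SimpleGraph.Reachable.symm⟩

end Network

namespace NetworkSpace

open Network PointedNetwork Filter Topology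

variable {Ξ Ξ' : Type*} {k : ℕ}

theorem exists_mk_withPt_one (a : NetworkSpace Ξ 1) :
    ∃ (N : PointedNetwork Ξ 0) (o x : N.net.V), mk (N.withPt ![o, x]) = a := by
  obtain ⟨N, rfl⟩ := exists_mk_eq a
  refine ⟨N.withPt ![N.root], N.pt 0, N.pt 1, ?_⟩
  change mk (N.withPt _) = mk (N.withPt N.pt)
  congr 2
  funext i
  fin_cases i <;> rfl

/-- The oriented edges from the root to the last distinguished vertex. -/
abbrev REdge (N : PointedNetwork Ξ k) : Type :=
  {d : N.net.D // N.net.src d = N.root ∧ N.net.tgt d = N.pt (Fin.last k)}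

/-- The pair of marks of an oriented edge. -/
def marks (N : PointedNetwork Ξ k) (d : N.net.D) : Ξ × Ξ :=
  (N.net.dmark d, N.net.dmark (N.net.rev d))

/-- The number of oriented edges from the root to the last distinguished vertex whose marks lie in
`C`. -/
noncomputable def ecount (C : Set (Ξ × Ξ)) (a : NetworkSpace Ξ k) : ℝ≥0∞ :=
  ∑' d : REdge a.rep, C.indicator 1 (marks a.rep d.1)

theorem ecount_mk (C : Set (Ξ × Ξ)) (N : PointedNetwork Ξ k) :
    ecount C (mk N) = ∑' d : REdge N, C.indicator 1 (marks N d.1) := by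
  obtain ⟨φ, hv, hd, hp⟩ := rep_mk N
  let e : REdge (mk N).rep ≃ REdge N := φ.onD.subtypeEquiv fun d => by
    rw [φ.src_onD, φ.tgt_onD, ← hp, show N.root = N.pt 0 from rfl, ← hp]
    simp only [φ.onV.apply_eq_iff_eq]
    rfl
  rw [ecount, ← e.tsum_eq]
  refine tsum_congr fun d => congrArg _ ?_
  change ((mk N).rep.net.dmark _, (mk N).rep.net.dmark _) =
    (N.net.dmark (φ.onD d.1), N.net.dmark (N.net.rev (φ.onD d.1)))
  rw [φ.rev_onD, hd, hd]

theorem ecount_pos_iff {C : Set (Ξ × Ξ)} {N : PointedNetwork Ξ 0} {x y : N.net.V} :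
    0 < ecount C (mk (N.withPt ![x, y])) ↔ N.net.edgeRel C x y := by
  rw [ecount_mk, pos_iff_ne_zero, ne_eq, ENNReal.tsum_eq_zero, not_forall]
  constructor
  · rintro ⟨d, hd⟩
    have : marks (N.withPt ![x, y]) d.1 ∈ C := by
      by_contra h
      exact hd (Set.indicator_of_notMem h _)
    exact ⟨d.1, d.2.1, d.2.2, this⟩
  · rintro ⟨d, h1, h2, h3⟩
    refine ⟨⟨d, h1, h2⟩, ?_⟩
    have : marks (N.withPt ![x, y]) d ∈ C := h3
    simp [this]

/-- The networks with two distinguished vertices that lie in the same `A`-component. -/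
def connSet (A : Set Ξ) : Set (NetworkSpace Ξ 1) :=
  {a | a.rep.pt 1 ∈ a.rep.net.component A (a.rep.pt 0)}

theorem mk_mem_connSet {A : Set Ξ} {N : PointedNetwork Ξ 0} {x y : N.net.V} :
    mk (N.withPt ![x, y]) ∈ connSet A ↔ y ∈ N.net.component A x := by
  have aux : ∀ {P Q : PointedNetwork Ξ 1}, P ≈ Q → P.pt 1 ∈ P.net.component A (P.pt 0) →
      Q.pt 1 ∈ Q.net.component A (Q.pt 0) := by
    rintro P Q ⟨φ, hv, hd, hp⟩ h
    rw [mem_component_iff] at h ⊢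
    rw [← hp, ← hp]
    refine h.lift φ.onV ?_
    rintro a b ⟨d, h1, h2, h3, h4⟩
    refine ⟨φ.onD d, by rw [φ.src_onD, h1], by rw [φ.tgt_onD, h2], ?_, ?_⟩
    · simpa [hd] using h3
    · simpa [hd, φ.rev_onD] using h4
  exact ⟨aux (rep_mk (N.withPt ![x, y])), aux (Setoid.symm (rep_mk (N.withPt ![x, y])))⟩

/-- The networks with two distinguished vertices joined by an `A`-path of length `n`. -/
def pathSet (A : Set Ξ) : ℕ → Set (NetworkSpace Ξ 1)
  | 0 => within Ξ 1 0
  | n + 1 => {b | 0 < vsum ((reindex ![0, 2] ⁻¹' pathSet A n ∩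
      reindex ![2, 1] ⁻¹' {c | 0 < ecount (A ×ˢ A) c}).indicator 1) b}

/-- Reachability becomes a countable union over path lengths. Each existential over an intermediate
vertex is the positivity of a sum over vertices, so this exhibits `connSet A` as a Borel set. -/
theorem iUnion_pathSet (A : Set Ξ) : ⋃ n, pathSet A n = connSet A := by
  have h0 : ∀ (N : PointedNetwork Ξ 0) (o x : N.net.V),
      mk (N.withPt ![o, x]) ∈ pathSet A 0 ↔ x = o := fun N o x => mk_mem_within.trans mem_cball_zero
  have h1 : ∀ (n : ℕ) (N : PointedNetwork Ξ 0) (o x : N.net.V),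
      mk (N.withPt ![o, x]) ∈ pathSet A (n + 1) ↔
        ∃ y, mk (N.withPt ![o, y]) ∈ pathSet A n ∧ N.net.edgeRel (A ×ˢ A) y x := by
    intro n N o x
    change 0 < vsum _ _ ↔ _
    -- The added vertex `y` has index 2: the path runs from `o` to `y`, and the final edge from `y`
    -- to `x`.
    have e1 : ∀ y, reindex ![0, 2] (mk (N.withPt ![o, x, y])) = mk (N.withPt ![o, y]) := fun y =>
      reindex_mk_withPt fun i => by fin_cases i <;> rfl
    have e2 : ∀ y, reindex ![2, 1] (mk (N.withPt ![o, x, y])) = mk (N.withPt ![y, x]) := fun y =>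
      reindex_mk_withPt fun i => by fin_cases i <;> rfl
    rw [vsum_mk_one, pos_iff_ne_zero, ne_eq, ENNReal.tsum_eq_zero, not_forall]
    refine exists_congr fun y => ?_
    rw [← ecount_pos_iff, ← e1 y, ← e2 y]
    by_cases h : mk (N.withPt ![o, x, y]) ∈ (reindex ![0, 2] ⁻¹' pathSet A n ∩
      reindex ![2, 1] ⁻¹' {c | 0 < ecount (A ×ˢ A) c})
    · simp only [Set.indicator_of_mem h, Pi.one_apply, one_ne_zero, not_false_eq_true, true_iff]
      exact h
    · simp only [Set.indicator_of_notMem h, not_true_eq_false, false_iff]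
      exact h
  ext a
  obtain ⟨N, o, x, rfl⟩ := exists_mk_withPt_one a
  rw [mk_mem_connSet, mem_component_iff, Set.mem_iUnion]
  constructor
  · rintro ⟨n, hn⟩
    induction n generalizing x with
    | zero => rw [(h0 N o x).1 hn]
    | succ n ih =>
      obtain ⟨y, hy, hyx⟩ := (h1 n N o x).1 hn
      exact (ih y hy).tail hyx
  · intro h
    induction h with
    | refl => exact ⟨0, (h0 N o o).2 rfl⟩
    | @tail b c _ hbc ih =>
      obtain ⟨n, hn⟩ := ih
      exact ⟨n + 1, (h1 n N o c).2 ⟨b, hn, hbc⟩⟩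

theorem tsum_indicator_one {α : Type*} (s : Set α) :
    ∑' x, s.indicator (1 : α → ℝ≥0∞) x = (s.encard : ℝ≥0∞) := by
  rw [← tsum_subtype, ← ENNReal.tsum_set_one]
  rfl

theorem indicator_one_congr {α β : Type*} {s : Set α} {t : Set β} {x : α} {y : β}
    (h : x ∈ s ↔ y ∈ t) : s.indicator (1 : α → ℝ≥0∞) x = t.indicator 1 y := by
  by_cases hx : x ∈ s
  · simp [hx, h.1 hx]
  · rw [Set.indicator_of_notMem hx, Set.indicator_of_notMem fun hy => hx (h.2 hy)]

theorem vsum_connSet (A : Set Ξ) (N : PointedNetwork Ξ 0) :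
    vsum ((connSet A).indicator 1) (mk N) = ((N.net.component A N.root).encard : ℝ≥0∞) := by
  rw [vsum_mk_zero, ← tsum_indicator_one]
  refine tsum_congr fun x => ?_
  exact indicator_one_congr mk_mem_connSet

/-- The number of vertices joined to the root by an edge with some mark not in `A`. -/
noncomputable def rootCut (A : Set Ξ) : NetworkSpace Ξ 0 → ℝ≥0∞ :=
  vsum ({b | 0 < ecount ((A ×ˢ A)ᶜ) b}.indicator 1)

theorem rootCut_mk (A : Set Ξ) (N : PointedNetwork Ξ 0) (x : N.net.V) :
    rootCut A (mk (N.withPt ![x])) = N.net.cut A x := by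
  rw [rootCut, vsum_mk, cut, ← tsum_indicator_one]
  refine tsum_congr fun y => indicator_one_congr ?_
  have h1 : (N.withPt ![x]).addPt y = N.withPt ![x, y] := by
    refine congrArg N.withPt (funext fun i => ?_)
    fin_cases i <;> rfl
  rw [h1]
  refine ecount_pos_iff.trans (exists_congr fun d => ?_)
  simp only [Set.mem_compl_iff, Set.mem_prod, not_and_or]

section Measurability

variable [MetricSpace Ξ]

theorem exists_equiv_redge {R : ℕ} {ε : ℝ} {N M : PointedNetwork Ξ k} (h : CloseWith R ε N M)
    (hR : N.pt (Fin.last k) ∈ N.net.cball N.root R) :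
    ∃ e : REdge N ≃ REdge M, ∀ d, dist (marks N d.1) (marks M (e d).1) < ε := by
  obtain ⟨φ, -, hd, hp⟩ := h
  have hr := ball_iso_root hp
  have hl : (φ.onV ⟨_, hR⟩).1 = M.pt (Fin.last k) := (hp _ ⟨_, hR⟩).1 rfl
  have hR' : M.pt (Fin.last k) ∈ M.net.cball M.root R := hl ▸ (φ.onV ⟨_, hR⟩).2
  have mem : ∀ d : REdge N, d.1 ∈ N.net.eball N.root R := fun d =>
    ⟨by rw [d.2.1]; exact self_mem_cball _ _, by rw [d.2.2]; exact hR⟩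
  have mem' : ∀ d : REdge M, d.1 ∈ M.net.eball M.root R := fun d =>
    ⟨by rw [d.2.1]; exact self_mem_cball _ _, by rw [d.2.2]; exact hR'⟩
  have s1 : ∀ d : REdge N, M.net.src (φ.onD ⟨d.1, mem d⟩).1 = M.root ∧
      M.net.tgt (φ.onD ⟨d.1, mem d⟩).1 = M.pt (Fin.last k) := fun d => by
    have h1 : M.net.src (φ.onD ⟨d.1, mem d⟩).1 = (φ.onV ⟨N.net.src d.1, (mem d).1⟩).1 :=
      congrArg Subtype.val (φ.src_onD _)
    have h2 : M.net.tgt (φ.onD ⟨d.1, mem d⟩).1 = (φ.onV ⟨N.net.tgt d.1, (mem d).2⟩).1 :=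
      congrArg Subtype.val (φ.tgt_onD _)
    refine ⟨h1.trans ?_, h2.trans ?_⟩
    · exact (congrArg (fun v => (φ.onV v).1) (Subtype.ext d.2.1)).trans hr
    · exact (congrArg (fun v => (φ.onV v).1) (Subtype.ext d.2.2)).trans hl
  have s2 : ∀ d : REdge M, N.net.src (φ.symm.onD ⟨d.1, mem' d⟩).1 = N.root ∧
      N.net.tgt (φ.symm.onD ⟨d.1, mem' d⟩).1 = N.pt (Fin.last k) := fun d => by
    have h1 : N.net.src (φ.symm.onD ⟨d.1, mem' d⟩).1
        = (φ.symm.onV ⟨M.net.src d.1, (mem' d).1⟩).1 := congrArg Subtype.val (φ.symm.src_onD _)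
    have h2 : N.net.tgt (φ.symm.onD ⟨d.1, mem' d⟩).1
        = (φ.symm.onV ⟨M.net.tgt d.1, (mem' d).2⟩).1 := congrArg Subtype.val (φ.symm.tgt_onD _)
    have h3 : φ.symm.onV ⟨M.net.src d.1, (mem' d).1⟩ = ⟨N.root, self_mem_cball _ _⟩ :=
      φ.onV.symm_apply_eq.2 (Subtype.ext (d.2.1.trans hr.symm))
    have h4 : φ.symm.onV ⟨M.net.tgt d.1, (mem' d).2⟩ = ⟨_, hR⟩ :=
      φ.onV.symm_apply_eq.2 (Subtype.ext (d.2.2.trans hl.symm))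
    rw [h1, h2, h3, h4]
    exact ⟨rfl, rfl⟩
  let e : REdge N ≃ REdge M :=
    { toFun := fun d => ⟨(φ.onD ⟨d.1, mem d⟩).1, s1 d⟩
      invFun := fun d => ⟨(φ.symm.onD ⟨d.1, mem' d⟩).1, s2 d⟩
      left_inv := fun d =>
        Subtype.ext (congrArg Subtype.val (φ.onD.symm_apply_apply ⟨d.1, mem d⟩) :)
      right_inv := fun d =>
        Subtype.ext (congrArg Subtype.val (φ.onD.apply_symm_apply ⟨d.1, mem' d⟩) :) }
  refine ⟨e, fun d => max_lt (hd ⟨d.1, mem d⟩) ?_⟩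
  have h1 := hd ((N.net.ball N.root R).rev ⟨d.1, mem d⟩)
  exact lt_of_eq_of_lt (congrArg (fun x => dist _ ((M.net.ball M.root R).dmark x))
    (φ.rev_onD ⟨d.1, mem d⟩)) h1

/-- Finitely many edges start at the root, so one `δ` works for all whose marks lie in the open set
`C`. Under a perturbation smaller than `δ` none of these leaves `C`. -/
theorem ecount_lsc {C : Set (Ξ × Ξ)} (hC : IsOpen C) :
    LowerSemicontinuous (ecount C : NetworkSpace Ξ k → ℝ≥0∞) := by
  intro a y hy
  obtain ⟨N, rfl⟩ := exists_mk_eq a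
  have h1 : ∀ d : REdge N, ∃ ε > 0, ∀ p, marks N d.1 ∈ C → dist (marks N d.1) p < ε → p ∈ C :=
    fun d => by
    by_cases hd : marks N d.1 ∈ C
    · obtain ⟨ε, hε, h⟩ := Metric.isOpen_iff.1 hC _ hd
      exact ⟨ε, hε, fun p _ hp => h (by rwa [Metric.mem_ball, dist_comm])⟩
    · exact ⟨1, one_pos, fun p h => absurd h hd⟩
  choose ε hε hC' using h1
  have hfin : Finite (REdge N) := (N.locallyFinite N.root).subset fun d hd => hd.1
  obtain ⟨δ, hδ, hδε⟩ : ∃ δ > 0, ∀ d, δ ≤ ε d := by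
    rcases isEmpty_or_nonempty (REdge N) with h | h
    · exact ⟨1, one_pos, fun d => isEmptyElim d⟩
    · obtain ⟨d, hd⟩ := Finite.exists_min ε
      exact ⟨ε d, hε d, hd⟩
  obtain ⟨m, hm⟩ := exists_mem_cball N.connected N.root (N.pt (Fin.last k))
  refine mem_nhds_of_closeWith (n := m) hδ fun M hM => hy.trans_le ?_
  obtain ⟨e, he⟩ := exists_equiv_redge hM hm
  rw [ecount_mk, ecount_mk, ← e.tsum_eq]
  refine ENNReal.tsum_le_tsum fun d => ?_
  by_cases hd : marks N d.1 ∈ C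
  · have := hC' d _ hd ((he d).trans_le (hδε d))
    simp [hd, this]
  · simp [hd]

theorem measurable_ecount {C : Set (Ξ × Ξ)} (hC : MeasurableSet[borel (Ξ × Ξ)] C) :
    Measurable (ecount C : NetworkSpace Ξ k → ℝ≥0∞) := by
  let _ : MeasurableSpace (Ξ × Ξ) := borel _
  have : BorelSpace (Ξ × Ξ) := ⟨rfl⟩
  let m : NetworkSpace Ξ k → Measure (Ξ × Ξ) := fun a =>
    Measure.sum fun d : REdge a.rep => Measure.dirac (marks a.rep d.1)
  have hm : ∀ (s : Set (Ξ × Ξ)), MeasurableSet s → ∀ a, m a s = ecount s a := fun s hs a => by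
    rw [Measure.sum_apply _ hs, ecount]
    exact tsum_congr fun d => Measure.dirac_apply' _ hs
  have hfin : ∀ a, m a Set.univ ≠ ∞ := fun a => by
    rw [hm _ .univ, ecount]
    have : Finite (REdge a.rep) := (a.rep.locallyFinite a.rep.root).subset fun d hd => hd.1
    have := Fintype.ofFinite (REdge a.rep)
    rw [tsum_fintype]
    exact ENNReal.sum_ne_top.2 fun d _ => by simp
  suffices h : Measurable fun a => m a C by
    refine (funext fun a => ?_ : (fun a => m a C) = ecount C) ▸ h
    exact hm C hC a
  have hopen : ∀ t : Set (Ξ × Ξ), IsOpen t → Measurable fun a => m a t := fun t ht => by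
    simp only [hm t ht.measurableSet]
    exact (ecount_lsc ht).measurable
  induction C, hC using MeasurableSpace.induction_on_inter
    (h_eq := rfl) (h_inter := isPiSystem_isOpen) with
  | empty => simp
  | basic t ht => exact hopen t ht
  | compl t ht ih =>
    have : ∀ a, m a tᶜ = m a Set.univ - m a t := fun a =>
      measure_compl ht (ne_top_of_le_ne_top (hfin a) (measure_mono (Set.subset_univ _)))
    simp only [this]
    exact (hopen _ isOpen_univ).sub ih
  | iUnion f hd hf ih =>
    have : ∀ a, m a (⋃ i, f i) = ∑' i, m a (f i) := fun a => measure_iUnion hd hf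
    simp only [this]
    exact Measurable.tsum ih

/-- The Borel σ-algebra of the product is used directly: both projections are continuous, so
separability plays no role. -/
theorem measurableSet_prod_self {A : Set Ξ} (hA : MeasurableSet[borel Ξ] A) :
    MeasurableSet[borel (Ξ × Ξ)] (A ×ˢ A) := by
  let _ : MeasurableSpace (Ξ × Ξ) := borel _
  have : BorelSpace (Ξ × Ξ) := ⟨rfl⟩
  let _ : MeasurableSpace Ξ := borel _
  have : BorelSpace Ξ := ⟨rfl⟩
  have h1 : @Measurable (Ξ × Ξ) Ξ (borel _) _ Prod.fst :=
    @Continuous.measurable _ _ _ (borel _) ⟨le_rfl⟩ _ _ _ _ continuous_fst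
  have h2 : @Measurable (Ξ × Ξ) Ξ (borel _) _ Prod.snd :=
    @Continuous.measurable _ _ _ (borel _) ⟨le_rfl⟩ _ _ _ _ continuous_snd
  exact @MeasurableSet.inter _ (borel _) _ _ (h1 hA) (h2 hA)

theorem measurableSet_connSet {A : Set Ξ} (hA : MeasurableSet[borel Ξ] A) :
    MeasurableSet (connSet A) := by
  rw [← iUnion_pathSet]
  refine MeasurableSet.iUnion fun n => ?_
  induction n with
  | zero => exact measurableSet_within 0
  | succ n ih =>
    refine measurableSet_lt measurable_const (measurable_vsum (measurable_one.indicator ?_))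
    exact (measurable_reindex _ ih).inter (measurable_reindex _
      (measurableSet_lt measurable_const (measurable_ecount (measurableSet_prod_self hA))))

theorem measurable_rootCut {A : Set Ξ} (hA : MeasurableSet[borel Ξ] A) :
    Measurable (rootCut A) :=
  measurable_vsum (measurable_one.indicator (measurableSet_lt measurable_const
    (measurable_ecount (@MeasurableSet.compl _ _ (borel _) (measurableSet_prod_self hA)))))

end Measurability

end NetworkSpace

/-! ### Nearby pairs, the uniform transport on clusters and mass-transport estimates. -/

namespace NetworkSpace

open Network PointedNetwork Filter Topology

variable {Ξ Ξ' : Type*} {k : ℕ}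

theorem exists_mk_withPt_two (a : NetworkSpace Ξ 2) :
    ∃ (N : PointedNetwork Ξ 0) (o x y : N.net.V), mk (N.withPt ![o, x, y]) = a := by
  obtain ⟨N, rfl⟩ := exists_mk_eq a
  refine ⟨N.withPt ![N.root], N.pt 0, N.pt 1, N.pt 2, ?_⟩
  change mk (N.withPt _) = mk (N.withPt N.pt)
  congr 2
  funext i
  fin_cases i <;> rfl

theorem reindex_reindex {l m : ℕ} (σ : Fin (l + 1) → Fin (k + 1)) (τ : Fin (m + 1) → Fin (l + 1))
    (a : NetworkSpace Ξ k) : reindex τ (reindex σ a) = reindex (σ ∘ τ) a := by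
  obtain ⟨N, rfl⟩ := exists_mk_eq a
  rfl

theorem reindex_zero_swap (b : NetworkSpace Ξ 1) :
    reindex ![0] (reindex ![1, 0] b) = reindex ![1] b := by
  rw [reindex_reindex]; congr 1; funext i; fin_cases i; rfl

theorem reindex_one_swap (b : NetworkSpace Ξ 1) :
    reindex ![1] (reindex ![1, 0] b) = reindex ![0] b := by
  rw [reindex_reindex]; congr 1; funext i; fin_cases i; rfl

theorem reindex_swap_swap (b : NetworkSpace Ξ 1) :
    reindex ![1, 0] (reindex ![1, 0] b) = b := by
  obtain ⟨N, o, x, rfl⟩ := exists_mk_withPt_one b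
  rw [reindex_reindex]
  exact reindex_mk_withPt fun i => by fin_cases i <;> rfl

theorem reindex_withPt_zero (N : PointedNetwork Ξ 0) (x y : N.net.V) :
    reindex ![0] (mk (N.withPt ![x, y])) = mk (N.withPt ![x]) :=
  reindex_mk_withPt fun i => by fin_cases i; rfl

theorem reindex_withPt_one (N : PointedNetwork Ξ 0) (x y : N.net.V) :
    reindex ![1] (mk (N.withPt ![x, y])) = mk (N.withPt ![y]) :=
  reindex_mk_withPt fun i => by fin_cases i; rfl

theorem reindex_withPt_swap (N : PointedNetwork Ξ 0) (x y : N.net.V) :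
    reindex ![1, 0] (mk (N.withPt ![x, y])) = mk (N.withPt ![y, x]) :=
  reindex_mk_withPt fun i => by fin_cases i <;> rfl

theorem mk_withPt_root (N : PointedNetwork Ξ 0) : mk (N.withPt ![N.root]) = mk N := by
  change mk (N.withPt _) = mk (N.withPt N.pt)
  congr 2
  funext i
  fin_cases i; rfl

theorem vsum_mul_root (F : NetworkSpace Ξ 0 → ℝ≥0∞) (f : NetworkSpace Ξ 1 → ℝ≥0∞)
    (a : NetworkSpace Ξ 0) : vsum (fun b => F (reindex ![0] b) * f b) a = F a * vsum f a := by
  have h : (![0] : Fin 1 → Fin 2) = Fin.castSucc := by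
    funext i; fin_cases i; rfl
  rw [h]
  exact vsum_mul_left F f a

theorem vsum_mul_first (F : NetworkSpace Ξ 1 → ℝ≥0∞) (f : NetworkSpace Ξ 2 → ℝ≥0∞)
    (a : NetworkSpace Ξ 1) : vsum (fun b => F (reindex ![0, 1] b) * f b) a = F a * vsum f a := by
  have h : (![0, 1] : Fin 2 → Fin 3) = Fin.castSucc := by
    funext i; fin_cases i <;> rfl
  rw [h]
  exact vsum_mul_left F f a

theorem vsum_const_mul (c : ℝ≥0∞) (f : NetworkSpace Ξ (k + 1) → ℝ≥0∞) (a : NetworkSpace Ξ k) :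
    vsum (fun b => c * f b) a = c * vsum f a := ENNReal.tsum_mul_left

/-- The number of vertices at distance at most `n` from the root. -/
noncomputable def bcount (n : ℕ) : NetworkSpace Ξ 0 → ℝ≥0∞ := vsum ((within Ξ 1 n).indicator 1)

theorem bcount_mk (n : ℕ) (N : PointedNetwork Ξ 0) (x : N.net.V) :
    bcount n (mk (N.withPt ![x])) = ((N.net.cball x n).encard : ℝ≥0∞) := by
  rw [bcount, vsum_mk, ← tsum_indicator_one]
  exact tsum_congr fun y => indicator_one_congr addPt_mem_within

theorem bcount_ne_top (n : ℕ) (a : NetworkSpace Ξ 0) : bcount n a ≠ ∞ :=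
  vsum_ne_top (n := n) (fun _ hb => Set.indicator_of_notMem hb _) (fun b => by
    by_cases h : b ∈ within Ξ 1 n <;> simp [h]) a

theorem mk_withPt_mem_within {n : ℕ} {N : PointedNetwork Ξ 0} {x y : N.net.V} :
    mk (N.withPt ![x, y]) ∈ within Ξ 1 n ↔ y ∈ N.net.cball x n := mk_mem_within

/-- Pairs of vertices at distance at most `r` around which the balls of radius `2 r` have at most
`D` vertices. -/
def nearSet (Ξ : Type*) (r D : ℕ) : Set (NetworkSpace Ξ 1) :=
  {b | b ∈ within Ξ 1 r ∧ bcount (2 * r) (reindex ![0] b) ≤ D ∧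
    bcount (2 * r) (reindex ![1] b) ≤ D}

theorem mk_mem_nearSet {r D : ℕ} {N : PointedNetwork Ξ 0} {x y : N.net.V} :
    mk (N.withPt ![x, y]) ∈ nearSet Ξ r D ↔ y ∈ N.net.cball x r ∧
      ((N.net.cball x (2 * r)).encard : ℝ≥0∞) ≤ D ∧
      ((N.net.cball y (2 * r)).encard : ℝ≥0∞) ≤ D := by
  change _ ∧ _ ≤ _ ∧ _ ≤ _ ↔ _
  rw [mk_withPt_mem_within, reindex_withPt_zero, reindex_withPt_one, bcount_mk, bcount_mk]

theorem swap_mem_nearSet {r D : ℕ} {b : NetworkSpace Ξ 1} :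
    reindex ![1, 0] b ∈ nearSet Ξ r D ↔ b ∈ nearSet Ξ r D := by
  obtain ⟨N, o, x, rfl⟩ := exists_mk_withPt_one b
  rw [reindex_withPt_swap, mk_mem_nearSet, mk_mem_nearSet, mem_cball_comm]
  tauto

theorem map_mem_nearSet {r D : ℕ} {f : Ξ → Ξ'} {b : NetworkSpace Ξ 1} :
    map f b ∈ nearSet Ξ' r D ↔ b ∈ nearSet Ξ r D := by
  obtain ⟨N, o, x, rfl⟩ := exists_mk_withPt_one b
  exact (mk_mem_nearSet (N := N.map f) (x := o) (y := x)).trans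
    (mk_mem_nearSet (N := N) (x := o) (y := x)).symm

theorem exists_mem_nearSet (b : NetworkSpace Ξ 1) : ∃ r D, b ∈ nearSet Ξ r D := by
  have hb : b ∈ ⋃ n, within Ξ 1 n := by rw [iUnion_within]; trivial
  obtain ⟨r, hr⟩ := Set.mem_iUnion.1 hb
  obtain ⟨D, hD⟩ := ENNReal.exists_nat_gt
    (max_lt (bcount_ne_top (2 * r) (reindex ![0] b)).lt_top
      (bcount_ne_top (2 * r) (reindex ![1] b)).lt_top).ne
  exact ⟨r, D, hr, (le_max_left _ _).trans hD.le, (le_max_right _ _).trans hD.le⟩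

/-- Either the ball of radius `2 r` about the root has at most `D` vertices and contains every
candidate, or no pair with this root is admissible. -/
theorem vsum_nearSet_le (r D : ℕ) (a : NetworkSpace Ξ 0) :
    vsum ((nearSet Ξ r D).indicator 1) a ≤ D := by
  obtain ⟨N, rfl⟩ := exists_mk_eq a
  rw [vsum_mk_zero]
  by_cases h : ((N.net.cball N.root (2 * r)).encard : ℝ≥0∞) ≤ D
  · refine le_trans ?_ h
    rw [← tsum_indicator_one]
    refine ENNReal.tsum_le_tsum fun x => ?_
    by_cases hx : mk (N.withPt ![N.root, x]) ∈ nearSet Ξ r D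
    · have : x ∈ N.net.cball N.root (2 * r) :=
        cball_mono (by omega) (mk_mem_nearSet.1 hx).1
      simp [hx, this]
    · simp [hx]
  · refine le_of_eq_of_le (ENNReal.tsum_eq_zero.2 fun x => ?_) zero_le
    exact Set.indicator_of_notMem (fun hx => h (mk_mem_nearSet.1 hx).2.1) _

/-- The uniform distribution on the component of the root. -/
noncomputable def kap (A : Set Ξ) (b : NetworkSpace Ξ 1) : ℝ≥0∞ :=
  (connSet A).indicator 1 b * (vsum ((connSet A).indicator 1) (reindex ![0] b))⁻¹

theorem vsum_connSet_withPt (A : Set Ξ) (N : PointedNetwork Ξ 0) (x : N.net.V) :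
    vsum ((connSet A).indicator 1) (mk (N.withPt ![x])) = ((N.net.component A x).encard : ℝ≥0∞) :=
  vsum_connSet A (N.withPt ![x])

theorem kap_mk (A : Set Ξ) (N : PointedNetwork Ξ 0) (x y : N.net.V) :
    kap A (mk (N.withPt ![x, y])) =
      (N.net.component A x).indicator 1 y * ((N.net.component A x).encard : ℝ≥0∞)⁻¹ := by
  rw [kap, reindex_withPt_zero, vsum_connSet_withPt, indicator_one_congr mk_mem_connSet]

/-- Two vertices in the same cluster see the same cluster size; otherwise both sides vanish. -/
theorem kap_swap (A : Set Ξ) (b : NetworkSpace Ξ 1) : kap A (reindex ![1, 0] b) = kap A b := by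
  obtain ⟨N, o, x, rfl⟩ := exists_mk_withPt_one b
  rw [reindex_withPt_swap, kap_mk, kap_mk]
  by_cases h : x ∈ N.net.component A o
  · rw [component_eq h, Set.indicator_of_mem h, Set.indicator_of_mem (mem_component_self o)]
    rfl
  · rw [Set.indicator_of_notMem h, Set.indicator_of_notMem fun h' => h (mem_component_comm.1 h'),
      zero_mul, zero_mul]

theorem vsum_kap (A : Set Ξ) (a : NetworkSpace Ξ 0) :
    vsum (kap A) a =
      (vsum ((connSet A).indicator 1) a)⁻¹ * vsum ((connSet A).indicator 1) a := by
  rw [← vsum_mul_root (fun a => (vsum ((connSet A).indicator 1) a)⁻¹)]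
  exact congrArg (fun f => vsum f a) (funext fun b => mul_comm _ _)

/-- Infinite clusters are included: there the convention `∞⁻¹ = 0` makes the sum zero. -/
theorem vsum_kap_le_one (A : Set Ξ) (a : NetworkSpace Ξ 0) : vsum (kap A) a ≤ 1 := by
  rw [vsum_kap]; exact ENNReal.inv_mul_le_one _

theorem vsum_kap_eq_one {A : Set Ξ} {a : NetworkSpace Ξ 0}
    (h : (a.rep.net.component A a.rep.root).Finite) : vsum (kap A) a = 1 := by
  rw [vsum_kap, ← mk_rep a, vsum_connSet]
  refine ENNReal.inv_mul_cancel ?_ ?_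
  · have : (a.rep.net.component A a.rep.root).encard ≠ 0 :=
      Set.encard_ne_zero.2 ⟨_, mem_component_self _⟩
    simpa using this
  · have := h.encard_lt_top.ne
    simpa using this

/-- If the two targets share a cluster, they receive the same mass and the difference is zero;
otherwise the subtracted term is dropped. -/
theorem kap_sub_le (A : Set Ξ) (c : NetworkSpace Ξ 2) :
    kap A (reindex ![0, 1] c) - kap A (reindex ![0, 2] c) ≤
      kap A (reindex ![0, 1] c) * (connSet A)ᶜ.indicator 1 (reindex ![1, 2] c) := by
  obtain ⟨N, o, x, y, rfl⟩ := exists_mk_withPt_two c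
  have e1 : reindex ![0, 1] (mk (N.withPt ![o, x, y])) = mk (N.withPt ![o, x]) :=
    reindex_mk_withPt fun i => by fin_cases i <;> rfl
  have e2 : reindex ![0, 2] (mk (N.withPt ![o, x, y])) = mk (N.withPt ![o, y]) :=
    reindex_mk_withPt fun i => by fin_cases i <;> rfl
  have e3 : reindex ![1, 2] (mk (N.withPt ![o, x, y])) = mk (N.withPt ![x, y]) :=
    reindex_mk_withPt fun i => by fin_cases i <;> rfl
  rw [e1, e2, e3]
  by_cases hxy : y ∈ N.net.component A x
  · refine le_of_eq_of_le ?_ zero_le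
    rw [kap_mk, kap_mk, tsub_eq_zero_iff_le]
    refine le_of_eq (congrArg (· * _) (indicator_one_congr ?_))
    exact ⟨fun h => SimpleGraph.Reachable.trans h hxy,
      fun h => SimpleGraph.Reachable.trans h (SimpleGraph.Reachable.symm hxy)⟩
  · have : mk (N.withPt ![x, y]) ∈ (connSet A)ᶜ := fun h => hxy (mk_mem_connSet.1 h)
    rw [Set.indicator_of_mem this, Pi.one_apply, mul_one]
    exact tsub_le_self

/-- A path of length at most `n` that leaves the cluster has a first edge that is not open. Its
starting vertex is still in the ball, and this edge makes its cut nonzero. -/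
theorem exists_cut_of_notMem_component {N : Network Ξ} {A : Set Ξ} {n : ℕ} {x y : N.V}
    (h : y ∈ N.cball x n) (hy : y ∉ N.component A x) :
    ∃ z ∈ N.cball x n, 1 ≤ N.cut A z := by
  induction n generalizing x with
  | zero =>
    obtain rfl := mem_cball_zero.1 h
    exact absurd (mem_component_self y) hy
  | succ n ih =>
    rcases mem_cball_succ h with rfl | ⟨d, rfl, hd⟩
    · exact absurd (mem_component_self y) hy
    · by_cases ho : N.dmark d ∈ A ∧ N.dmark (N.rev d) ∈ A
      · have h1 : N.tgt d ∈ N.component A (N.src d) :=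
          mem_component_iff.2 (.single ⟨d, rfl, rfl, ho⟩)
        obtain ⟨z, hz, hz'⟩ := ih hd fun h' => hy (SimpleGraph.Reachable.trans h1 h')
        refine ⟨z, ?_, hz'⟩
        rw [add_comm]
        exact mem_cball_trans (tgt_mem_cball d) hz
      · refine ⟨N.src d, self_mem_cball _ _, ?_⟩
        have : (1 : ℕ∞) ≤ {y | ∃ e, N.src e = N.src d ∧ N.tgt e = y ∧
            (N.dmark e ∉ A ∨ N.dmark (N.rev e) ∉ A)}.encard :=
          Set.one_le_encard_iff_nonempty.2 ⟨N.tgt d, d, rfl, rfl, not_and_or.1 ho⟩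
        rw [cut, ← ENat.toENNReal_one]
        exact ENat.toENNReal_le.2 this

/-- If any nearby vertex is in another cluster, then some vertex within distance `r` has a nonzero
cut. It alone pays for all of the at most `D` such vertices. -/
theorem vsum_near_disconnected_le (A : Set Ξ) (r D : ℕ) (a : NetworkSpace Ξ 0) :
    vsum ((nearSet Ξ r D ∩ (connSet A)ᶜ).indicator 1) a ≤
      D * vsum (fun b => ((within Ξ 1 r).indicator 1 b *
        {c | bcount (2 * r) c ≤ D}.indicator 1 (reindex ![0] b)) *
          rootCut A (reindex ![1] b)) a := by
  obtain ⟨N, rfl⟩ := exists_mk_eq a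
  by_cases hex : ∃ y, mk (N.withPt ![N.root, y]) ∈ nearSet Ξ r D ∩ (connSet A)ᶜ
  · obtain ⟨y, hy1, hy2⟩ := hex
    have hy1' := mk_mem_nearSet.1 hy1
    obtain ⟨z, hz, hz1⟩ := exists_cut_of_notMem_component hy1'.1 fun h => hy2 (mk_mem_connSet.2 h)
    calc vsum ((nearSet Ξ r D ∩ (connSet A)ᶜ).indicator 1) (mk N)
        ≤ vsum ((nearSet Ξ r D).indicator 1) (mk N) :=
          vsum_mono (fun b => Set.indicator_le_indicator_of_subset Set.inter_subset_left
            (fun _ => zero_le) b) _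
      _ ≤ D * 1 := by rw [mul_one]; exact vsum_nearSet_le r D _
      _ ≤ _ := by
          gcongr
          rw [vsum_mk_zero]
          refine le_trans ?_ (ENNReal.le_tsum z)
          have h1 : mk (N.withPt ![N.root, z]) ∈ within Ξ 1 r := mk_withPt_mem_within.2 hz
          have h2 : mk (N.withPt ![N.root]) ∈ {c | bcount (2 * r) c ≤ D} := by
            change bcount _ _ ≤ _
            rw [bcount_mk]; exact hy1'.2.1
          rw [reindex_withPt_zero, reindex_withPt_one, rootCut_mk, Set.indicator_of_mem h1,
            Set.indicator_of_mem h2]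
          simpa using hz1
  · refine le_of_eq_of_le ?_ zero_le
    rw [vsum_mk_zero, ENNReal.tsum_eq_zero]
    exact fun y => Set.indicator_of_notMem (fun h => hex ⟨y, h⟩) _

/-- All vertices that contribute lie within distance `2 r` of any fixed one of them, whose ball of
that radius has at most `D` vertices. This is why `nearSet` bounds balls of radius `2 r`. -/
theorem vsum_swap_within_le (r D : ℕ) (a : NetworkSpace Ξ 0) :
    vsum (fun b => (within Ξ 1 r).indicator 1 (reindex ![1, 0] b) *
        {c | bcount (2 * r) c ≤ D}.indicator 1 (reindex ![1] b)) a ≤ D := by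
  obtain ⟨N, rfl⟩ := exists_mk_eq a
  simp only [vsum_mk_zero, reindex_withPt_swap, reindex_withPt_one]
  by_cases hex : ∃ x, N.root ∈ N.net.cball x r ∧ ((N.net.cball x (2 * r)).encard : ℝ≥0∞) ≤ D
  · obtain ⟨x, hx, hD⟩ := hex
    refine le_trans ?_ hD
    rw [← tsum_indicator_one]
    refine ENNReal.tsum_le_tsum fun y => ?_
    rw [indicator_one_congr (mk_withPt_mem_within (N := N) (n := r) (x := y) (y := N.root))]
    by_cases hy : N.root ∈ N.net.cball y r
    · have : y ∈ N.net.cball x (2 * r) := by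
        rw [two_mul]; exact mem_cball_trans hx (mem_cball_comm.1 hy)
      rw [Set.indicator_of_mem this]
      refine mul_le_one' ?_ ?_ <;>
        exact Set.indicator_le_self' (fun _ _ => zero_le) _
    · rw [Set.indicator_of_notMem (s := N.net.cball y r) hy, zero_mul]
      exact zero_le
  · refine le_of_eq_of_le (ENNReal.tsum_eq_zero.2 fun x => ?_) zero_le
    by_cases h1 : mk (N.withPt ![x, N.root]) ∈ within Ξ 1 r
    · have h2 : mk (N.withPt ![x]) ∉ {c | bcount (2 * r) c ≤ D} := fun h => by
        change bcount _ _ ≤ _ at h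
        rw [bcount_mk] at h
        exact hex ⟨x, mk_withPt_mem_within.1 h1, h⟩
      rw [Set.indicator_of_notMem h2, mul_zero]
    · rw [Set.indicator_of_notMem h1, zero_mul]

section Measure

variable [MetricSpace Ξ] [MetricSpace Ξ']

theorem isClopen_bcount_le (n D : ℕ) : IsClopen {a : NetworkSpace Ξ 0 | bcount n a ≤ D} := by
  refine isClopen_of_closeWith fun N => ⟨n, fun M hM => ?_⟩
  obtain ⟨e, -⟩ := exists_equiv_cball hM le_rfl
  change bcount n _ ≤ D ↔ bcount n _ ≤ D
  rw [← mk_withPt_root N, ← mk_withPt_root M, bcount_mk, bcount_mk, Set.encard_congr e]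

theorem isClopen_nearSet (r D : ℕ) : IsClopen (nearSet Ξ r D) :=
  (isClopen_within r).inter (((isClopen_bcount_le _ D).preimage (continuous_reindex ![0])).inter
    ((isClopen_bcount_le _ D).preimage (continuous_reindex ![1])))

theorem measurableSet_nearSet (r D : ℕ) : MeasurableSet (nearSet Ξ r D) :=
  (isClopen_nearSet r D).isOpen.measurableSet

theorem measurable_kap {A : Set Ξ} (hA : MeasurableSet[borel Ξ] A) : Measurable (kap A) := by
  have h : Measurable ((connSet A).indicator (1 : NetworkSpace Ξ 1 → ℝ≥0∞)) :=
    measurable_one.indicator (measurableSet_connSet hA)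
  exact h.mul ((measurable_vsum h).comp (measurable_reindex _)).inv

theorem _root_.IsUnimodular.mtp {μ : Measure (GStar Ξ)} (hμ : IsUnimodular μ)
    {f : NetworkSpace Ξ 1 → ℝ≥0∞} (hf : Measurable f) :
    ∫⁻ a, vsum f a ∂μ = ∫⁻ a, vsum (fun b => f (reindex ![1, 0] b)) a ∂μ := by
  have h := hμ.massTransport f hf
  simp only [← vsum_mk_zero, ← vsum_swap_mk, mk_rep] at h
  exact h

theorem isUnimodular_of_mtp {μ : Measure (GStar Ξ)} [h : IsProbabilityMeasure μ]
    (h' : ∀ f : NetworkSpace Ξ 1 → ℝ≥0∞, Measurable f →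
      ∫⁻ a, vsum f a ∂μ = ∫⁻ a, vsum (fun b => f (reindex ![1, 0] b)) a ∂μ) :
    IsUnimodular μ where
  isProbabilityMeasure := h
  massTransport f hf := by
    simp only [← vsum_mk_zero, ← vsum_swap_mk, mk_rep]
    exact h' f hf

theorem _root_.IsUnimodular.map {μ : Measure (GStar Ξ)} (hμ : IsUnimodular μ) {g : Ξ → Ξ'}
    (hg : LipschitzWith 1 g) : IsUnimodular (μ.map (NetworkSpace.map g)) := by
  have := hμ.isProbabilityMeasure
  have hm := measurable_map (k := 0) hg
  have := Measure.isProbabilityMeasure_map (μ := μ) hm.aemeasurable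
  refine isUnimodular_of_mtp fun f hf => ?_
  rw [lintegral_map (measurable_vsum hf) hm,
    lintegral_map (measurable_vsum (f := fun b => f (reindex ![1, 0] b))
      (hf.comp (measurable_reindex _))) hm]
  simp only [vsum_map]
  rw [hμ.mtp (f := fun b => f (NetworkSpace.map g b)) (hf.comp (measurable_map hg))]
  simp only [map_reindex]

variable {P : Measure (GStar Ξ)} {A : Set Ξ}

/-- By `kap_sub_le` the root sends to each `x` the mass `kap A`, weighted by the number of partners
of `x` outside its cluster. Mass transport brings this weight back to the root, where the symmetric
`kap A` has total mass at most 1. -/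
theorem lintegral_kap_sub_le (hP : IsUnimodular P) (hA : MeasurableSet[borel Ξ] A)
    {U : Set (NetworkSpace Ξ 1)} (hU : MeasurableSet U) :
    ∫⁻ a, vsum (vsum fun c => U.indicator 1 (reindex ![1, 2] c) *
        (kap A (reindex ![0, 1] c) - kap A (reindex ![0, 2] c))) a ∂P ≤
      ∫⁻ a, vsum ((U ∩ (connSet A)ᶜ).indicator 1) a ∂P := by
  have hW : Measurable ((U ∩ (connSet A)ᶜ).indicator (1 : NetworkSpace Ξ 1 → ℝ≥0∞)) :=
    measurable_one.indicator (hU.inter (measurableSet_connSet hA).compl)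
  have hk := measurable_kap hA
  calc _ ≤ ∫⁻ a, vsum (vsum fun c => kap A (reindex ![0, 1] c) *
        (U ∩ (connSet A)ᶜ).indicator 1 (reindex ![1, 2] c)) a ∂P := by
        refine lintegral_mono fun a => vsum_mono (fun b => vsum_mono (fun c => ?_) b) a
        by_cases h : reindex ![1, 2] c ∈ U
        · rw [Set.indicator_of_mem h, Pi.one_apply, one_mul]
          refine (kap_sub_le A c).trans (le_of_eq (congrArg _ (indicator_one_congr ?_)))
          exact ⟨fun h' => ⟨h, h'⟩, fun h' => h'.2⟩
        · rw [Set.indicator_of_notMem h, zero_mul]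
          exact zero_le
    _ = ∫⁻ a, vsum (fun b => kap A b *
          vsum ((U ∩ (connSet A)ᶜ).indicator 1) (reindex ![1] b)) a ∂P := by
        simp only [vsum_reindex_one, ← vsum_mul_first]
    _ = ∫⁻ a, vsum ((U ∩ (connSet A)ᶜ).indicator 1) a * vsum (kap A) a ∂P := by
        rw [hP.mtp (f := fun b => kap A b *
            vsum ((U ∩ (connSet A)ᶜ).indicator 1) (reindex ![1] b))
          (hk.mul ((measurable_vsum hW).comp (measurable_reindex _)))]
        simp only [kap_swap, reindex_one_swap, ← vsum_mul_root]
        simp only [mul_comm]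
    _ ≤ _ := lintegral_mono fun a => mul_le_of_le_one_right zero_le (vsum_kap_le_one A a)

/-- One factor `D` counts the vertices paid for by a single cut vertex. The other counts, after mass
transport, the roots that charge a given cut vertex. -/
theorem lintegral_near_disconnected_le (hP : IsUnimodular P) (hA : MeasurableSet[borel Ξ] A)
    (r D : ℕ) :
    ∫⁻ a, vsum ((nearSet Ξ r D ∩ (connSet A)ᶜ).indicator 1) a ∂P ≤
      D * (D * ∫⁻ a, rootCut A a ∂P) := by
  have hc := measurable_rootCut hA
  have h1 : Measurable ((within Ξ 1 r).indicator (1 : NetworkSpace Ξ 1 → ℝ≥0∞)) :=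
    measurable_one.indicator (measurableSet_within r)
  have h2 : Measurable ({c : NetworkSpace Ξ 0 | bcount (2 * r) c ≤ D}.indicator
      (1 : NetworkSpace Ξ 0 → ℝ≥0∞)) :=
    measurable_one.indicator (isClopen_bcount_le _ D).isOpen.measurableSet
  have h3 : Measurable fun b : NetworkSpace Ξ 1 => ((within Ξ 1 r).indicator (1 : NetworkSpace Ξ 1 → ℝ≥0∞) b *
        {c | bcount (2 * r) c ≤ D}.indicator 1 (reindex ![0] b)) *
          rootCut A (reindex ![1] b) :=
    (h1.mul (h2.comp (measurable_reindex _))).mul (hc.comp (measurable_reindex _))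
  refine (lintegral_mono (vsum_near_disconnected_le A r D)).trans ?_
  rw [lintegral_const_mul _ (measurable_vsum h3), hP.mtp h3]
  gcongr
  rw [← lintegral_const_mul _ hc]
  refine lintegral_mono fun a => ?_
  simp only [reindex_one_swap, reindex_zero_swap]
  have : ∀ b : NetworkSpace Ξ 1, (within Ξ 1 r).indicator (1 : NetworkSpace Ξ 1 → ℝ≥0∞)
        (reindex ![1, 0] b) *
        {c | bcount (2 * r) c ≤ D}.indicator 1 (reindex ![1] b) * rootCut A (reindex ![0] b) =
      rootCut A (reindex ![0] b) * ((within Ξ 1 r).indicator 1 (reindex ![1, 0] b) *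
        {c | bcount (2 * r) c ≤ D}.indicator 1 (reindex ![1] b)) := fun b => mul_comm _ _
  simp only [this, vsum_mul_root]
  rw [mul_comm]
  gcongr
  exact vsum_swap_within_le r D a

/-- Every vertex distributes its cut evenly over its cluster. By mass transport the expected amount
sent equals the expected amount received, and the latter is the cluster average in the isoperimetric
constant. -/
theorem lintegral_rootCut (hP : IsUnimodular P) (hA : MeasurableSet[borel Ξ] A)
    (hfin : ∀ᵐ a ∂P, (a.rep.net.component A a.rep.root).Finite) :
    ∫⁻ a, rootCut A a ∂P = ∫⁻ a, (∑' x : a.rep.net.component A a.rep.root, a.rep.net.cut A x) /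
      ((a.rep.net.component A a.rep.root).encard : ℝ≥0∞) ∂P := by
  have hc := measurable_rootCut hA
  have hk := measurable_kap hA
  calc ∫⁻ a, rootCut A a ∂P = ∫⁻ a, rootCut A a * vsum (kap A) a ∂P := by
        refine lintegral_congr_ae ?_
        filter_upwards [hfin] with a ha
        rw [vsum_kap_eq_one ha, mul_one]
    _ = ∫⁻ a, vsum (fun b => kap A b * rootCut A (reindex ![1] b)) a ∂P := by
        rw [hP.mtp (f := fun b => kap A b * rootCut A (reindex ![1] b))
          (hk.mul (hc.comp (measurable_reindex _)))]
        simp only [kap_swap, reindex_one_swap, ← vsum_mul_root]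
        simp only [mul_comm]
    _ = _ := by
        refine lintegral_congr fun a => ?_
        conv_lhs => rw [← mk_rep a]
        simp only [vsum_mk_zero, kap_mk, reindex_withPt_one, rootCut_mk]
        rw [ENNReal.div_eq_inv_mul, ← ENNReal.tsum_mul_left,
          tsum_subtype (a.rep.net.component A a.rep.root) fun x =>
            ((a.rep.net.component A a.rep.root).encard : ℝ≥0∞)⁻¹ * a.rep.net.cut A x]
        refine tsum_congr fun x => ?_
        by_cases h : x ∈ a.rep.net.component A a.rep.root <;> simp [h]

end Measure

end NetworkSpace

/-! ### Almost invariant transports on unmarked networks. -/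

namespace NetworkSpace

open Network PointedNetwork Filter Topology

variable {Ξ : Type*} {k : ℕ}

/-- Forgetting the marks. -/
abbrev forget : NetworkSpace Ξ k → NetworkSpace Unit k := map fun _ => ()

theorem reindex_first_third_swap (c : NetworkSpace Ξ 2) :
    reindex ![0, 2] (reindex ![0, 2, 1] c) = reindex ![0, 1] c := by
  rw [reindex_reindex]; congr 1; funext i; fin_cases i <;> rfl

theorem reindex_second_third_swap (c : NetworkSpace Ξ 2) :
    reindex ![1, 2] (reindex ![0, 2, 1] c) = reindex ![1, 0] (reindex ![1, 2] c) := by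
  rw [reindex_reindex, reindex_reindex]; congr 1; funext i; fin_cases i <;> rfl

section

variable [MetricSpace Ξ]

theorem measurable_forget : Measurable (forget (Ξ := Ξ) (k := k)) :=
  measurable_map (LipschitzWith.const _ |>.weaken zero_le)

/-- The measure on networks with a further distinguished vertex obtained by counting. -/
noncomputable def fwd (μ : Measure (NetworkSpace Ξ k)) : Measure (NetworkSpace Ξ (k + 1)) :=
  μ.bind vmeas

theorem lintegral_fwd (μ : Measure (NetworkSpace Ξ k)) {f : NetworkSpace Ξ (k + 1) → ℝ≥0∞}
    (hf : Measurable f) : ∫⁻ b, f b ∂(fwd μ) = ∫⁻ a, vsum f a ∂μ := by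
  rw [fwd, Measure.lintegral_bind measurable_vmeas.aemeasurable hf.aemeasurable]
  simp only [lintegral_vmeas hf]

theorem fwd_apply (μ : Measure (NetworkSpace Ξ k)) {s : Set (NetworkSpace Ξ (k + 1))}
    (hs : MeasurableSet s) : fwd μ s = ∫⁻ a, vsum (s.indicator 1) a ∂μ := by
  rw [← lintegral_indicator_one hs, lintegral_fwd μ (measurable_one.indicator hs)]

theorem fwd_nearSet_lt_top (μ : Measure (GStar Ξ)) [IsFiniteMeasure μ] (r D : ℕ) :
    fwd μ (nearSet Ξ r D) < ∞ := by
  rw [fwd_apply μ (measurableSet_nearSet r D)]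
  refine (lintegral_mono (vsum_nearSet_le r D)).trans_lt ?_
  rw [lintegral_const]
  exact ENNReal.mul_lt_top (ENNReal.natCast_lt_top D) (measure_lt_top μ _)

/-- The sets `nearSet` exhaust all pairs and have finite measure; the Radon–Nikodym theorem below
depends on this. -/
instance sigmaFinite_fwd (μ : Measure (GStar Ξ)) [IsFiniteMeasure μ] : SigmaFinite (fwd μ) := by
  refine (Measure.FiniteSpanningSetsIn.sigmaFinite (C := {s | MeasurableSet s}) (μ := fwd μ)
    ⟨fun n => nearSet Ξ n.unpair.1 n.unpair.2, fun n => measurableSet_nearSet _ _,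
      fun n => fwd_nearSet_lt_top μ _ _, ?_⟩)
  refine Set.eq_univ_of_forall fun b => ?_
  obtain ⟨r, D, h⟩ := exists_mem_nearSet b
  exact Set.mem_iUnion.2 ⟨Nat.pair r D, by simpa using h⟩

/-- The conditional expectation of `kap A` given the unmarked network. -/
theorem exists_condexp_kap {P : Measure (GStar Ξ)} [IsProbabilityMeasure P] {A : Set Ξ}
    (hA : MeasurableSet[borel Ξ] A) :
    ∃ l : NetworkSpace Unit 1 → ℝ≥0∞, Measurable l ∧ ∀ h : NetworkSpace Unit 1 → ℝ≥0∞,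
      Measurable h → ∫⁻ a, vsum (fun b => l b * h b) a ∂(P.map forget) =
        ∫⁻ a, vsum (fun b => kap A b * h (forget b)) a ∂P := by
  have hk := measurable_kap hA
  have hπ := measurable_forget (Ξ := Ξ) (k := 0)
  have hπ1 := measurable_forget (Ξ := Ξ) (k := 1)
  -- Forgetting marks keeps the vertices, so `M` is also the image of `fwd P` (see `hM`). The
  -- density of `T` with respect to `M` is then the conditional expectation of `kap A`.
  let T : Measure (NetworkSpace Unit 1) := ((fwd P).withDensity (kap A)).map forget
  let M : Measure (NetworkSpace Unit 1) := fwd (P.map forget)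
  have := Measure.isProbabilityMeasure_map (μ := P) hπ.aemeasurable
  have hT : ∀ h : NetworkSpace Unit 1 → ℝ≥0∞, Measurable h →
      ∫⁻ b, h b ∂T = ∫⁻ a, vsum (fun b => kap A b * h (forget b)) a ∂P := fun h hh => by
    rw [lintegral_map hh hπ1]
    exact (lintegral_withDensity_eq_lintegral_mul _ hk (hh.comp hπ1)).trans
      (lintegral_fwd _ (hk.mul (hh.comp hπ1)))
  have hM : ∀ h : NetworkSpace Unit 1 → ℝ≥0∞, Measurable h →
      ∫⁻ b, h b ∂M = ∫⁻ a, vsum (fun b => h (forget b)) a ∂P := fun h hh => by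
    rw [lintegral_fwd _ hh, lintegral_map (measurable_vsum hh) hπ]
    simp only [vsum_map]
  have : IsFiniteMeasure T := by
    refine ⟨?_⟩
    rw [← lintegral_one, hT _ measurable_const]
    simp only [mul_one]
    refine (lintegral_mono fun a => vsum_kap_le_one A a).trans_lt ?_
    simp
  have hac : T ≪ M := by
    refine Measure.AbsolutelyContinuous.mk fun s hs h => ?_
    rw [← lintegral_indicator_one hs] at h ⊢
    have hi : Measurable (s.indicator (1 : NetworkSpace Unit 1 → ℝ≥0∞)) :=
      measurable_one.indicator hs
    rw [hM _ hi] at h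
    rw [hT _ hi]
    refine le_antisymm (le_trans (lintegral_mono fun a => vsum_mono (fun b => ?_) a) h.le) zero_le
    -- Absolute continuity comes from `kap A ≤ 1`, a single term of a sum that is at most 1.
    refine mul_le_of_le_one_left zero_le ?_
    rw [kap]
    obtain ⟨N, o, x, rfl⟩ := exists_mk_withPt_one b
    change kap A _ ≤ 1
    have h1 := vsum_kap_le_one A (mk (N.withPt ![o]))
    rw [vsum_mk_zero] at h1
    exact (ENNReal.le_tsum (f := fun x => kap A (mk ((N.withPt ![o]).withPt
      ![(N.withPt ![o]).root, x]))) x).trans h1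
  refine ⟨T.rnDeriv M, Measure.measurable_rnDeriv T M, fun h hh => ?_⟩
  have hr := Measure.measurable_rnDeriv T M
  rw [← hT h hh, ← lintegral_fwd _ (f := fun b => T.rnDeriv M b * h b) (hr.mul hh)]
  conv_rhs => rw [← Measure.withDensity_rnDeriv_eq T M hac]
  exact (lintegral_withDensity_eq_lintegral_mul _ hr hh).symm

end

/-- The total discrepancy, over pairs of vertices in `nearSet`, of the transports `l` to the two
vertices of a pair. -/
noncomputable def discrepancy (r D : ℕ) (l : NetworkSpace Ξ 1 → ℝ≥0∞) : NetworkSpace Ξ 0 → ℝ≥0∞ :=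
  vsum (vsum fun c => (nearSet Ξ r D).indicator 1 (reindex ![1, 2] c) *
    (l (reindex ![0, 1] c) - l (reindex ![0, 2] c)))

/-- Each target `x` of the transport has at most `D` partners `y`. The bound supplies the finiteness
needed to cancel terms in `discrepancy_condexp_le`. -/
theorem vsum_vsum_le {r D : ℕ} {l : NetworkSpace Ξ 1 → ℝ≥0∞} {s : Set (NetworkSpace Ξ 2)}
    (hs : ∀ c ∈ s, reindex ![1, 2] c ∈ nearSet Ξ r D) (a : NetworkSpace Ξ 0) :
    vsum (vsum fun c => s.indicator 1 c * l (reindex ![0, 1] c)) a ≤ D * vsum l a := by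
  calc _ ≤ vsum (vsum fun c => l (reindex ![0, 1] c) *
        (nearSet Ξ r D).indicator 1 (reindex ![1, 2] c)) a := by
        refine vsum_mono (fun b => vsum_mono (fun c => ?_) b) a
        by_cases hc : c ∈ s
        · simp [hc, hs c hc]
        · simp [hc]
    _ = vsum (fun b => l b * vsum ((nearSet Ξ r D).indicator 1) (reindex ![1] b)) a := by
        simp only [vsum_reindex_one, ← vsum_mul_first]
    _ ≤ vsum (fun b => D * l b) a := by
        refine vsum_mono (fun b => ?_) a
        rw [mul_comm]
        gcongr
        exact vsum_nearSet_le r D _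
    _ = D * vsum l a := vsum_const_mul _ _ _

variable [MetricSpace Ξ]

/-- Summing `g` over the third vertex leaves a function of the unmarked network with two
distinguished vertices, against which `l` and `kap A` have the same integral. -/
theorem vsum_condexp {P : Measure (GStar Ξ)} {A : Set Ξ} {l : NetworkSpace Unit 1 → ℝ≥0∞}
    (h : ∀ h : NetworkSpace Unit 1 → ℝ≥0∞,
      Measurable h → ∫⁻ a, vsum (fun b => l b * h b) a ∂(P.map forget) =
        ∫⁻ a, vsum (fun b => kap A b * h (forget b)) a ∂P)
    {g : NetworkSpace Unit 2 → ℝ≥0∞} (hg : Measurable g) :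
    ∫⁻ a, vsum (vsum fun c => g c * l (reindex ![0, 1] c)) a ∂(P.map forget) =
      ∫⁻ a, vsum (vsum fun c => g (forget c) * kap A (reindex ![0, 1] c)) a ∂P := by
  have e1 : ∀ b, vsum (fun c => g c * l (reindex ![0, 1] c)) b = l b * vsum g b := fun b => by
    rw [← vsum_mul_first]; simp only [mul_comm]
  have e2 : ∀ b : NetworkSpace Ξ 1, vsum (fun c => g (forget c) * kap A (reindex ![0, 1] c)) b =
      kap A b * vsum g (forget b) := fun b => by
    rw [vsum_map, ← vsum_mul_first]; simp only [mul_comm]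
  simp only [funext e1, funext e2]
  exact h _ (measurable_vsum hg)

/-- This is conditional Jensen for the positive part. The positive part of `l(o, x) - l(o, y)` is
the difference itself on a set `s` that depends only on the unmarked network. On `s`, both terms may
be replaced by those of `kap A`, and the resulting difference is at most its positive part.
Truncated subtraction is avoided by adding the second term to both sides. -/
theorem discrepancy_condexp_le {P : Measure (GStar Ξ)} [IsProbabilityMeasure P] {A : Set Ξ}
    (hA : MeasurableSet[borel Ξ] A) {l : NetworkSpace Unit 1 → ℝ≥0∞}
    (hl : Measurable l) (h : ∀ h : NetworkSpace Unit 1 → ℝ≥0∞,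
      Measurable h → ∫⁻ a, vsum (fun b => l b * h b) a ∂(P.map forget) =
        ∫⁻ a, vsum (fun b => kap A b * h (forget b)) a ∂P) (r D : ℕ) :
    ∫⁻ a, discrepancy r D l a ∂(P.map forget) ≤ ∫⁻ a, discrepancy r D (kap A) a ∂P := by
  have hk := measurable_kap hA
  let s : Set (NetworkSpace Unit 2) := {c | reindex ![1, 2] c ∈ nearSet Unit r D ∧
    l (reindex ![0, 2] c) < l (reindex ![0, 1] c)}
  have hs : MeasurableSet s := (measurable_reindex _ (measurableSet_nearSet r D)).inter
    (measurableSet_lt (hl.comp (measurable_reindex _)) (hl.comp (measurable_reindex _)))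
  have hs1 : Measurable (s.indicator (1 : NetworkSpace Unit 2 → ℝ≥0∞)) :=
    measurable_one.indicator hs
  -- Exchanging `x` and `y` puts the second term into the form to which `vsum_condexp` applies.
  let s' : Set (NetworkSpace Unit 2) := reindex ![0, 2, 1] ⁻¹' s
  have hs' : Measurable (s'.indicator (1 : NetworkSpace Unit 2 → ℝ≥0∞)) :=
    measurable_one.indicator (measurable_reindex _ hs)
  have ex : ∀ (a : NetworkSpace Unit 0),
      vsum (vsum fun c => s.indicator 1 c * l (reindex ![0, 2] c)) a =
        vsum (vsum fun c => s'.indicator 1 c * l (reindex ![0, 1] c)) a := fun a => by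
    rw [← vsum_vsum_swap]
    simp only [reindex_first_third_swap]
    rfl
  have ex' : ∀ (a : NetworkSpace Ξ 0),
      vsum (vsum fun c => s.indicator 1 (forget c) * kap A (reindex ![0, 2] c)) a =
        vsum (vsum fun c => s'.indicator 1 (forget c) * kap A (reindex ![0, 1] c)) a := fun a => by
    rw [← vsum_vsum_swap]
    simp only [reindex_first_third_swap, map_reindex]
    rfl
  have m2 : Measurable fun c : NetworkSpace Unit 2 => s.indicator (1 : NetworkSpace Unit 2 → ℝ≥0∞) c *
      l (reindex ![0, 2] c) := hs1.mul (hl.comp (measurable_reindex _))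
  have m3 : Measurable fun c : NetworkSpace Unit 2 => (nearSet Unit r D).indicator (1 : NetworkSpace Unit 1 → ℝ≥0∞)
      (reindex ![1, 2] c) * (l (reindex ![0, 1] c) - l (reindex ![0, 2] c)) :=
    ((measurable_one.indicator (measurableSet_nearSet r D)).comp (measurable_reindex _)).mul
      ((hl.comp (measurable_reindex _)).sub (hl.comp (measurable_reindex _)))
  have m4 : Measurable fun c : NetworkSpace Ξ 2 =>
      s.indicator (1 : NetworkSpace Unit 2 → ℝ≥0∞) (forget c) * kap A (reindex ![0, 2] c) :=
    (hs1.comp measurable_forget).mul (hk.comp (measurable_reindex _))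
  have key : ∫⁻ a, discrepancy r D l a ∂(P.map forget) +
      ∫⁻ a, vsum (vsum fun c => s.indicator 1 c * l (reindex ![0, 2] c)) a ∂(P.map forget) =
      ∫⁻ a, vsum (vsum fun c => s.indicator 1 c * l (reindex ![0, 1] c)) a ∂(P.map forget) := by
    rw [← lintegral_add_right _ (measurable_vsum (measurable_vsum m2))]
    refine lintegral_congr fun a => ?_
    rw [discrepancy, ← vsum_add]
    simp only [← vsum_add]
    congr 1
    funext b
    congr 1
    funext c
    by_cases hc : c ∈ s
    · rw [Set.indicator_of_mem hc, Set.indicator_of_mem hc.1]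
      simp only [Pi.one_apply, one_mul]
      exact tsub_add_cancel_of_le hc.2.le
    · rw [Set.indicator_of_notMem hc, zero_mul, zero_mul, add_zero]
      by_cases hn : reindex ![1, 2] c ∈ nearSet Unit r D
      · rw [tsub_eq_zero_of_le (not_lt.1 fun h' => hc ⟨hn, h'⟩), mul_zero]
      · rw [Set.indicator_of_notMem hn, zero_mul]
  have le : ∫⁻ a, vsum (vsum fun c => s.indicator 1 (forget c) * kap A (reindex ![0, 1] c)) a ∂P ≤
      ∫⁻ a, discrepancy r D (kap A) a ∂P +
        ∫⁻ a, vsum (vsum fun c => s.indicator 1 (forget c) * kap A (reindex ![0, 2] c)) a ∂P := by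
    rw [← lintegral_add_right _ (measurable_vsum (measurable_vsum m4))]
    refine lintegral_mono fun a => ?_
    rw [discrepancy, ← vsum_add]
    simp only [← vsum_add]
    refine vsum_mono (fun b => vsum_mono (fun c => ?_) b) a
    by_cases hc : forget c ∈ s
    · have hn : reindex ![1, 2] c ∈ nearSet Ξ r D := by
        have := hc.1
        rwa [← map_reindex, map_mem_nearSet] at this
      rw [Set.indicator_of_mem hc, Set.indicator_of_mem hn]
      simp only [Pi.one_apply, one_mul]
      exact le_tsub_add
    · rw [Set.indicator_of_notMem hc, zero_mul]
      exact zero_le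
  have hfin : ∫⁻ a, vsum (vsum fun c => s.indicator 1 (forget c) * kap A (reindex ![0, 2] c)) a ∂P
      ≠ ∞ := by
    simp only [ex']
    refine ((lintegral_mono fun a => ?_).trans_lt (?_ : ∫⁻ a, (D : ℝ≥0∞) ∂P < ∞)).ne
    · have hsub : ∀ c ∈ (forget ⁻¹' s' : Set (NetworkSpace Ξ 2)),
          reindex ![1, 2] c ∈ nearSet Ξ r D := by
        intro c hc
        have := hc.1
        rwa [reindex_second_third_swap, ← map_reindex, ← map_reindex, map_mem_nearSet, swap_mem_nearSet] at this
      refine (vsum_vsum_le (l := kap A) hsub a).trans ?_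
      exact mul_le_of_le_one_right zero_le (vsum_kap_le_one A a)
    · simp
  rw [vsum_condexp h hs1, lintegral_congr ex, vsum_condexp h hs',
    ← lintegral_congr ex'] at key
  refine (ENNReal.add_le_add_iff_right hfin).1 (key.le.trans le)

/-- Amenability provides transports, depending only on the unmarked network, that are almost
invariant. -/
theorem exists_transport {μ : Measure (GStar Ξ)} (ha : IsAmenable μ) {ε : ℝ≥0∞} (hε : 0 < ε) :
    ∃ l : NetworkSpace Unit 1 → ℝ≥0∞, Measurable l ∧
      ∫⁻ a, vsum l a ∂(μ.map forget) = 1 ∧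
      (∀ᵐ a ∂(μ.map forget), vsum (fun b => l (reindex ![1, 0] b)) a = 1) ∧
      ∀ r D : ℕ, ∫⁻ a, discrepancy r D l a ∂(μ.map forget) ≤ D * (D * ε) := by
  have h : isoperimetricConstant μ < ε := by rw [ha]; exact hε
  simp only [isoperimetricConstant, iInf_lt_iff] at h
  obtain ⟨P, A, hPA, hlt⟩ := h
  have hP := hPA.unimodular
  have := hP.isProbabilityMeasure
  have hA := hPA.measurableSet
  have hk := measurable_kap hA
  -- The percolation extends `μ` by further marks only, so the unmarked laws agree.
  have hμ : μ.map forget = P.map forget := by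
    rw [← hPA.map_fst, Measure.map_map measurable_forget (measurable_map LipschitzWith.prod_fst)]
    exact congrArg (fun f => P.map f) (funext fun a => map_map _ _ a)
  rw [hμ]
  obtain ⟨l, hl, hlP⟩ := exists_condexp_kap (P := P) hA
  have hone : ∀ᵐ a ∂P, vsum (kap A) a = 1 :=
    hPA.finite_component.mono fun a ha => vsum_kap_eq_one ha
  have hprob := Measure.isProbabilityMeasure_map (μ := P)
    (measurable_forget (k := 0)).aemeasurable
  have hU : IsUnimodular (P.map forget) := hP.map (LipschitzWith.const _ |>.weaken zero_le)
  refine ⟨l, hl, ?_, ?_, fun r D => ?_⟩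
  · have := hlP 1 measurable_one
    simp only [Pi.one_apply, mul_one] at this
    rw [this, lintegral_congr_ae hone]
    simp
  · have hm : Measurable (vsum (k := 0) fun b => l (reindex ![1, 0] b)) :=
      measurable_vsum (hl.comp (measurable_reindex _))
    -- Tested against `s`, the incoming `l`-mass turns into outgoing `l`-mass by mass transport for
    -- the unmarked law, then into `kap A`-mass by conditional expectation, and returns to the root
    -- by mass transport for `P`, where the total is a.s. 1.
    refine ae_eq_of_forall_setLIntegral_eq_of_sigmaFinite hm measurable_const fun s hs _ => ?_
    have hi : Measurable (s.indicator (1 : NetworkSpace Unit 0 → ℝ≥0∞)) :=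
      measurable_one.indicator hs
    calc ∫⁻ a in s, vsum (fun b => l (reindex ![1, 0] b)) a ∂(P.map forget)
        = ∫⁻ a, s.indicator 1 a * vsum (fun b => l (reindex ![1, 0] b)) a ∂(P.map forget) := by
          rw [← lintegral_indicator hs]
          refine lintegral_congr fun a => ?_
          by_cases ha : a ∈ s <;> simp [ha]
      _ = ∫⁻ a, vsum (fun b => l b * s.indicator 1 (reindex ![1] b)) a ∂(P.map forget) := by
          rw [hU.mtp (f := fun b => l b * s.indicator 1 (reindex ![1] b))
            (hl.mul (hi.comp (measurable_reindex _)))]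
          simp only [reindex_one_swap]
          refine lintegral_congr fun a => ?_
          rw [← vsum_mul_root]
          exact congrArg (fun f => vsum f a) (funext fun b => mul_comm _ _)
      _ = ∫⁻ a, vsum (fun b => kap A b * s.indicator 1 (reindex ![1] (forget b))) a ∂P :=
          hlP _ (hi.comp (measurable_reindex _))
      _ = ∫⁻ a, s.indicator 1 (forget a) * vsum (kap A) a ∂P := by
          rw [hP.mtp (f := fun b => kap A b * s.indicator 1 (reindex ![1] (forget b)))
            (hk.mul (hi.comp ((measurable_reindex _).comp measurable_forget)))]
          simp only [map_reindex, reindex_one_swap, kap_swap]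
          refine lintegral_congr fun a => ?_
          rw [← vsum_mul_root
            (fun a => s.indicator (1 : NetworkSpace Unit 0 → ℝ≥0∞) (forget a))]
          refine congrArg (fun f => vsum f a) (funext fun b => ?_)
          rw [mul_comm, ← map_reindex]
      _ = ∫⁻ a, s.indicator 1 (forget a) ∂P := by
          refine lintegral_congr_ae ?_
          filter_upwards [hone] with a ha
          rw [ha, mul_one]
      _ = ∫⁻ a in s, 1 ∂(P.map forget) := by
          rw [← lintegral_map hi measurable_forget, lintegral_indicator_one hs]
          simp
  · refine (discrepancy_condexp_le hA hl hlP r D).trans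
      ((lintegral_kap_sub_le hP hA (measurableSet_nearSet r D)).trans
        ((lintegral_near_disconnected_le hP hA r D).trans ?_))
    rw [lintegral_rootCut hP hA hPA.finite_component]
    gcongr

end NetworkSpace

/-! ### Moving the root of a coupling. -/

namespace NetworkSpace

open Network PointedNetwork Filter Topology

variable {Ξ Ξ' : Type*} {k l : ℕ}

/-- The networks all of whose marks lie in `R`. -/
def marksIn (R : Set Ξ) (k : ℕ) : Set (NetworkSpace Ξ k) :=
  {a | (∀ v, a.rep.net.vmark v ∈ R) ∧ ∀ d, a.rep.net.dmark d ∈ R}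

theorem mk_mem_marksIn {R : Set Ξ} {N : PointedNetwork Ξ k} :
    mk N ∈ marksIn R k ↔ (∀ v, N.net.vmark v ∈ R) ∧ ∀ d, N.net.dmark d ∈ R := by
  obtain ⟨φ, hv, hd, -⟩ := rep_mk N
  change (∀ v, _) ∧ (∀ d, _) ↔ _
  simp only [← hv, ← hd]
  exact and_congr (φ.onV.forall_congr_right (q := fun v => N.net.vmark v ∈ R))
    (φ.onD.forall_congr_right (q := fun d => N.net.dmark d ∈ R))

theorem reindex_mem_marksIn {R : Set Ξ} {σ : Fin (l + 1) → Fin (k + 1)} {a : NetworkSpace Ξ k} :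
    reindex σ a ∈ marksIn R l ↔ a ∈ marksIn R k := by
  obtain ⟨N, rfl⟩ := exists_mk_eq a
  rw [reindex_mk, mk_mem_marksIn, mk_mem_marksIn]
  rfl

theorem forget_map (f : Ξ → Ξ') (a : NetworkSpace Ξ k) : forget (map f a) = forget a :=
  map_map _ _ _

variable [MetricSpace Ξ] [MetricSpace Ξ']

theorem isClosed_marksIn {R : Set Ξ} (hR : IsClosed R) : IsClosed (marksIn R k) := by
  rw [← isOpen_compl_iff, isOpen_iff_mem_nhds]
  intro a ha
  obtain ⟨N, rfl⟩ := exists_mk_eq a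
  rw [Set.mem_compl_iff, mk_mem_marksIn, not_and_or, not_forall, not_forall] at ha
  rcases ha with ⟨v, hv⟩ | ⟨d, hd⟩
  · obtain ⟨n, hn⟩ := exists_mem_cball N.connected N.root v
    obtain ⟨ε, hε, h⟩ := Metric.isOpen_iff.1 hR.isOpen_compl _ hv
    refine mem_nhds_of_closeWith (n := n) hε fun M hM => ?_
    obtain ⟨φ, h1, -, -⟩ := hM
    rw [Set.mem_compl_iff, mk_mem_marksIn]
    exact fun h' => h (Metric.mem_ball'.2 (h1 ⟨v, hn⟩)) (h'.1 _)
  · obtain ⟨n, hn⟩ := exists_mem_cball N.connected N.root (N.net.src d)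
    have hd' : d ∈ N.net.eball N.root (n + 1) :=
      ⟨cball_mono (Nat.le_succ n) hn, mem_cball_trans hn (tgt_mem_cball d)⟩
    obtain ⟨ε, hε, h⟩ := Metric.isOpen_iff.1 hR.isOpen_compl _ hd
    refine mem_nhds_of_closeWith (n := n + 1) hε fun M hM => ?_
    obtain ⟨φ, -, h1, -⟩ := hM
    rw [Set.mem_compl_iff, mk_mem_marksIn]
    exact fun h' => h (Metric.mem_ball'.2 (h1 ⟨d, hd'⟩)) (h'.2 _)

/-- The law of the network after moving the root according to the transport `t`. -/
noncomputable def moved (ν : Measure (GStar Ξ)) (t : NetworkSpace Unit 1 → ℝ≥0∞) :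
    Measure (GStar Ξ) :=
  ((fwd ν).withDensity fun b => t (forget b)).map (reindex ![1])

theorem lintegral_moved (ν : Measure (GStar Ξ)) {t : NetworkSpace Unit 1 → ℝ≥0∞}
    (ht : Measurable t) {F : GStar Ξ → ℝ≥0∞} (hF : Measurable F) :
    ∫⁻ a, F a ∂(moved ν t) =
      ∫⁻ a, vsum (fun b => t (forget b) * F (reindex ![1] b)) a ∂ν := by
  have h1 : Measurable fun b : NetworkSpace Ξ 1 => t (forget b) := ht.comp measurable_forget
  have h2 : Measurable fun b : NetworkSpace Ξ 1 => F (reindex ![1] b) :=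
    hF.comp (measurable_reindex _)
  rw [moved, lintegral_map hF (measurable_reindex _)]
  exact (lintegral_withDensity_eq_lintegral_mul _ h1 h2).trans (lintegral_fwd _ (h1.mul h2))

/-- Since `t` ignores marks, moving the root commutes with `f`. Under the unimodular `μ`, mass
transport turns the weight of the new root into its incoming `t`-mass, which is a.s. 1.
Unimodularity of `ν` is not required. -/
theorem map_moved {μ : Measure (GStar Ξ')} (hμ : IsUnimodular μ) {ν : Measure (GStar Ξ)}
    {f : Ξ → Ξ'} (hf : LipschitzWith 1 f) (hν : ν.map (map f) = μ)
    {t : NetworkSpace Unit 1 → ℝ≥0∞} (ht : Measurable t)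
    (ht1 : ∀ᵐ a ∂(μ.map forget), vsum (fun b => t (reindex ![1, 0] b)) a = 1) :
    (moved ν t).map (map f) = μ := by
  refine Measure.ext_of_lintegral _ fun F hF => ?_
  rw [lintegral_map hF (measurable_map hf),
    lintegral_moved ν ht (F := fun a => F (map f a)) (hF.comp (measurable_map hf))]
  have h1 : Measurable fun b : NetworkSpace Ξ' 1 => t (forget b) * F (reindex ![1] b) :=
    (ht.comp measurable_forget).mul (hF.comp (measurable_reindex _))
  calc ∫⁻ a, vsum (fun b => t (forget b) * F (map f (reindex ![1] b))) a ∂ν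
      = ∫⁻ a, vsum (fun b => t (forget b) * F (reindex ![1] b)) (map f a) ∂ν := by
        simp only [vsum_map, forget_map, map_reindex]
    _ = ∫⁻ a, vsum (fun b => t (forget b) * F (reindex ![1] b)) a ∂μ := by
        rw [← hν, lintegral_map (measurable_vsum h1) (measurable_map hf)]
    _ = ∫⁻ a, F a * vsum (fun b => t (reindex ![1, 0] b)) (forget a) ∂μ := by
        rw [hμ.mtp (f := fun b => t (forget b) * F (reindex ![1] b)) h1]
        simp only [reindex_one_swap]
        refine lintegral_congr fun a => ?_
        rw [vsum_map, ← vsum_mul_root]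
        refine congrArg (fun f => vsum f a) (funext fun b => ?_)
        rw [mul_comm, forget, map_reindex]
    _ = ∫⁻ a, F a ∂μ := by
        refine lintegral_congr_ae ?_
        filter_upwards [ae_of_ae_map measurable_forget.aemeasurable ht1] with a ha
        rw [ha, mul_one]

theorem moved_marksIn {R : Set Ξ} (hR : IsClosed R) {ν : Measure (GStar Ξ)}
    (hν : ∀ᵐ a ∂ν, a ∈ marksIn R 0) {t : NetworkSpace Unit 1 → ℝ≥0∞} (ht : Measurable t) :
    ∀ᵐ a ∂(moved ν t), a ∈ marksIn R 0 := by
  have hm := (isClosed_marksIn (k := 0) hR).isOpen_compl.measurableSet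
  change moved ν t (marksIn R 0)ᶜ = 0
  rw [← lintegral_indicator_one hm, lintegral_moved ν ht (measurable_one.indicator hm)]
  rw [← lintegral_zero (μ := ν)]
  refine lintegral_congr_ae ?_
  filter_upwards [hν] with a ha
  refine le_antisymm (le_of_le_of_eq (b := vsum (fun b => (marksIn R 0)ᶜ.indicator 1
    (reindex ![0] b) * t (forget b)) a) (vsum_mono (fun b => ?_) a) ?_) zero_le
  · refine le_of_eq ((mul_comm _ _).trans (congrArg (· * _) ?_))
    by_cases h : b ∈ marksIn R 1 <;> simp [Set.indicator, reindex_mem_marksIn, h]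
  · rw [vsum_mul_root ((marksIn R 0)ᶜ.indicator 1)]
    simp [ha]

theorem isProbabilityMeasure_moved {ν : Measure (GStar Ξ)} {t : NetworkSpace Unit 1 → ℝ≥0∞}
    (ht : Measurable t) (h : ∫⁻ a, vsum t a ∂(ν.map forget) = 1) :
    IsProbabilityMeasure (moved ν t) := by
  refine ⟨?_⟩
  rw [← lintegral_one, lintegral_moved ν ht measurable_const]
  rw [lintegral_map (measurable_vsum ht) measurable_forget] at h
  simpa only [vsum_map, mul_one] using h

/-- The Mass-Transport Principle holds for `moved` up to the discrepancy of the transport. -/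
theorem lintegral_moved_vsum_le {ν : Measure (GStar Ξ)} {t : NetworkSpace Unit 1 → ℝ≥0∞}
    (ht : Measurable t) {g : NetworkSpace Ξ 1 → ℝ≥0∞} (hg : Measurable g) {C : ℝ≥0∞} {r D : ℕ}
    (hC : ∀ b, g b ≤ C * (nearSet Ξ r D).indicator 1 b) :
    ∫⁻ a, vsum g a ∂(moved ν t) ≤
      ∫⁻ a, vsum (fun b => g (reindex ![1, 0] b)) a ∂(moved ν t) +
        C * ∫⁻ a, discrepancy r D t a ∂(ν.map forget) := by
  have ht1 : Measurable fun b : NetworkSpace Ξ 1 => t (forget b) := ht.comp measurable_forget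
  have key : ∀ g : NetworkSpace Ξ 1 → ℝ≥0∞, Measurable g → ∫⁻ a, vsum g a ∂(moved ν t) =
      ∫⁻ a, vsum (vsum fun c => t (forget (reindex ![0, 1] c)) * g (reindex ![1, 2] c)) a ∂ν := by
    intro g hg
    rw [lintegral_moved ν ht (measurable_vsum hg)]
    simp only [vsum_reindex_one, ← vsum_mul_first (fun b => t (forget b))]
  have hdm : Measurable fun c : NetworkSpace Unit 2 =>
      (nearSet Unit r D).indicator 1 (reindex ![1, 2] c) *
        (t (reindex ![0, 1] c) - t (reindex ![0, 2] c)) :=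
    ((measurable_one.indicator (measurableSet_nearSet r D)).comp (measurable_reindex _)).mul
      ((ht.comp (measurable_reindex _)).sub (ht.comp (measurable_reindex _)))
  have hdm' : Measurable fun c : NetworkSpace Ξ 2 =>
      (nearSet Unit r D).indicator (1 : NetworkSpace Unit 1 → ℝ≥0∞) (reindex ![1, 2] (forget c)) *
        (t (reindex ![0, 1] (forget c)) - t (reindex ![0, 2] (forget c))) :=
    hdm.comp measurable_forget
  rw [key g hg, key (fun b => g (reindex ![1, 0] b)) (hg.comp (measurable_reindex _)),
    lintegral_map (f := discrepancy r D t) (measurable_vsum (measurable_vsum hdm))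
      measurable_forget]
  simp only [discrepancy, vsum_map]
  rw [← lintegral_const_mul _ (measurable_vsum (measurable_vsum hdm')),
    ← lintegral_add_right _ ((measurable_vsum (measurable_vsum hdm')).const_mul C)]
  refine lintegral_mono fun a => ?_
  -- Renaming `x` and `y` in the reversed sum gives both sides the same factor `g(x, y)`, with
  -- weights `t(o, x)` and `t(o, y)`.
  rw [← vsum_vsum_swap (fun c => t (forget (reindex ![0, 1] c)) *
    g (reindex ![1, 0] (reindex ![1, 2] c)))]
  rw [← vsum_const_mul, ← vsum_add]
  refine vsum_mono (fun b => ?_) a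
  rw [← vsum_const_mul, ← vsum_add]
  refine vsum_mono (fun c => ?_) b
  have e1 : reindex ![0, 1] (reindex ![0, 2, 1] c) = reindex ![0, 2] c := by
    rw [reindex_reindex]; congr 1; funext i; fin_cases i <;> rfl
  have e2 : reindex ![1, 0] (reindex ![1, 2] (reindex ![0, 2, 1] c)) = reindex ![1, 2] c := by
    rw [reindex_reindex, reindex_reindex]; congr 1; funext i; fin_cases i <;> rfl
  rw [e1, e2, ← map_reindex, ← map_reindex, ← map_reindex]
  have e3 : (nearSet Unit r D).indicator (1 : NetworkSpace Unit 1 → ℝ≥0∞)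
      (map (fun _ => ()) (reindex ![1, 2] c)) =
      (nearSet Ξ r D).indicator 1 (reindex ![1, 2] c) := indicator_one_congr map_mem_nearSet
  rw [e3]
  generalize t (map (fun _ => ()) (reindex ![0, 1] c)) = x
  generalize t (map (fun _ => ()) (reindex ![0, 2] c)) = y
  calc x * g (reindex ![1, 2] c) ≤ (y + (x - y)) * g (reindex ![1, 2] c) := by
        gcongr; exact le_add_tsub
    _ = y * g (reindex ![1, 2] c) + g (reindex ![1, 2] c) * (x - y) := by ring
    _ ≤ y * g (reindex ![1, 2] c) +
        C * (nearSet Ξ r D).indicator 1 (reindex ![1, 2] c) * (x - y) := by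
        gcongr; exact hC _
    _ = _ := by rw [mul_assoc]

end NetworkSpace

/-! ### Ultralimits of networks with bounded balls. -/

section Limits

open Filter Topology

/-- The label of `x` is the first `r` with `x ∈ S r` together with a number below `D r` that
identifies `x` within `S r`. Labels let vertices and edges of different networks be compared. -/
theorem exists_depth_labels {α : Type*} {S : ℕ → Set α} (hS : Monotone S)
    (hex : ∀ x, ∃ r, x ∈ S r) {D : ℕ → ℕ} (hD : ∀ r, (S r).encard ≤ D r) :
    ∃ f : α → ℕ × ℕ, Function.Injective f ∧
      ∀ x, (f x).2 < D (f x).1 ∧ ∀ r, x ∈ S r ↔ (f x).1 ≤ r := by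
  classical
  have hg : ∀ r, ∃ g : α → ℕ, Set.InjOn g (S r) ∧ ∀ x ∈ S r, g x < D r := fun r => by
    have hfin : (S r).Finite := Set.finite_of_encard_le_coe (hD r)
    have hle : (S r).encard ≤ (Set.Iio (D r)).encard := by
      simpa [Set.encard_eq_coe_toFinset_card] using hD r
    by_cases hne : (Set.Iio (D r)).Nonempty
    · have : Nonempty ℕ := ⟨0⟩
      obtain ⟨g, h1, h2⟩ := hfin.exists_injOn_of_encard_le hle
      exact ⟨g, h2, fun x hx => h1 hx⟩
    · rw [Set.not_nonempty_iff_eq_empty] at hne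
      rw [hne, Set.encard_empty, nonpos_iff_eq_zero, Set.encard_eq_zero] at hle
      simp [hle]
  choose g hg1 hg2 using hg
  refine ⟨fun x => (Nat.find (hex x), g (Nat.find (hex x)) x), fun x y h => ?_, fun x => ⟨?_, ?_⟩⟩
  · simp only [Prod.mk.injEq] at h
    obtain ⟨h1, h2⟩ := h
    rw [← h1] at h2
    exact hg1 _ (Nat.find_spec (hex x)) (h1 ▸ Nat.find_spec (hex y)) h2
  · exact hg2 _ _ (Nat.find_spec (hex x))
  · exact fun r => ⟨fun h => Nat.find_min' _ h, fun h => hS h (Nat.find_spec (hex x))⟩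

theorem Ultrafilter.exists_limit_of_compact {ι X : Type*} [PseudoMetricSpace X] (U : Ultrafilter ι)
    {C : Set X} (hC : IsCompact C) {P : ι → X → Prop} (h : ∀ᶠ i in (U : Filter ι), ∃ y ∈ C, P i y) :
    ∃ x, ∀ ε > 0, ∀ᶠ i in (U : Filter ι), ∃ y, P i y ∧ dist y x < ε := by
  have : Nonempty X := h.exists.choose_spec.nonempty
  obtain ⟨f, hf⟩ := h.choice
  obtain ⟨x, -, hx⟩ := hC.ultrafilter_le_nhds (U.map f)
    (le_principal_iff.2 (mem_map.2 (hf.mono fun i hi => hi.1)))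
  refine ⟨x, fun ε hε => ?_⟩
  have := hx (Metric.ball_mem_nhds x hε)
  filter_upwards [hf, (mem_map.1 this : f ⁻¹' Metric.ball x ε ∈ (U : Filter ι))] with i h1 h2
  exact ⟨f i, h1.2, h2⟩

theorem finite_label_set (D : ℕ → ℕ) (r : ℕ) : {n : ℕ × ℕ | n.1 ≤ r ∧ n.2 < D n.1}.Finite := by
  refine ((Set.finite_Iic r).biUnion fun i _ =>
    (Set.finite_Iio (D i)).image (Prod.mk i)).subset ?_
  rintro ⟨i, j⟩ ⟨h1, h2⟩
  exact Set.mem_biUnion h1 ⟨j, h2, rfl⟩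

end Limits

namespace PointedNetwork

open Network Filter Topology

variable {Ξ : Type*}

theorem exists_mem_eball (N : PointedNetwork Ξ 0) (d : N.net.D) :
    ∃ m, d ∈ N.net.eball N.root m := by
  obtain ⟨a, ha⟩ := exists_mem_cball N.connected N.root (N.net.src d)
  exact ⟨a + 1, cball_mono (Nat.le_succ a) ha, mem_cball_trans ha (tgt_mem_cball d)⟩

/-- There are at most `D` vertices and at most `D` oriented edges in the ball of radius `r` around
the root, and their marks lie in `T`. -/
def BallIn (r D : ℕ) (T : Set Ξ) (N : PointedNetwork Ξ 0) : Prop :=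
  (N.net.cball N.root r).encard ≤ D ∧ (N.net.eball N.root r).encard ≤ D ∧
    (∀ v ∈ N.net.cball N.root r, N.net.vmark v ∈ T) ∧
    ∀ d ∈ N.net.eball N.root r, N.net.dmark d ∈ T

/-- The numbers of vertices and edges in balls around the root are bounded by `D` and the marks in
these balls lie in the sets `C`. -/
def BoundedBy (D : ℕ → ℕ) (C : ℕ → Set Ξ) (N : PointedNetwork Ξ 0) : Prop :=
  ∀ r, BallIn r (D r) (C r) N

variable [MetricSpace Ξ]

/-- With vertices and edges labelled by depth, each feature of the graph up to a given depth has
finitely many possible values, and `U` chooses one. The marks converge along `U` by compactness of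
the sets `C r`. -/
theorem exists_ultrafilter_limit {ι : Type*} (U : Ultrafilter ι) {D : ℕ → ℕ} {C : ℕ → Set Ξ}
    (hC : ∀ r, IsCompact (C r)) (N : ι → PointedNetwork Ξ 0) (hN : ∀ i, BoundedBy D C (N i)) :
    ∃ M : PointedNetwork Ξ 0, ∀ (R : ℕ) (ε : ℝ), 0 < ε →
      ∀ᶠ i in (U : Filter ι), CloseWith R ε (N i) M := by
  have hvl := fun i => exists_depth_labels (S := fun r => (N i).net.cball (N i).root r)
    (fun _ _ h => cball_mono h) (exists_mem_cball (N i).connected (N i).root)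
    (fun r => (hN i r).1)
  have hel := fun i => exists_depth_labels (S := fun r => (N i).net.eball (N i).root r)
    (fun _ _ h => eball_mono h) (exists_mem_eball (N i)) (fun r => (hN i r).2.1)
  choose vl vinj hvl using hvl
  choose el einj hel using hel
  have hvF : ∀ i v r, v ∈ (N i).net.cball (N i).root r →
      vl i v ∈ {n : ℕ × ℕ | n.1 ≤ r ∧ n.2 < D n.1} := fun i v r h =>
    ⟨((hvl i v).2 r).1 h, (hvl i v).1⟩
  have heF : ∀ i v r, v ∈ (N i).net.eball (N i).root r →
      el i v ∈ {n : ℕ × ℕ | n.1 ≤ r ∧ n.2 < D n.1} := fun i v r h =>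
    ⟨((hel i v).2 r).1 h, (hel i v).1⟩
  have hrev : ∀ i d r, d ∈ (N i).net.eball (N i).root r →
      (N i).net.rev d ∈ (N i).net.eball (N i).root r := fun i d r h =>
    ⟨h.2, by simpa [tgt, (N i).net.rev_rev] using h.1⟩
  -- The vertices and edges of the limit are the labels in use for `U`-almost every index.
  let V' := {n : ℕ × ℕ // ∀ᶠ i in (U : Filter ι), ∃ v, vl i v = n}
  let D' := {n : ℕ × ℕ // ∀ᶠ i in (U : Filter ι), ∃ d, el i d = n}
  have hsr : ∀ e : D', ∃ n : V', ∀ᶠ i in (U : Filter ι), ∃ d, el i d = e.1 ∧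
      vl i ((N i).net.src d) = n.1 := fun e => by
    obtain ⟨n, -, hn⟩ := (Ultrafilter.eventually_exists_mem_iff (f := U)
      (P := fun n i => ∃ d, el i d = e.1 ∧ vl i ((N i).net.src d) = n)
      (finite_label_set D e.1.1)).1 (by
        filter_upwards [e.2] with i hi
        obtain ⟨d, hd⟩ := hi
        have := ((hel i d).2 e.1.1).2 (hd ▸ le_rfl)
        exact ⟨_, hvF i _ _ this.1, d, hd, rfl⟩)
    exact ⟨⟨n, hn.mono fun i hi => hi.imp' _ fun d hd => hd.2⟩, hn⟩
  have hrv : ∀ e : D', ∃ n : D', ∀ᶠ i in (U : Filter ι), ∃ d, el i d = e.1 ∧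
      el i ((N i).net.rev d) = n.1 := fun e => by
    obtain ⟨n, -, hn⟩ := (Ultrafilter.eventually_exists_mem_iff (f := U)
      (P := fun n i => ∃ d, el i d = e.1 ∧ el i ((N i).net.rev d) = n)
      (finite_label_set D e.1.1)).1 (by
        filter_upwards [e.2] with i hi
        obtain ⟨d, hd⟩ := hi
        have := ((hel i d).2 e.1.1).2 (hd ▸ le_rfl)
        exact ⟨_, heF i _ _ (hrev _ _ _ this), d, hd, rfl⟩)
    exact ⟨⟨n, hn.mono fun i hi => hi.imp' _ fun d hd => hd.2⟩, hn⟩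
  have hvm : ∀ n : V', ∃ x : Ξ, ∀ ε > 0, ∀ᶠ i in (U : Filter ι), ∃ y,
      (∃ v, vl i v = n.1 ∧ (N i).net.vmark v = y) ∧ dist y x < ε := fun n => by
    refine U.exists_limit_of_compact (hC n.1.1) ?_
    filter_upwards [n.2] with i hi
    obtain ⟨v, hv⟩ := hi
    exact ⟨_, (hN i n.1.1).2.2.1 v (((hvl i v).2 _).2 (hv ▸ le_rfl)), v, hv, rfl⟩
  have hdm : ∀ n : D', ∃ x : Ξ, ∀ ε > 0, ∀ᶠ i in (U : Filter ι), ∃ y,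
      (∃ v, el i v = n.1 ∧ (N i).net.dmark v = y) ∧ dist y x < ε := fun n => by
    refine U.exists_limit_of_compact (hC n.1.1) ?_
    filter_upwards [n.2] with i hi
    obtain ⟨v, hv⟩ := hi
    exact ⟨_, (hN i n.1.1).2.2.2 v (((hel i v).2 _).2 (hv ▸ le_rfl)), v, hv, rfl⟩
  choose sr hsr using hsr
  choose rv hrv using hrv
  choose vm hvm using hvm
  choose dm hdm using hdm
  let M : Network Ξ :=
    { V := V'
      D := D'
      src := sr
      rev := rv
      rev_rev := fun e => by
        obtain ⟨i, ⟨d, h1, h2⟩, ⟨d', h3, h4⟩⟩ := ((hrv e).and (hrv (rv e))).exists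
        obtain rfl := einj i (h3.trans h2.symm)
        rw [(N i).net.rev_rev] at h4
        exact Subtype.ext (h4.symm.trans h1)
      rev_ne := fun e h => by
        obtain ⟨i, d, h1, h2⟩ := (hrv e).exists
        rw [h, ← h1] at h2
        exact (N i).net.rev_ne d (einj i h2)
      vmark := vm
      dmark := dm }
  obtain ⟨o, ho⟩ : ∃ o : V', ∀ᶠ i in (U : Filter ι), vl i (N i).root = o.1 := by
    obtain ⟨n, -, hn⟩ := (Ultrafilter.eventually_exists_mem_iff (f := U)
      (P := fun n i => vl i (N i).root = n) (finite_label_set D 0)).1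
        (Eventually.of_forall fun i => ⟨_, hvF i _ 0 (self_mem_cball _ _), rfl⟩)
    exact ⟨⟨n, hn.mono fun i hi => ⟨_, hi⟩⟩, hn⟩
  have hdata : ∀ e : D', ∀ᶠ i in (U : Filter ι), ∃ d, el i d = e.1 ∧
      vl i ((N i).net.src d) = (M.src e).1 ∧ vl i ((N i).net.tgt d) = (M.tgt e).1 := fun e => by
    filter_upwards [hsr e, hrv e, hsr (rv e)] with i h1 h2 h3
    obtain ⟨d, h1, h1'⟩ := h1
    obtain ⟨d', h2, h2'⟩ := h2
    obtain ⟨d'', h3, h3'⟩ := h3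
    obtain rfl := einj i (h1.trans h2.symm)
    obtain rfl := einj i (h2'.trans h3.symm)
    exact ⟨d, h1, h1', h3'⟩
  -- Together with `hball2`, this shows that the depth stored in a label is the distance from the
  -- root in the limit; connectedness and local finiteness follow.
  have hball1 : ∀ (r : ℕ) (n : V'), n ∈ M.cball o r → n.1.1 ≤ r := by
    intro r
    induction r with
    | zero =>
      intro n hn
      obtain rfl := mem_cball_zero.1 hn
      obtain ⟨i, hi⟩ := ho.exists
      exact hi ▸ ((hvl i _).2 0).1 (self_mem_cball _ _)
    | succ r ih =>
      intro n hn
      rcases mem_cball_succ (mem_cball_comm.1 hn) with h | ⟨e, rfl, h⟩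
      · exact (ih n (by rw [h]; exact self_mem_cball _ _)).trans (Nat.le_succ r)
      · have h1 := ih _ (mem_cball_comm.1 h)
        obtain ⟨i, d, -, h2, h3⟩ := (hdata e).exists
        rw [← h3] at h1
        rw [← h2]
        exact ((hvl i _).2 _).1 (mem_cball_trans (((hvl i _).2 _).2 h1)
          (mem_cball_comm.1 (tgt_mem_cball d)))
  have hball2 : ∀ (r : ℕ) (n : V'), n.1.1 ≤ r → n ∈ M.cball o r := by
    intro r
    induction r with
    | zero =>
      intro n hn
      refine mem_cball_zero.2 ?_
      obtain ⟨i, h1, v, h2⟩ := (ho.and n.2).exists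
      have h3 := mem_cball_zero.1 (((hvl i v).2 0).2 (h2 ▸ hn))
      rw [← h3] at h1
      exact Subtype.ext (h2.symm.trans h1)
    | succ r ih =>
      intro n hn
      have := (Ultrafilter.eventually_exists_mem_iff (f := U)
        (P := fun e i => ∃ d, el i d = e ∧ vl i ((N i).net.src d) = n.1 ∧
          ((N i).net.tgt d) ∈ (N i).net.cball (N i).root r) (finite_label_set D (r + 1)))
      -- Either `U`-almost always an edge leads from this vertex one step closer to the root, and
      -- then one edge label serves almost always; or the vertex is the root.
      by_cases hex : ∀ᶠ i in (U : Filter ι), ∃ d, vl i ((N i).net.src d) = n.1 ∧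
          ((N i).net.tgt d) ∈ (N i).net.cball (N i).root r
      · obtain ⟨e, -, he⟩ := this.1 (by
          filter_upwards [hex] with i hi
          obtain ⟨d, h1, h2⟩ := hi
          exact ⟨_, heF i d (r + 1) ⟨((hvl i _).2 _).2 (h1 ▸ hn),
            cball_mono (Nat.le_succ r) h2⟩, d, rfl, h1, h2⟩)
        let e' : D' := ⟨e, he.mono fun i hi => hi.imp fun d hd => hd.1⟩
        obtain ⟨i, ⟨d, h1, h2, h3⟩, ⟨d', h4, h5, h6⟩⟩ := (he.and (hdata e')).exists
        obtain rfl := einj i (h1.trans h4.symm)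
        have h7 : M.src e' = n := Subtype.ext (h5.symm.trans h2)
        have h8 := ih (M.tgt e') (h6 ▸ ((hvl i _).2 r).1 h3)
        rw [← h7]
        exact mem_cball_trans h8 (mem_cball_comm.1 (tgt_mem_cball (N := M) e'))
      · obtain ⟨i, h1, h2, v, h3⟩ := ((Ultrafilter.eventually_not.2 hex).and (ho.and n.2)).exists
        rcases mem_cball_succ (mem_cball_comm.1 (((hvl i v).2 (r + 1)).2 (h3 ▸ hn))) with h | h
        · rw [h, h3] at h2
          obtain rfl : n = o := Subtype.ext h2
          exact self_mem_cball _ _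
        · obtain ⟨d, h4, h5⟩ := h
          exact absurd ⟨d, h4.symm ▸ h3, mem_cball_comm.1 h5⟩ h1
  have hball : ∀ (r : ℕ) (n : V'), n ∈ M.cball o r ↔ n.1.1 ≤ r := fun r n =>
    ⟨hball1 r n, hball2 r n⟩
  have heball : ∀ (r : ℕ) (e : D'), e ∈ M.eball o r ↔ e.1.1 ≤ r := fun r e => by
    obtain ⟨i, d, h1, h2, h3⟩ := (hdata e).exists
    rw [← h1, ← (hel i d).2 r]
    change (M.src e) ∈ _ ∧ (M.tgt e) ∈ _ ↔ _ ∈ _ ∧ _ ∈ _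
    rw [hball, hball, ← h2, ← h3, ← (hvl i _).2 r, ← (hvl i _).2 r]
  have hDF : ∀ e : D', e.1.2 < D e.1.1 := fun e => by
    obtain ⟨i, d, h⟩ := e.2.exists
    exact h ▸ (hel i d).1
  have hVF : ∀ e : V', e.1.2 < D e.1.1 := fun e => by
    obtain ⟨i, d, h⟩ := e.2.exists
    exact h ▸ (hvl i d).1
  have hfinD : ∀ r, {e : D' | e.1.1 ≤ r}.Finite := fun r =>
    ((finite_label_set D r).preimage Subtype.val_injective.injOn).subset
      fun e he => ⟨he, hDF e⟩
  have hfinV : ∀ r, {e : V' | e.1.1 ≤ r}.Finite := fun r =>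
    ((finite_label_set D r).preimage Subtype.val_injective.injOn).subset
      fun e he => ⟨he, hVF e⟩
  refine ⟨⟨M, ?_, fun v => ?_, fun _ => o⟩, fun R ε hε => ?_⟩
  · refine (SimpleGraph.connected_iff_exists_forall_reachable _).2 ⟨o, fun v => ?_⟩
    rw [← SimpleGraph.edist_ne_top_iff_reachable]
    have h : M.graph.edist o v ≤ (v.1.1 : ℕ∞) := (hball _ v).2 le_rfl
    exact (h.trans_lt (ENat.natCast_lt_top _)).ne
  · refine (hfinD (v.1.1 + 1)).subset fun e he => ?_
    obtain rfl : M.src e = v := he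
    refine (heball _ e).1 ⟨cball_mono (Nat.le_succ _) ((hball _ _).2 le_rfl), ?_⟩
    exact mem_cball_trans ((hball _ _).2 le_rfl) (tgt_mem_cball (N := M) e)
  -- Finitely many labels matter up to depth `R`, so almost every index uses only labels that
  -- survive in the limit.
  · have g1 : ∀ᶠ i in (U : Filter ι), ∀ n ∈ {n : ℕ × ℕ | n.1 ≤ R ∧ n.2 < D n.1},
        (∃ v, vl i v = n) → ∀ᶠ i in (U : Filter ι), ∃ v, vl i v = n := by
      rw [eventually_all_finite (finite_label_set D R)]
      intro n _
      by_cases h : ∀ᶠ i in (U : Filter ι), ∃ v, vl i v = n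
      · exact Eventually.of_forall fun i _ => h
      · filter_upwards [Ultrafilter.eventually_not.2 h] with i hi h'
        exact absurd h' hi
    have g2 : ∀ᶠ i in (U : Filter ι), ∀ n ∈ {n : ℕ × ℕ | n.1 ≤ R ∧ n.2 < D n.1},
        (∃ v, el i v = n) → ∀ᶠ i in (U : Filter ι), ∃ v, el i v = n := by
      rw [eventually_all_finite (finite_label_set D R)]
      intro n _
      by_cases h : ∀ᶠ i in (U : Filter ι), ∃ v, el i v = n
      · exact Eventually.of_forall fun i _ => h
      · filter_upwards [Ultrafilter.eventually_not.2 h] with i hi h'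
        exact absurd h' hi
    have g3 := (eventually_all_finite (hfinD R)).2 fun e _ => hsr e
    have g4 := (eventually_all_finite (hfinD R)).2 fun e _ => hrv e
    have g5 := (eventually_all_finite (hfinV R)).2 fun n _ => hvm n ε hε
    have g6 := (eventually_all_finite (hfinD R)).2 fun e _ => hdm e ε hε
    filter_upwards [g1, g2, g3, g4, g5, g6, ho] with i g1 g2 g3 g4 g5 g6 ho
    have memV : ∀ v, v ∈ (N i).net.cball (N i).root R →
        ∀ᶠ j in (U : Filter ι), ∃ w, vl j w = vl i v := fun v hv =>
      g1 _ (hvF i v R hv) ⟨v, rfl⟩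
    have memD : ∀ v, v ∈ (N i).net.eball (N i).root R →
        ∀ᶠ j in (U : Filter ι), ∃ w, el j w = el i v := fun v hv =>
      g2 _ (heF i v R hv) ⟨v, rfl⟩
    let fV : (N i).net.cball (N i).root R → M.cball o R := fun v =>
      ⟨⟨vl i v.1, memV v.1 v.2⟩, (hball _ _).2 (((hvl i v.1).2 R).1 v.2)⟩
    let fD : (N i).net.eball (N i).root R → M.eball o R := fun v =>
      ⟨⟨el i v.1, memD v.1 v.2⟩, (heball _ _).2 (((hel i v.1).2 R).1 v.2)⟩
    have bV : Function.Bijective fV := by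
      refine ⟨fun v w h => Subtype.ext (vinj i ?_), fun n => ?_⟩
      · exact congrArg (fun n => n.1.1) h
      · obtain ⟨y, ⟨v, hv, -⟩, -⟩ := g5 n.1 ((hball _ _).1 n.2)
        exact ⟨⟨v, ((hvl i v).2 R).2 (hv ▸ (hball _ _).1 n.2)⟩, Subtype.ext (Subtype.ext hv)⟩
    have bD : Function.Bijective fD := by
      refine ⟨fun v w h => Subtype.ext (einj i ?_), fun n => ?_⟩
      · exact congrArg (fun n => n.1.1) h
      · obtain ⟨y, ⟨v, hv, -⟩, -⟩ := g6 n.1 ((heball _ _).1 n.2)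
        exact ⟨⟨v, ((hel i v).2 R).2 (hv ▸ (heball _ _).1 n.2)⟩, Subtype.ext (Subtype.ext hv)⟩
    refine ⟨⟨Equiv.ofBijective fV bV, Equiv.ofBijective fD bD, fun d => ?_, fun d => ?_⟩,
      fun v => ?_, fun d => ?_, fun j v => ?_⟩
    · obtain ⟨d', h1, h2⟩ := g3 (fD d).1 ((heball _ _).1 (fD d).2)
      obtain rfl : d' = d.1 := einj i h1
      exact Subtype.ext (Subtype.ext h2.symm)
    · obtain ⟨d', h1, h2⟩ := g4 (fD d).1 ((heball _ _).1 (fD d).2)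
      obtain rfl : d' = d.1 := einj i h1
      exact Subtype.ext (Subtype.ext h2.symm)
    · obtain ⟨y, ⟨w, hw, rfl⟩, h⟩ := g5 (fV v).1 ((hball _ _).1 (fV v).2)
      obtain rfl : w = v.1 := vinj i hw
      exact h
    · obtain ⟨y, ⟨w, hw, rfl⟩, h⟩ := g6 (fD d).1 ((heball _ _).1 (fD d).2)
      obtain rfl : w = d.1 := einj i hw
      exact h
    · obtain rfl : j = 0 := Subsingleton.elim (α := Fin 1) _ _
      change v.1 = (N i).root ↔ (fV v).1 = o
      rw [Subtype.ext_iff, ← ho]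
      exact ((vinj i).eq_iff).symm

end PointedNetwork

/-! ### Compact sets of networks and tightness. -/

namespace PointedNetwork

open Network Filter Topology

variable {Ξ : Type*} {r D : ℕ} {T T' : Set Ξ}

theorem BallIn.of_iso {N M : PointedNetwork Ξ 0} (h : BallIn r D T N)
    (φ : (N.net.ball N.root r).Iso (M.net.ball M.root r))
    (hv : ∀ v, (N.net.ball N.root r).vmark v ∈ T → (M.net.ball M.root r).vmark (φ.onV v) ∈ T')
    (hd : ∀ d, (N.net.ball N.root r).dmark d ∈ T → (M.net.ball M.root r).dmark (φ.onD d) ∈ T') :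
    BallIn r D T' M := by
  obtain ⟨h1, h2, h3, h4⟩ := h
  have e1 : (N.net.cball N.root r).encard = (M.net.cball M.root r).encard :=
    Set.encard_congr φ.onV
  have e2 : (N.net.eball N.root r).encard = (M.net.eball M.root r).encard :=
    Set.encard_congr φ.onD
  refine ⟨e1 ▸ h1, e2 ▸ h2, fun v hv' => ?_, fun d hd' => ?_⟩
  · obtain ⟨w, hw⟩ := φ.onV.surjective ⟨v, hv'⟩
    have := hv w (h3 w.1 w.2)
    rwa [hw] at this
  · obtain ⟨w, hw⟩ := φ.onD.surjective ⟨d, hd'⟩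
    have := hd w (h4 w.1 w.2)
    rwa [hw] at this

theorem ballIn_congr {N M : PointedNetwork Ξ 0} (h : N ≈ M) :
    BallIn r D T N ↔ BallIn r D T M := by
  have aux : ∀ {N M : PointedNetwork Ξ 0}, N ≈ M → BallIn r D T N → BallIn r D T M := by
    intro N M h hN
    obtain ⟨φ, h1, h2, -⟩ := exists_ball_iso_of_equiv h r
    exact hN.of_iso φ (fun v hv => by rwa [h1]) (fun v hv => by rwa [h2])
  exact ⟨aux h, aux (Setoid.symm h)⟩

theorem BallIn.mono {N : PointedNetwork Ξ 0} {D' : ℕ} (h : BallIn r D T N) (hD : D ≤ D')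
    (hT : T ⊆ T') : BallIn r D' T' N :=
  ⟨h.1.trans (Nat.cast_le.2 hD), h.2.1.trans (Nat.cast_le.2 hD), fun v hv => hT (h.2.2.1 v hv),
    fun d hd => hT (h.2.2.2 d hd)⟩

/-- The marks in a ball. -/
def ballMarks (N : PointedNetwork Ξ 0) (r : ℕ) : Set Ξ :=
  N.net.vmark '' N.net.cball N.root r ∪ N.net.dmark '' N.net.eball N.root r

theorem finite_ballMarks (N : PointedNetwork Ξ 0) (r : ℕ) : (N.ballMarks r).Finite :=
  ((finite_cball N.locallyFinite r N.root).image _).union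
    ((finite_eball N.locallyFinite r N.root).image _)

theorem ballIn_iff_ballMarks {N : PointedNetwork Ξ 0} :
    BallIn r D T N ↔ (N.net.cball N.root r).encard ≤ D ∧ (N.net.eball N.root r).encard ≤ D ∧
      N.ballMarks r ⊆ T := by
  simp only [BallIn, ballMarks, Set.union_subset_iff, Set.image_subset_iff]
  rfl

variable [MetricSpace Ξ]

theorem BallIn.thickening {N M : PointedNetwork Ξ 0} (h : BallIn r D T N) {ε : ℝ}
    (hNM : CloseWith r ε N M) : BallIn r D (Metric.thickening ε T) M := by
  obtain ⟨φ, h1, h2, -⟩ := hNM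
  exact h.of_iso φ (fun v hv => Metric.mem_thickening_iff.2 ⟨_, hv, by rw [dist_comm]; exact h1 v⟩)
    (fun d hd => Metric.mem_thickening_iff.2 ⟨_, hd, by rw [dist_comm]; exact h2 d⟩)

/-- A closed set is the intersection of its thickenings. In this way bounds known only up to a small
mark error pass to a limit. -/
theorem ballIn_of_forall_thickening (hT : IsClosed T) {N : PointedNetwork Ξ 0}
    (h : ∀ ε > 0, BallIn r D (Metric.thickening ε T) N) : BallIn r D T N := by
  have key : ∀ x, (∀ ε > 0, x ∈ Metric.thickening ε T) → x ∈ T := fun x hx => by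
    rw [← hT.closure_eq, Metric.closure_eq_iInter_thickening]
    exact Set.mem_iInter₂.2 hx
  exact ⟨(h 1 one_pos).1, (h 1 one_pos).2.1, fun v hv => key _ fun ε hε => (h ε hε).2.2.1 v hv,
    fun d hd => key _ fun ε hε => (h ε hε).2.2.2 d hd⟩

end PointedNetwork

namespace NetworkSpace

open Network PointedNetwork Filter Topology

variable {Ξ Ξ' : Type*}

/-- The networks with `BallIn r D T`. -/
def ballInSet (r D : ℕ) (T : Set Ξ) : Set (NetworkSpace Ξ 0) := {a | BallIn r D T a.rep}

theorem mk_mem_ballInSet {r D : ℕ} {T : Set Ξ} {N : PointedNetwork Ξ 0} :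
    mk N ∈ ballInSet r D T ↔ BallIn r D T N := ballIn_congr (rep_mk N)

/-- The networks with `BoundedBy D C`. -/
def boundedSet (D : ℕ → ℕ) (C : ℕ → Set Ξ) : Set (NetworkSpace Ξ 0) := ⋂ r, ballInSet r (D r) (C r)

theorem mk_mem_boundedSet {D : ℕ → ℕ} {C : ℕ → Set Ξ} {N : PointedNetwork Ξ 0} :
    mk N ∈ boundedSet D C ↔ BoundedBy D C N := by
  simp only [boundedSet, Set.mem_iInter, mk_mem_ballInSet, BoundedBy]

/-- Both coordinates live on the same graph, so `D₁` alone bounds the balls. -/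
theorem map_preimage_boundedSet_subset {D₁ D₂ : ℕ → ℕ} {C₁ : ℕ → Set Ξ} {C₂ : ℕ → Set Ξ'} :
    map Prod.fst ⁻¹' boundedSet D₁ C₁ ∩ map Prod.snd ⁻¹' boundedSet D₂ C₂ ⊆
      boundedSet D₁ fun r => C₁ r ×ˢ C₂ r := by
  rintro a ⟨h1, h2⟩
  obtain ⟨N, rfl⟩ := exists_mk_eq a
  rw [Set.mem_preimage, map_mk, mk_mem_boundedSet] at h1 h2
  rw [mk_mem_boundedSet]
  exact fun r => ⟨(h1 r).1, (h1 r).2.1, fun v hv => ⟨(h1 r).2.2.1 v hv, (h2 r).2.2.1 v hv⟩,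
    fun d hd => ⟨(h1 r).2.2.2 d hd, (h2 r).2.2.2 d hd⟩⟩

variable [MetricSpace Ξ] [MetricSpace Ξ']

theorem isOpen_ballInSet (r D : ℕ) {T : Set Ξ} (hT : IsOpen T) : IsOpen (ballInSet r D T) := by
  refine isOpen_iff_mem_nhds.2 fun a ha => ?_
  obtain ⟨N, rfl⟩ := exists_mk_eq a
  obtain ⟨h1, h2, h3⟩ := ballIn_iff_ballMarks.1 (mk_mem_ballInSet.1 ha)
  obtain ⟨ε, hε, h⟩ := (N.finite_ballMarks r).isCompact.exists_thickening_subset_open hT h3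
  refine mem_nhds_of_closeWith (n := r) hε fun M hM => mk_mem_ballInSet.2 ?_
  exact ((ballIn_iff_ballMarks.2 ⟨h1, h2, subset_rfl⟩).thickening hM).mono le_rfl h

theorem isCompact_boundedSet (D : ℕ → ℕ) {C : ℕ → Set Ξ} (hC : ∀ r, IsCompact (C r)) :
    IsCompact (boundedSet D C) := by
  classical
  refine isCompact_iff_ultrafilter_le_nhds.2 fun U hU => ?_
  rw [le_principal_iff] at hU
  obtain ⟨a₀, ha₀⟩ := U.nonempty_of_mem hU
  have hrep : ∀ a ∈ boundedSet D C, BoundedBy D C a.rep := fun a ha => by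
    rwa [← mk_mem_boundedSet, mk_rep]
  obtain ⟨M, hM⟩ := exists_ultrafilter_limit U (D := D) hC
    -- The limit lemma asks for bounds at every index, so classes outside the set are replaced by a
    -- fixed member.
    (fun a => if a ∈ boundedSet D C then a.rep else a₀.rep) (fun a => by
      split_ifs with h
      · exact hrep a h
      · exact hrep a₀ ha₀)
  have hM' : ∀ (R : ℕ) (ε : ℝ), 0 < ε →
      ∀ᶠ a in (U : Filter (NetworkSpace Ξ 0)), a ∈ boundedSet D C ∧ CloseWith R ε a.rep M := by
    intro R ε hε
    filter_upwards [hM R ε hε, hU] with a h1 h2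
    rw [if_pos h2] at h1
    exact ⟨h2, h1⟩
  refine ⟨mk M, ?_, ?_⟩
  · rw [mk_mem_boundedSet]
    refine fun r => ballIn_of_forall_thickening (hC r).isClosed fun ε hε => ?_
    obtain ⟨a, h1, h2⟩ := (hM' r ε hε).exists
    exact (hrep a h1 r).thickening h2
  · intro s hs
    obtain ⟨n, hn⟩ := mem_nhds_iff.1 hs
    filter_upwards [hM' n (1 / (n + 1)) (by positivity)] with a ha
    rw [← mk_rep a]
    exact hn _ ha.2.symm

theorem exists_measure_compl_le {α : Type*} [MeasurableSpace α] (μ : Measure α) [IsFiniteMeasure μ]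
    {S : ℕ → Set α} (hS : Monotone S) (hm : ∀ n, MeasurableSet (S n)) (hU : ⋃ n, S n = Set.univ)
    {δ : ℝ≥0∞} (hδ : 0 < δ) : ∃ n, μ (S n)ᶜ < δ := by
  have := tendsto_measure_iInter_atTop (μ := μ) (s := fun n => (S n)ᶜ)
    (fun n => (hm n).compl.nullMeasurableSet) (fun _ _ h => Set.compl_subset_compl.2 (hS h))
    ⟨0, measure_ne_top _ _⟩
  rw [← Set.compl_iUnion, hU, Set.compl_univ, measure_empty] at this
  exact ((tendsto_order.1 this).2 δ hδ).exists

/-- This is Ulam's argument: for each radius `r` and precision `1 / (m + 1)`, outside small measure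
the marks in the ball are covered by finitely many metric balls about points of a dense sequence.
Intersecting over `m` gives a totally bounded set, whose closure is compact by completeness. -/
theorem exists_boundedSet_measure_compl_le [CompleteSpace Ξ] [TopologicalSpace.SeparableSpace Ξ]
    (μ : Measure (GStar Ξ)) [IsProbabilityMeasure μ] {δ : ℝ≥0∞} (hδ : 0 < δ) :
    ∃ (D : ℕ → ℕ) (C : ℕ → Set Ξ), (∀ r, IsCompact (C r)) ∧ μ (boundedSet D C)ᶜ ≤ δ := by
  have : Nonempty Ξ := by
    obtain ⟨a⟩ := Measure.nonempty_of_neZero μ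
    exact ⟨a.rep.net.vmark a.rep.root⟩
  let q := TopologicalSpace.denseSeq Ξ
  let T : ℕ → ℕ → Set Ξ := fun m n => ⋃ i ∈ Set.Iic n, Metric.ball (q i) (1 / (m + 1))
  have hTo : ∀ m n, IsOpen (T m n) := fun m n => isOpen_biUnion fun _ _ => Metric.isOpen_ball
  have hTm : ∀ m, Monotone (T m) := fun m a b h =>
    Set.biUnion_subset_biUnion_left (Set.Iic_subset_Iic.2 h)
  have hTU : ∀ m x, ∃ n, x ∈ T m n := fun m x => by
    obtain ⟨i, hi⟩ := (TopologicalSpace.denseRange_denseSeq Ξ).exists_dist_lt x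
      (ε := 1 / ((m : ℝ) + 1)) (by positivity)
    exact ⟨i, Set.mem_biUnion (Set.mem_Iic.2 le_rfl) hi⟩
  have hS : ∀ r m, ⋃ n, ballInSet r n (T m n) = Set.univ := fun r m => by
    refine Set.eq_univ_of_forall fun a => Set.mem_iUnion.2 ?_
    obtain ⟨N, rfl⟩ := exists_mk_eq a
    simp only [mk_mem_ballInSet, ballIn_iff_ballMarks]
    have h1 := (finite_cball N.locallyFinite r N.root).encard_lt_top
    have h2 := (finite_eball N.locallyFinite r N.root).encard_lt_top
    choose n hn using hTU m
    obtain ⟨b, hb⟩ := ((N.finite_ballMarks r).image n).bddAbove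
    obtain ⟨c1, hc1⟩ := ENat.ne_top_iff_exists.1 h1.ne
    obtain ⟨c2, hc2⟩ := ENat.ne_top_iff_exists.1 h2.ne
    refine ⟨max b (max c1 c2), ?_, ?_, fun x hx => hTm m ?_ (hn x)⟩
    · rw [← hc1]; exact Nat.cast_le.2 (by omega)
    · rw [← hc2]; exact Nat.cast_le.2 (by omega)
    · exact (hb ⟨x, hx, rfl⟩).trans (le_max_left _ _)
  obtain ⟨δ', hδ', hsum⟩ := ENNReal.exists_pos_sum_of_countable hδ.ne' (ℕ × ℕ)
  have hn : ∀ p : ℕ × ℕ, ∃ n, μ (ballInSet p.1 n (T p.2 n))ᶜ < δ' p := fun p =>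
    exists_measure_compl_le μ (S := fun n => ballInSet p.1 n (T p.2 n))
      (fun a b h x hx => BallIn.mono hx h (hTm p.2 h))
      (fun n => (isOpen_ballInSet _ _ (hTo _ _)).measurableSet) (hS p.1 p.2)
      (ENNReal.coe_pos.2 (hδ' p))
  choose n hn using hn
  -- Any precision would do for the bound on the size of the ball; `m = 0` is chosen.
  refine ⟨fun r => n (r, 0), fun r => closure (⋂ m, T m (n (r, m))), fun r => ?_, ?_⟩
  · refine TotallyBounded.isCompact_of_isClosed ?_ isClosed_closure
    refine TotallyBounded.closure (Metric.totallyBounded_iff.2 fun ε hε => ?_)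
    obtain ⟨m, hm⟩ := exists_nat_one_div_lt hε
    refine ⟨q '' Set.Iic (n (r, m)), (Set.finite_Iic _).image _, ?_⟩
    rw [Set.biUnion_image]
    refine (Set.iInter_subset _ m).trans (Set.iUnion₂_mono fun i _ => Metric.ball_subset_ball hm.le)
  · calc μ (boundedSet _ _)ᶜ ≤ μ (⋃ p : ℕ × ℕ, (ballInSet p.1 (n p) (T p.2 (n p)))ᶜ) := by
          refine measure_mono ?_
          rw [← Set.compl_iInter, Set.compl_subset_compl]
          intro a ha
          obtain ⟨N, rfl⟩ := exists_mk_eq a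
          simp only [Set.mem_iInter, mk_mem_ballInSet, ballIn_iff_ballMarks] at ha
          rw [mk_mem_boundedSet]
          refine fun r => ballIn_iff_ballMarks.2 ⟨(ha (r, 0)).1, (ha (r, 0)).2.1, ?_⟩
          exact (Set.subset_iInter fun m => (ha (r, m)).2.2).trans subset_closure
      _ ≤ ∑' p, μ (ballInSet p.1 (n p) (T p.2 (n p)))ᶜ := measure_iUnion_le _
      _ ≤ ∑' p, (δ' p : ℝ≥0∞) := ENNReal.tsum_le_tsum fun p => (hn p).le
      _ ≤ δ := hsum.le

/-- The measures with given marginals form a tight set. -/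
theorem isTightMeasureSet_of_marginals [CompleteSpace Ξ] [TopologicalSpace.SeparableSpace Ξ]
    [CompleteSpace Ξ'] [TopologicalSpace.SeparableSpace Ξ']
    (μ₁ : Measure (GStar Ξ)) [IsProbabilityMeasure μ₁]
    (μ₂ : Measure (GStar Ξ')) [IsProbabilityMeasure μ₂] :
    IsTightMeasureSet {ν : Measure (GStar (Ξ × Ξ')) |
      ν.map (map Prod.fst) = μ₁ ∧ ν.map (map Prod.snd) = μ₂} := by
  refine isTightMeasureSet_iff_exists_isCompact_measure_compl_le.2 fun δ hδ => ?_
  have hδ2 : 0 < δ / 2 := ENNReal.half_pos hδ.ne'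
  obtain ⟨D₁, C₁, hC₁, h₁⟩ := exists_boundedSet_measure_compl_le μ₁ hδ2
  obtain ⟨D₂, C₂, hC₂, h₂⟩ := exists_boundedSet_measure_compl_le μ₂ hδ2
  refine ⟨_, isCompact_boundedSet D₁ fun r => (hC₁ r).prod (hC₂ r), ?_⟩
  rintro ν ⟨rfl, rfl⟩
  calc ν (boundedSet D₁ fun r => C₁ r ×ˢ C₂ r)ᶜ
      ≤ ν (map Prod.fst ⁻¹' (boundedSet D₁ C₁)ᶜ ∪ map Prod.snd ⁻¹' (boundedSet D₂ C₂)ᶜ) := by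
        refine measure_mono ?_
        rw [Set.preimage_compl, Set.preimage_compl, ← Set.compl_inter, Set.compl_subset_compl]
        exact map_preimage_boundedSet_subset
    _ ≤ _ := measure_union_le _ _
    _ ≤ δ / 2 + δ / 2 := add_le_add
        ((Measure.le_map_apply (measurable_map LipschitzWith.prod_fst).aemeasurable _).trans h₁)
        ((Measure.le_map_apply (measurable_map LipschitzWith.prod_snd).aemeasurable _).trans h₂)
    _ = δ := ENNReal.add_halves δ

end NetworkSpace

/-! ### Weak limits and the unimodular coupling. -/

namespace NetworkSpace

open Network PointedNetwork Filter Topology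
open scoped NNReal BoundedContinuousFunction

variable {Ξ : Type*} [MetricSpace Ξ] {k : ℕ}

/-- Close networks have matching `n`-balls about their roots, so locally this is a finite sum of
matched terms, each of which varies continuously. -/
theorem continuous_vsum {f : NetworkSpace Ξ (k + 1) → ℝ≥0∞} (hf : Continuous f) {n : ℕ}
    (hn : ∀ b, b ∉ within Ξ (k + 1) n → f b = 0) : Continuous (vsum f) := by
  refine continuous_iff_continuousAt.2 fun a => ?_
  obtain ⟨N, rfl⟩ := exists_mk_eq a
  intro s hs
  have hfin := finite_cball N.locallyFinite n N.root
  let _ : Fintype (N.net.cball N.root n) := hfin.fintype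
  rw [← tsum_cball hn, tsum_fintype] at hs
  have hc : Continuous fun y : N.net.cball N.root n → ℝ≥0∞ => ∑ x, y x := by fun_prop
  have h1 := hc.continuousAt.preimage_mem_nhds hs
  rw [nhds_pi, mem_pi] at h1
  obtain ⟨I, -, t, ht, hI⟩ := h1
  have h2 : ∀ x : N.net.cball N.root n, ∃ R : ℕ, ∀ M,
      CloseWith R (1 / (R + 1)) (N.addPt x.1) M → f (mk M) ∈ t x := fun x =>
    mem_nhds_iff.1 (hf.continuousAt.preimage_mem_nhds (ht x))
  choose R hR using h2
  refine mem_nhds_iff.2 ⟨max (Finset.univ.sup R) n, fun M hM => ?_⟩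
  obtain ⟨e, he⟩ := exists_equiv_cball hM (le_max_right _ n)
  rw [Set.mem_preimage, ← tsum_cball hn, ← e.tsum_eq, tsum_fintype]
  refine hI (show (fun x => f (mk (M.addPt (e x).1))) ∈ I.pi t from fun x _ => ?_)
  have hRx : R x ≤ max (Finset.univ.sup R) n :=
    (Finset.le_sup (Finset.mem_univ x)).trans (le_max_left _ _)
  refine hR x _ ((he x).mono hRx ?_)
  gcongr

theorem tendsto_lintegral_of_continuous {X ι : Type*} [TopologicalSpace X] [MeasurableSpace X]
    [OpensMeasurableSpace X] {L : Filter ι} {P : ι → ProbabilityMeasure X}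
    {Q : ProbabilityMeasure X} (h : Tendsto P L (𝓝 Q)) {f : X → ℝ≥0∞} (hf : Continuous f)
    {C : ℝ≥0∞} (hC : C ≠ ∞) (hfC : ∀ x, f x ≤ C) :
    Tendsto (fun i => ∫⁻ x, f x ∂(P i : Measure X)) L (𝓝 (∫⁻ x, f x ∂(Q : Measure X))) := by
  have hne : ∀ x, f x ≠ ∞ := fun x => ne_top_of_le_ne_top hC (hfC x)
  have hg : Continuous fun x => (f x).toNNReal :=
    continuous_iff_continuousAt.2 fun x =>
      (ENNReal.tendsto_toNNReal (hne x)).comp hf.continuousAt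
  have hle : ∀ x, ((f x).toNNReal : ℝ) ≤ C.toNNReal := fun x =>
    NNReal.coe_le_coe.2 (ENNReal.toNNReal_mono hC (hfC x))
  let g : X →ᵇ ℝ≥0 := BoundedContinuousFunction.mkOfBound ⟨_, hg⟩ C.toNNReal fun x y => by
    rw [NNReal.dist_eq, abs_le]
    have h1 := hle x
    have h2 := hle y
    have h3 := (f x).toNNReal.coe_nonneg
    have h4 := (f y).toNNReal.coe_nonneg
    constructor <;> simp only [ContinuousMap.coe_mk] <;> linarith
  have hgf : ∀ x, (g x : ℝ≥0∞) = f x := fun x => ENNReal.coe_toNNReal (hne x)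
  have := ProbabilityMeasure.tendsto_iff_forall_lintegral_tendsto.1 h g
  simpa only [hgf] using this

/-- Support in `nearSet` bounds both the range of the sum, giving continuity, and its size, by `C *
D`. Weak convergence therefore applies to the summed function. -/
theorem tendsto_lintegral_vsum {ι : Type*} {L : Filter ι} {P : ι → ProbabilityMeasure (GStar Ξ)}
    {Q : ProbabilityMeasure (GStar Ξ)} (h : Tendsto P L (𝓝 Q)) {g : NetworkSpace Ξ 1 → ℝ≥0∞}
    (hg : Continuous g) {C : ℝ≥0∞} (hC : C ≠ ∞) {r D : ℕ}
    (hgC : ∀ b, g b ≤ C * (nearSet Ξ r D).indicator 1 b) :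
    Tendsto (fun i => ∫⁻ a, vsum g a ∂(P i : Measure (GStar Ξ))) L
      (𝓝 (∫⁻ a, vsum g a ∂(Q : Measure (GStar Ξ)))) := by
  refine tendsto_lintegral_of_continuous h (C := C * D) (continuous_vsum hg (n := r) fun b hb => ?_)
    (ENNReal.mul_ne_top hC (ENNReal.natCast_ne_top D)) fun a => ?_
  · have := hgC b
    rw [Set.indicator_of_notMem fun hb' => hb hb'.1, mul_zero] at this
    exact le_antisymm this zero_le
  · refine (vsum_mono hgC a).trans ?_
    rw [vsum_const_mul]
    gcongr
    exact vsum_nearSet_le r D a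

/-- A weak limit of measures that obey the Mass-Transport Principle asymptotically is unimodular. -/
theorem isUnimodular_of_tendsto {ι : Type*} {L : Filter ι} [L.NeBot]
    {P : ι → ProbabilityMeasure (GStar Ξ)} {Q : ProbabilityMeasure (GStar Ξ)}
    (h : Tendsto P L (𝓝 Q)) {η : ℕ → ℕ → ι → ℝ≥0∞} (hη : ∀ r D, Tendsto (η r D) L (𝓝 0))
    (hP : ∀ (g : NetworkSpace Ξ 1 → ℝ≥0∞) (C : ℝ≥0∞) (r D : ℕ), Measurable g →
      (∀ b, g b ≤ C * (nearSet Ξ r D).indicator 1 b) → ∀ i,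
        ∫⁻ a, vsum g a ∂(P i : Measure (GStar Ξ)) ≤
          ∫⁻ a, vsum (fun b => g (reindex ![1, 0] b)) a ∂(P i : Measure (GStar Ξ)) +
            C * η r D i) :
    IsUnimodular (Q : Measure (GStar Ξ)) := by
  have hswap := continuous_reindex (Ξ := Ξ) ![(1 : Fin 2), 0]
  have hle : ∀ (g : NetworkSpace Ξ 1 → ℝ≥0∞) (C : ℝ≥0∞) (r D : ℕ), Continuous g → C ≠ ∞ →
      (∀ b, g b ≤ C * (nearSet Ξ r D).indicator 1 b) →
        ∫⁻ a, vsum g a ∂(Q : Measure (GStar Ξ)) ≤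
          ∫⁻ a, vsum (fun b => g (reindex ![1, 0] b)) a ∂(Q : Measure (GStar Ξ)) := by
    intro g C r D hg hC hgC
    have h1 := tendsto_lintegral_vsum h hg hC hgC
    have h2 := tendsto_lintegral_vsum h (g := fun b => g (reindex ![1, 0] b)) (hg.comp hswap) hC
      (r := r) (D := D) fun b =>
        (hgC _).trans_eq (congrArg (C * ·) (indicator_one_congr swap_mem_nearSet))
    have h3 := h2.add (ENNReal.Tendsto.const_mul (hη r D) (Or.inr hC))
    rw [mul_zero, add_zero] at h3
    exact le_of_tendsto_of_tendsto' h1 h3 (hP g C r D hg.measurable hgC)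
  have heq : ∀ (g : NetworkSpace Ξ 1 → ℝ≥0∞) (C : ℝ≥0∞) (r D : ℕ), Continuous g → C ≠ ∞ →
      (∀ b, g b ≤ C * (nearSet Ξ r D).indicator 1 b) →
        ∫⁻ a, vsum g a ∂(Q : Measure (GStar Ξ)) =
          ∫⁻ a, vsum (fun b => g (reindex ![1, 0] b)) a ∂(Q : Measure (GStar Ξ)) := by
    intro g C r D hg hC hgC
    refine le_antisymm (hle g C r D hg hC hgC) ?_
    refine (hle (fun b => g (reindex ![1, 0] b)) C r D (hg.comp hswap) hC fun b =>
        (hgC _).trans_eq (congrArg (C * ·) (indicator_one_congr swap_mem_nearSet))).trans_eq ?_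
    simp only [reindex_swap_swap]
  -- Unimodularity is invariance of the counting measure on pairs under exchange of the two
  -- vertices. It is checked on each `nearSet`, where the measure is finite and so determined by
  -- bounded continuous functions; since these sets are clopen, cutting off there preserves
  -- continuity.
  have hfwd : fwd (Q : Measure (GStar Ξ)) =
      (fwd (Q : Measure (GStar Ξ))).map (reindex ![1, 0]) := by
    refine (Measure.ext_iff_of_iUnion_eq_univ (s := fun p : ℕ × ℕ => nearSet Ξ p.1 p.2) ?_).2 ?_
    · refine Set.eq_univ_of_forall fun b => ?_
      obtain ⟨r, D, hb⟩ := exists_mem_nearSet b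
      exact Set.mem_iUnion.2 ⟨(r, D), hb⟩
    · rintro ⟨r, D⟩
      have hm := measurableSet_nearSet (Ξ := Ξ) r D
      have : IsFiniteMeasure ((fwd (Q : Measure (GStar Ξ))).restrict (nearSet Ξ r D)) :=
        ⟨by rw [Measure.restrict_apply_univ]; exact fwd_nearSet_lt_top _ r D⟩
      refine ext_of_forall_lintegral_eq_of_IsFiniteMeasure fun f => ?_
      have hf : Continuous fun b => (f b : ℝ≥0∞) := ENNReal.continuous_coe.comp f.continuous
      have hfi : Continuous ((nearSet Ξ r D).indicator fun b => (f b : ℝ≥0∞)) :=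
        (isClopen_nearSet r D).continuous_indicator hf
      obtain ⟨C, hC⟩ : ∃ C : ℝ≥0, ∀ b, f b ≤ C := ⟨nndist 0 f, f.apply_le_nndist_zero⟩
      rw [← lintegral_indicator hm, ← lintegral_indicator hm, lintegral_fwd _ hfi.measurable,
        lintegral_map hfi.measurable hswap.measurable,
        lintegral_fwd _ (f := fun b => (nearSet Ξ r D).indicator (fun b => (f b : ℝ≥0∞))
          (reindex ![1, 0] b)) (hfi.measurable.comp hswap.measurable)]
      refine heq _ C r D hfi ENNReal.coe_ne_top fun b => ?_
      by_cases hb : b ∈ nearSet Ξ r D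
      · simpa [hb] using hC b
      · simp [hb]
  refine isUnimodular_of_mtp fun f hf => ?_
  rw [← lintegral_fwd _ hf, ← lintegral_fwd _ (f := fun b => f (reindex ![1, 0] b)) (hf.comp hswap.measurable),
    ← lintegral_map hf hswap.measurable, ← hfwd]

/-- If `μ₁` is `R`-related to `μ₂`, both are unimodular and `μ₁` is amenable, then there is a
unimodular `R`-coupling. -/
theorem exists_unimodular_coupling [CompleteSpace Ξ] [TopologicalSpace.SeparableSpace Ξ]
    {R : Set (Ξ × Ξ)} (hR : IsClosed R) {μ₁ μ₂ : Measure (GStar Ξ)}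
    (hμ₁ : IsUnimodular μ₁) (hμ₂ : IsUnimodular μ₂) (ha₁ : IsAmenable μ₁)
    (hrel : IsRRelated R μ₁ μ₂) :
    ∃ ν : Measure (GStar (Ξ × Ξ)), IsRCoupling R μ₁ μ₂ ν ∧ IsUnimodular ν := by
  obtain ⟨ν, hν⟩ := hrel
  have := hμ₁.isProbabilityMeasure
  have := hμ₂.isProbabilityMeasure
  have hfst : Continuous (NetworkSpace.map (k := 0) (Prod.fst : Ξ × Ξ → Ξ)) :=
    continuous_map LipschitzWith.prod_fst
  have hsnd : Continuous (NetworkSpace.map (k := 0) (Prod.snd : Ξ × Ξ → Ξ)) :=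
    continuous_map LipschitzWith.prod_snd
  -- The three laws of the unmarked network coincide, so transports built from `μ₁` can be used on
  -- `ν` and have incoming mass 1 for `μ₂` as well.
  have hf1 : ν.map forget = μ₁.map forget := by
    rw [← hν.map_fst, Measure.map_map measurable_forget hfst.measurable]
    exact congrArg (ν.map ·) (funext fun a => (forget_map _ a).symm)
  have hf2 : ν.map forget = μ₂.map forget := by
    rw [← hν.map_snd, Measure.map_map measurable_forget hsnd.measurable]
    exact congrArg (ν.map ·) (funext fun a => (forget_map _ a).symm)
  choose t ht htν ht1 htd using fun n : ℕ =>
    exists_transport ha₁ (ε := ((n : ℝ≥0∞) + 1)⁻¹)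
      (ENNReal.inv_pos.2 (by exact_mod_cast ENNReal.natCast_ne_top (n + 1)))
  rw [← hf1] at htν ht1 htd
  let P : ℕ → ProbabilityMeasure (GStar (Ξ × Ξ)) := fun n =>
    ⟨moved ν (t n), isProbabilityMeasure_moved (ht n) (htν n)⟩
  have hP1 : ∀ n, (moved ν (t n)).map (map Prod.fst) = μ₁ := fun n =>
    map_moved hμ₁ LipschitzWith.prod_fst hν.map_fst (ht n) (hf1 ▸ ht1 n)
  have hP2 : ∀ n, (moved ν (t n)).map (map Prod.snd) = μ₂ := fun n =>
    map_moved hμ₂ LipschitzWith.prod_snd hν.map_snd (ht n) (hf2 ▸ ht1 n)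
  have hcomp : IsCompact (closure (Set.range P)) := by
    refine isCompact_closure_of_isTightMeasureSet
      ((isTightMeasureSet_of_marginals μ₁ μ₂).subset ?_)
    rintro _ ⟨_, ⟨n, rfl⟩, rfl⟩
    exact ⟨hP1 n, hP2 n⟩
  -- A limit along an ultrafilter avoids extracting a subsequence.
  obtain ⟨Q, -, hQ⟩ := hcomp.ultrafilter_le_nhds ((hyperfilter ℕ).map P)
    (le_principal_iff.2 (mem_map.2 (Eventually.of_forall fun n => subset_closure ⟨n, rfl⟩)))
  have hlim : Tendsto P (hyperfilter ℕ) (𝓝 Q) := hQ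
  refine ⟨Q, ⟨inferInstance, ?_, ?_, ?_⟩, ?_⟩
  · have hcl := isClosed_marksIn (k := 0) hR
    have h1 : ∀ n, (P n : Measure (GStar (Ξ × Ξ))) (marksIn R 0) = 1 := fun n =>
      (prob_compl_eq_zero_iff hcl.measurableSet).1 (moved_marksIn hR hν.marks_mem (ht n))
    -- Closedness of `R` enters here, through the portmanteau theorem for closed sets.
    have h2 := ProbabilityMeasure.limsup_measure_closed_le_of_tendsto hlim hcl
    simp only [h1, limsup_const] at h2
    exact (prob_compl_eq_zero_iff hcl.measurableSet).2 (le_antisymm prob_le_one h2)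
  · have h1 := ProbabilityMeasure.tendsto_map_of_tendsto_of_continuous P Q hlim hfst
    have h2 : ∀ n, (P n).map hfst.measurable.aemeasurable = ⟨μ₁, hμ₁.isProbabilityMeasure⟩ :=
      fun n => Subtype.ext (hP1 n)
    simp only [h2] at h1
    have h3 := tendsto_nhds_unique h1 tendsto_const_nhds
    exact congrArg Subtype.val h3
  · have h1 := ProbabilityMeasure.tendsto_map_of_tendsto_of_continuous P Q hlim hsnd
    have h2 : ∀ n, (P n).map hsnd.measurable.aemeasurable = ⟨μ₂, hμ₂.isProbabilityMeasure⟩ :=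
      fun n => Subtype.ext (hP2 n)
    simp only [h2] at h1
    have h3 := tendsto_nhds_unique h1 tendsto_const_nhds
    exact congrArg Subtype.val h3
  · refine isUnimodular_of_tendsto hlim
      (η := fun r D n => (D : ℝ≥0∞) * (D * ((n : ℝ≥0∞) + 1)⁻¹)) (fun r D => ?_)
      fun g C r D hg hgC n => (lintegral_moved_vsum_le (ht n) hg hgC).trans ?_
    · have h1 : Tendsto (fun n : ℕ => ((n : ℝ≥0∞) + 1)⁻¹) atTop (𝓝 0) := by
        have := (tendsto_add_atTop_iff_nat 1).2 ENNReal.tendsto_inv_nat_nhds_zero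
        exact_mod_cast this
      have h2 := (ENNReal.Tendsto.const_mul (ENNReal.Tendsto.const_mul h1
        (Or.inr (ENNReal.natCast_ne_top D))) (Or.inr (ENNReal.natCast_ne_top D)))
      rw [mul_zero, mul_zero] at h2
      exact h2.mono_left Nat.hyperfilter_le_atTop
    · change _ ≤ ∫⁻ a, vsum _ a ∂(moved ν (t n)) + _
      gcongr
      exact htd n r D

end NetworkSpace

theorem propositionp {Ξ : Type*} [MetricSpace Ξ] [CompleteSpace Ξ]
    [TopologicalSpace.SeparableSpace Ξ]
    (R : Set (Ξ × Ξ)) (hR : IsClosed R) (μ₁ μ₂ : Measure (GStar Ξ))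
    (hμ₁ : IsUnimodular μ₁) (hμ₂ : IsUnimodular μ₂)
    (ha₁ : IsAmenable μ₁) (ha₂ : IsAmenable μ₂)
    (hrel : IsRRelated R μ₁ μ₂) :
    ∃ ν : Measure (GStar (Ξ × Ξ)), IsRCoupling R μ₁ μ₂ ν ∧ IsUnimodular ν :=
  NetworkSpace.exists_unimodular_coupling hR hμ₁ hμ₂ ha₁ hrel
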